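/- Theorem 3.3. Let $\Omega\subset\mathbb{R}^d$, $d\ge 2$, be a bounded connected domain with $C^\infty$ boundary $\Gamma=\partial\Omega$ and Euclidean unit inner normal $\nu$, and let $c,n\in C^\infty(\overline\Omega)$ be real-valued with $c>0$ and $n>0$ on $\overline\Omega$. For every $k>0$ there is a constant $C>0$, depending only on $\Omega$, $c$, $n$ and $k$, such that the following holds for all $\lambda\in\mathbb{C}$ with $\operatorname{Re}\lambda\ge 1$, $|\operatorname{Im}\lambda|\le k$ and $\operatorname{Im}\lambda\ne 0$. Put $h=(\operatorname{Re}\lambda)^{-1}$. If $u\in H^2(\Omega)$, $v\in L^2(\Omega)$ and $f\in H^1(\Gamma)$ (all complex-valued) satisfy $$(\nabla c(x)\nabla+\lambda^2 n(x))u=\lambda v\ \text{ in }\Omega,\qquad u=f\ \text{ on }\Gamma,\qquad\qquad(3.1)$$ where $\nabla c\nabla u=\operatorname{div}(c\nabla u)$, then the semiclassical normal derivative $\omega=h\,\partial_\nu u|_\Gamma$ satisfies $$\|\omega\|_{0}\le C\,|\operatorname{Im}\lambda|^{-1}\left(\|v\|+\|f\|_{1,0}\right).$$ Here $\|\cdot\|$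 and $\|\cdot\|_0$ are the norms of $L^2(\Omega)$ and $L^2(\Gamma)$ (with the surface measure on $\Gamma$), and $\|f\|_{1,0}=\left(\|f\|_0^2+\|h\nabla_\Gamma f\|_0^2\right)^{1/2}$ is the semiclassical $H^1(\Gamma)$ norm, $\nabla_\Gamma$ being the tangential gradient; boundary values are taken in the sense of traces. -/

import Mathlib

open MeasureTheory Filter Topology
open scoped ContDiff

noncomputable section

namespace Helmholtz

variable {d : ℕ}

/-- `ρ` is a defining function of the domain `Ω` with smooth boundary: `ρ < 0` exactly in `Ω`,
`ρ = 0` exactly on the boundary (so `ρ > 0` outside the closure), and `dρ ≠ 0` on the boundary.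
A bounded open set has a smooth boundary iff it admits such a function. -/
structure IsDefiningFunction (Ω : Set (EuclideanSpace ℝ (Fin d)))
    (ρ : EuclideanSpace ℝ (Fin d) → ℝ) : Prop where
  smooth : ContDiff ℝ ∞ ρ
  neg_iff : ∀ x, ρ x < 0 ↔ x ∈ Ω
  zero_iff : ∀ x, ρ x = 0 ↔ x ∈ frontier Ω
  gradient_ne_zero : ∀ x ∈ frontier Ω, gradient ρ x ≠ 0

/-- A bounded connected domain with smooth boundary, given with a defining function. -/
structure IsSmoothBoundedDomain (Ω : Set (EuclideanSpace ℝ (Fin d)))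
    (ρ : EuclideanSpace ℝ (Fin d) → ℝ) : Prop where
  isOpen : IsOpen Ω
  isConnected : IsConnected Ω
  isBounded : Bornology.IsBounded Ω
  defining : IsDefiningFunction Ω ρ

/-- The Euclidean unit normal to the boundary, pointing into `{ρ < 0}`. -/
def innerNormal (ρ : EuclideanSpace ℝ (Fin d) → ℝ) (x : EuclideanSpace ℝ (Fin d)) :
    EuclideanSpace ℝ (Fin d) :=
  -(‖gradient ρ x‖⁻¹ • gradient ρ x)

/-- The surface measure of the boundary: `(d - 1)`-dimensional Hausdorff measure, normalized to
agree with Lebesgue measure on Euclidean spaces of dimension `d - 1`. -/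
def surfaceMeasure (Ω : Set (EuclideanSpace ℝ (Fin d))) :
    Measure (EuclideanSpace ℝ (Fin d)) :=
  (Measure.euclideanHausdorffMeasure (d - 1)).restrict (frontier Ω)

/-- The (classical) partial derivative `∂φ/∂xᵢ`. -/
def pderiv {F : Type*} [NormedAddCommGroup F] [NormedSpace ℝ F] (i : Fin d)
    (φ : EuclideanSpace ℝ (Fin d) → F) (x : EuclideanSpace ℝ (Fin d)) : F :=
  fderiv ℝ φ x (EuclideanSpace.single i 1)

/-- The `L²(μ)` norm; only used for functions in `L²(μ)`. -/
def l2norm (μ : Measure (EuclideanSpace ℝ (Fin d))) (w : EuclideanSpace ℝ (Fin d) → ℂ) : ℝ :=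
  (eLpNorm w 2 μ).toReal

/-- Convergence `wₖ → w` in `L²(μ)`. -/
def TendstoL2 (μ : Measure (EuclideanSpace ℝ (Fin d)))
    (wk : ℕ → EuclideanSpace ℝ (Fin d) → ℂ) (w : EuclideanSpace ℝ (Fin d) → ℂ) : Prop :=
  Tendsto (fun k => eLpNorm (fun x => wk k x - w x) 2 μ) atTop (𝓝 0)

/-- `w ∈ H¹(Ω)`, with weak partial derivatives `Dw i = ∂ᵢ w ∈ L²(Ω)`. -/
structure IsH1 (Ω : Set (EuclideanSpace ℝ (Fin d))) (w : EuclideanSpace ℝ (Fin d) → ℂ)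
    (Dw : Fin d → EuclideanSpace ℝ (Fin d) → ℂ) : Prop where
  memLp : MemLp w 2 (volume.restrict Ω)
  memLp_deriv : ∀ i, MemLp (Dw i) 2 (volume.restrict Ω)
  weak : ∀ i, ∀ φ : EuclideanSpace ℝ (Fin d) → ℝ, ContDiff ℝ ∞ φ → HasCompactSupport φ →
    tsupport φ ⊆ Ω →
      ∫ x in Ω, ((pderiv i φ x : ℝ) : ℂ) * w x = -∫ x in Ω, (φ x : ℂ) * Dw i x

/-- `u ∈ H²(Ω)`, with weak derivatives `Du j = ∂ⱼ u` and `D2u i j = ∂ᵢ ∂ⱼ u`. -/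
structure IsH2 (Ω : Set (EuclideanSpace ℝ (Fin d))) (u : EuclideanSpace ℝ (Fin d) → ℂ)
    (Du : Fin d → EuclideanSpace ℝ (Fin d) → ℂ)
    (D2u : Fin d → Fin d → EuclideanSpace ℝ (Fin d) → ℂ) : Prop where
  isH1 : IsH1 Ω u Du
  isH1_deriv : ∀ j, IsH1 Ω (Du j) (fun i => D2u i j)

/-- `(∇ c ∇ + λ² n) u = λ v` almost everywhere in `Ω`, where
`∇ c ∇ u = div (c ∇ u) = c Δ u + ∇c · ∇u` (`u ∈ H²(Ω)` and `c` is smooth). -/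
def SolvesHelmholtz (Ω : Set (EuclideanSpace ℝ (Fin d))) (c n : EuclideanSpace ℝ (Fin d) → ℝ)
    (lam : ℂ) (u : EuclideanSpace ℝ (Fin d) → ℂ)
    (Du : Fin d → EuclideanSpace ℝ (Fin d) → ℂ)
    (D2u : Fin d → Fin d → EuclideanSpace ℝ (Fin d) → ℂ)
    (v : EuclideanSpace ℝ (Fin d) → ℂ) : Prop :=
  ∀ᵐ x ∂(volume.restrict Ω),
    (∑ j, ((c x : ℂ) * D2u j j x + ((pderiv j c x : ℝ) : ℂ) * Du j x)) + lam ^ 2 * (n x : ℂ) * u x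
      = lam * v x

/-- `f ∈ L²(∂Ω)` is the trace on the boundary of `w ∈ H¹(Ω)` (with weak gradient `Dw`):
the trace map is the continuous extension to `H¹(Ω)` of the restriction of smooth functions. -/
def IsTrace (Ω : Set (EuclideanSpace ℝ (Fin d))) (w : EuclideanSpace ℝ (Fin d) → ℂ)
    (Dw : Fin d → EuclideanSpace ℝ (Fin d) → ℂ) (f : EuclideanSpace ℝ (Fin d) → ℂ) : Prop :=
  MemLp f 2 (surfaceMeasure Ω) ∧
  ∃ φ : ℕ → EuclideanSpace ℝ (Fin d) → ℂ,
    (∀ k, ContDiff ℝ ∞ (φ k)) ∧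
    TendstoL2 (volume.restrict Ω) φ w ∧
    (∀ i, TendstoL2 (volume.restrict Ω) (fun k => pderiv i (φ k)) (Dw i)) ∧
    TendstoL2 (surfaceMeasure Ω) φ f

/-- `η = ∂_ν u` on the boundary, for `u ∈ H²(Ω)`: `η = ∑ⱼ νⱼ γⱼ`, where `γⱼ` is the trace of
`∂ⱼ u ∈ H¹(Ω)` and `ν` is the inner unit normal. -/
def IsNormalDerivative (Ω : Set (EuclideanSpace ℝ (Fin d))) (ρ : EuclideanSpace ℝ (Fin d) → ℝ)
    (Du : Fin d → EuclideanSpace ℝ (Fin d) → ℂ)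
    (D2u : Fin d → Fin d → EuclideanSpace ℝ (Fin d) → ℂ)
    (η : EuclideanSpace ℝ (Fin d) → ℂ) : Prop :=
  ∃ γ : Fin d → EuclideanSpace ℝ (Fin d) → ℂ,
    (∀ j, IsTrace Ω (Du j) (fun i => D2u i j) (γ j)) ∧
    η =ᵐ[surfaceMeasure Ω] fun x => ∑ j, (innerNormal ρ x j : ℂ) * γ j x

/-- The `i`-th Euclidean component of the tangential gradient `∇φ - (∂_ν φ) ν` of a smooth
function. -/
def tangentialPderiv (ρ : EuclideanSpace ℝ (Fin d) → ℝ) (i : Fin d)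
    (φ : EuclideanSpace ℝ (Fin d) → ℂ) (x : EuclideanSpace ℝ (Fin d)) : ℂ :=
  pderiv i φ x - (innerNormal ρ x i : ℂ) * ∑ j, (innerNormal ρ x j : ℂ) * pderiv j φ x

/-- `f ∈ H¹(∂Ω)`, with tangential gradient `G`: `H¹(∂Ω)` is the completion of the smooth functions
on the boundary for the norm `(‖f‖² + ‖∇_tan f‖²)^{1/2}`. -/
def IsBoundaryH1 (Ω : Set (EuclideanSpace ℝ (Fin d))) (ρ : EuclideanSpace ℝ (Fin d) → ℝ)
    (f : EuclideanSpace ℝ (Fin d) → ℂ) (G : Fin d → EuclideanSpace ℝ (Fin d) → ℂ) : Prop :=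
  MemLp f 2 (surfaceMeasure Ω) ∧ (∀ i, MemLp (G i) 2 (surfaceMeasure Ω)) ∧
  ∃ φ : ℕ → EuclideanSpace ℝ (Fin d) → ℂ,
    (∀ k, ContDiff ℝ ∞ (φ k)) ∧
    TendstoL2 (surfaceMeasure Ω) φ f ∧
    ∀ i, TendstoL2 (surfaceMeasure Ω) (fun k => tangentialPderiv ρ i (φ k)) (G i)

/-- The semiclassical `H¹(∂Ω)` norm `(‖f‖² + ∑ᵢ ‖h Gᵢ‖²)^{1/2}` of a function `f` with
tangential gradient `G`. -/
def boundaryH1Norm (Ω : Set (EuclideanSpace ℝ (Fin d))) (h : ℝ)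
    (f : EuclideanSpace ℝ (Fin d) → ℂ) (G : Fin d → EuclideanSpace ℝ (Fin d) → ℂ) : ℝ :=
  Real.sqrt (l2norm (surfaceMeasure Ω) f ^ 2 +
    ∑ i, l2norm (surfaceMeasure Ω) (fun x => (h : ℂ) * G i x) ^ 2)

end Helmholtz

end

/-! The proof combines an energy identity with a Rellich identity. Write `h = 1 / Re λ` and `a = |Im
λ|`; constants depend only on the domain, the coefficients and `k`.

Energy: test the equation with `ū`. Since `Im λ² = 2 Re λ Im λ`, the imaginary part gives `a ‖u‖² ≲
‖v‖ ‖u‖ + ‖ω‖ ‖f‖`, and the real part gives `‖h∇u‖² ≲ ‖u‖² + ‖v‖ ‖u‖ + ‖ω‖ ‖f‖` (`energy_identity`,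
`exists_energy_estimates`).

Rellich: test with `∇ρ · ∇ū` and take real parts. Second derivatives disappear after integration by
parts. The boundary density is `c (|∇ρ · ∇u|² - |∇ρ|² |∇u|² / 2)`, in which the normal derivative
enters with a plus sign and the tangential gradient, known from `f`, with a minus sign
(`rellich_identity`, `exists_rellichBoundary_ge`). The zero-order term seems one power of `Re λ` too
large, but `2 Re (u ∂ū) = ∂|u|²` allows another integration by parts for the part with `Re λ²`, and
`Im λ²` has only one power of `Re λ` (`exists_rellichBoundary_le`). Hence `‖ω‖² ≲ ‖f‖² + ‖h∇_Γ f‖² +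
‖u‖² + ‖h∇u‖² + (‖u‖ + ‖v‖) ‖h∇u‖`. Multiplying by `a²`, inserting the energy bounds and absorbing
`a ‖ω‖ ‖f‖` gives the theorem (`sq_mul_sq_le_of_estimates`).

All integrations by parts rest on a divergence theorem. A cutoff in `ρ / ε` turns the integral of a
derivative over the domain into an average over the layer `-2ε ≤ ρ ≤ -ε`. In charts with `ρ` as a
coordinate these averages converge as `ε → 0`, and the limits glue to a boundary measure `τ`
(`exists_isConormalMeasure`). Its exact density is never needed: two-sided comparability with the
surface measure suffices, because only norm bounds are transferred. Traces enter through smooth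
approximation. The tangential part of the trace of `∇u` is identified with the gradient of `f` by
duality (`tangential_eq_of_boundaryH1`), as the two approximating sequences are unrelated. -/

noncomputable section

namespace Helmholtz

/-! ### Splitting off one coordinate -/

section Coordinates

variable {m : ℕ}

/-- The coordinates of `ℝ^(m+1)` given by all coordinates but the `i`-th, and the `i`-th one. -/
def insertCoord (i : Fin (m + 1)) :
    EuclideanSpace ℝ (Fin m) × ℝ ≃ᵐ EuclideanSpace ℝ (Fin (m + 1)) :=
  (((MeasurableEquiv.toLp 2 (Fin m → ℝ)).symm.prodCongr (MeasurableEquiv.refl ℝ)).trans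
    MeasurableEquiv.prodComm).trans
    ((MeasurableEquiv.piFinSuccAbove (fun _ : Fin (m + 1) => ℝ) i).symm.trans
      (MeasurableEquiv.toLp 2 (Fin (m + 1) → ℝ)))

theorem insertCoord_apply (i : Fin (m + 1)) (z : EuclideanSpace ℝ (Fin m) × ℝ) :
    insertCoord i z = WithLp.toLp 2 (i.insertNth z.2 (WithLp.ofLp z.1) : Fin (m + 1) → ℝ) := rfl

@[simp]
theorem insertCoord_apply_same (i : Fin (m + 1)) (z : EuclideanSpace ℝ (Fin m) × ℝ) :
    insertCoord i z i = z.2 := by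
  simp [insertCoord_apply]

@[simp]
theorem insertCoord_apply_succAbove (i : Fin (m + 1)) (z : EuclideanSpace ℝ (Fin m) × ℝ)
    (j : Fin m) : insertCoord i z (i.succAbove j) = z.1 j := by
  simp [insertCoord_apply]

theorem continuous_insertCoord (i : Fin (m + 1)) : Continuous (insertCoord i) := by
  have h : Continuous fun z : EuclideanSpace ℝ (Fin m) × ℝ =>
      (i.insertNth z.2 (WithLp.ofLp z.1) : Fin (m + 1) → ℝ) := by fun_prop
  exact (PiLp.continuous_toLp 2 _).comp h

theorem measurePreserving_insertCoord (i : Fin (m + 1)) :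
    MeasurePreserving (insertCoord i) volume volume := by
  have h1 : MeasurePreserving (MeasurableEquiv.toLp 2 (Fin m → ℝ)).symm volume volume :=
    EuclideanSpace.volume_preserving_symm_measurableEquiv_toLp _
  have h2 : MeasurePreserving (MeasurableEquiv.toLp 2 (Fin (m + 1) → ℝ)) volume volume :=
    (EuclideanSpace.volume_preserving_symm_measurableEquiv_toLp _).symm
  have h3 := (volume_preserving_piFinSuccAbove (fun _ : Fin (m + 1) => ℝ) i).symm
  have h4 : MeasurePreserving ((MeasurableEquiv.toLp 2 (Fin m → ℝ)).symm.prodCongr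
      (MeasurableEquiv.refl ℝ)) volume volume :=
    h1.prod (MeasurePreserving.id (volume : Measure ℝ))
  have h5 : MeasurePreserving (MeasurableEquiv.prodComm : (Fin m → ℝ) × ℝ ≃ᵐ ℝ × (Fin m → ℝ))
      volume volume := Measure.measurePreserving_swap
  exact (h2.comp h3).comp (h5.comp h4)

/-- All coordinates of a vector but the `i`-th. -/
def dropCoord (i : Fin (m + 1)) (x : EuclideanSpace ℝ (Fin (m + 1))) :
    EuclideanSpace ℝ (Fin m) :=
  WithLp.toLp 2 fun j => x (i.succAbove j)

@[simp]
theorem dropCoord_apply (i : Fin (m + 1)) (x : EuclideanSpace ℝ (Fin (m + 1))) (j : Fin m) :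
    dropCoord i x j = x (i.succAbove j) := rfl

@[simp]
theorem dropCoord_insertCoord (i : Fin (m + 1)) (z : EuclideanSpace ℝ (Fin m) × ℝ) :
    dropCoord i (insertCoord i z) = z.1 := by
  ext j; simp

theorem lipschitzWith_dropCoord (i : Fin (m + 1)) :
    LipschitzWith 1 (dropCoord i : EuclideanSpace ℝ (Fin (m + 1)) → _) := by
  refine LipschitzWith.of_dist_le_mul fun x y => ?_
  rw [NNReal.coe_one, one_mul, EuclideanSpace.dist_eq, EuclideanSpace.dist_eq]
  refine Real.sqrt_le_sqrt ?_
  rw [Fin.sum_univ_succAbove _ i]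
  simp only [dropCoord_apply]
  have := sq_nonneg (dist (x i) (y i))
  linarith

theorem lipschitzWith_insertCoord_zero (i : Fin (m + 1)) :
    LipschitzWith 1 (fun y : EuclideanSpace ℝ (Fin m) => insertCoord i (y, 0)) := by
  refine LipschitzWith.of_dist_le_mul fun x y => ?_
  rw [NNReal.coe_one, one_mul, EuclideanSpace.dist_eq, EuclideanSpace.dist_eq]
  refine Real.sqrt_le_sqrt ?_
  rw [Fin.sum_univ_succAbove _ i]
  simp

end Coordinates

theorem euclideanHausdorffMeasure_image_le_of_lipschitzOnWith {X Y : Type*} [EMetricSpace X] [MeasurableSpace X]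
    [BorelSpace X] [EMetricSpace Y] [MeasurableSpace Y] [BorelSpace Y] {K : NNReal} {f : X → Y}
    {s : Set X} (h : LipschitzOnWith K f s) (m : ℕ) :
    Measure.euclideanHausdorffMeasure m (f '' s) ≤
      (K : ENNReal) ^ m * Measure.euclideanHausdorffMeasure m s := by
  have := h.hausdorffMeasure_image_le (d := m) (by positivity)
  rw [ENNReal.rpow_natCast] at this
  simp only [Measure.euclideanHausdorffMeasure_def, Measure.smul_apply, ENNReal.smul_def,
    smul_eq_mul]
  calc _ ≤ _ := mul_le_mul_right this _
    _ = _ := by ring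

/-! ### Cutoff profile and concentration on a flat layer -/

/-- The cutoff profile: equal to `1` on `(-∞, -2]` and to `0` on `[-1, ∞)`. -/
def cutoffProfile (s : ℝ) : ℝ := Real.smoothTransition (-1 - s)

/-- Minus the derivative of the cutoff profile, a bump of integral `1` supported in `[-2, -1]`. -/
def layerKernel (s : ℝ) : ℝ := deriv Real.smoothTransition (-1 - s)

theorem hasDerivAt_cutoffProfile (s : ℝ) : HasDerivAt cutoffProfile (-layerKernel s) s := by
  have h := (Real.smoothTransition.contDiff (n := 1)).differentiable one_ne_zero (-1 - s)
  have h2 : HasDerivAt (fun s : ℝ => -1 - s) (-1) s := (hasDerivAt_id s).const_sub (-1)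
  have h3 := h.hasDerivAt.comp s h2
  rw [mul_neg_one] at h3
  exact h3

theorem continuous_layerKernel : Continuous layerKernel :=
  ((Real.smoothTransition.contDiff (n := 1)).continuous_deriv le_rfl).comp (by fun_prop)

theorem contDiff_cutoffProfile : ContDiff ℝ ∞ cutoffProfile :=
  Real.smoothTransition.contDiff.comp (by fun_prop)

theorem cutoffProfile_eq_one {s : ℝ} (hs : s ≤ -2) : cutoffProfile s = 1 :=
  Real.smoothTransition.one_of_one_le (by linarith)

theorem cutoffProfile_eq_zero {s : ℝ} (hs : -1 ≤ s) : cutoffProfile s = 0 :=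
  Real.smoothTransition.zero_of_nonpos (by linarith)

theorem abs_cutoffProfile_le_one (s : ℝ) : |cutoffProfile s| ≤ 1 :=
  abs_le.2 ⟨by linarith [Real.smoothTransition.nonneg (-1 - s), cutoffProfile.eq_def s],
    Real.smoothTransition.le_one _⟩

theorem layerKernel_eq_zero {s : ℝ} (hs : s ∉ Set.Icc (-2 : ℝ) (-1)) : layerKernel s = 0 := by
  have h1 := hasDerivAt_cutoffProfile s
  simp only [Set.mem_Icc, not_and_or, not_le] at hs
  rcases hs with hs | hs
  · have : cutoffProfile =ᶠ[𝓝 s] fun _ => 1 := by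
      filter_upwards [Iio_mem_nhds hs] with t ht using cutoffProfile_eq_one (le_of_lt ht)
    have := h1.unique ((hasDerivAt_const s (1 : ℝ)).congr_of_eventuallyEq this)
    linarith
  · have : cutoffProfile =ᶠ[𝓝 s] fun _ => 0 := by
      filter_upwards [Ioi_mem_nhds hs] with t ht using cutoffProfile_eq_zero (le_of_lt ht)
    have := h1.unique ((hasDerivAt_const s (0 : ℝ)).congr_of_eventuallyEq this)
    linarith

theorem hasCompactSupport_layerKernel : HasCompactSupport layerKernel :=
  HasCompactSupport.intro isCompact_Icc fun _ hs => layerKernel_eq_zero hs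

theorem integral_layerKernel : ∫ s, layerKernel s = 1 := by
  have h1 : ∫ s in (-2 : ℝ)..(-1), -layerKernel s = cutoffProfile (-1) - cutoffProfile (-2) :=
    intervalIntegral.integral_eq_sub_of_hasDerivAt (fun s _ => hasDerivAt_cutoffProfile s)
      (continuous_layerKernel.neg.intervalIntegrable _ _)
  rw [cutoffProfile_eq_zero le_rfl, cutoffProfile_eq_one le_rfl, intervalIntegral.integral_neg,
    intervalIntegral.integral_of_le (by norm_num), ← integral_Icc_eq_integral_Ioc,
    setIntegral_eq_integral_of_forall_compl_eq_zero fun s hs => layerKernel_eq_zero hs] at h1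
  linarith

/-- Rescaling the normal variable by `ε` turns the weight into the fixed kernel of integral `1` and
the argument into `(y, ε t)`. Dominated convergence, first in `t` and then in `y`, concludes. -/
theorem tendsto_integral_flat_layer {Y : Type*} [TopologicalSpace Y] [T2Space Y] [MeasurableSpace Y]
    [BorelSpace Y] [SecondCountableTopology Y]
    (μ : Measure Y) [SigmaFinite μ] [IsFiniteMeasureOnCompacts μ]
    {G : Y × ℝ → ℂ} (hG : Continuous G) (hGc : HasCompactSupport G) :
    Tendsto (fun ε : ℝ => ∫ z, (ε⁻¹ * layerKernel (z.2 / ε)) • G z ∂(μ.prod volume)) (𝓝[>] 0)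
      (𝓝 (∫ y, G (y, 0) ∂μ)) := by
  obtain ⟨M, hM⟩ := hGc.exists_bound_of_continuous hG
  set K : Set Y := Prod.fst '' tsupport G with hK
  have hKc : IsCompact K := hGc.isCompact.image continuous_fst
  have hG0 : ∀ y ∉ K, ∀ t, G (y, t) = 0 := fun y hy t => by
    by_contra h
    exact hy ⟨(y, t), subset_tsupport _ h, rfl⟩
  have hint : Integrable layerKernel := continuous_layerKernel.integrable_of_hasCompactSupport
    hasCompactSupport_layerKernel
  have key : ∀ ε : ℝ, 0 < ε →
      ∫ z, (ε⁻¹ * layerKernel (z.2 / ε)) • G z ∂(μ.prod volume)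
        = ∫ y, (∫ t, layerKernel t • G (y, ε * t)) ∂μ := by
    intro ε hε
    rw [integral_prod]
    · refine integral_congr_ae (Eventually.of_forall fun y => ?_)
      have := Measure.integral_comp_div (fun t => layerKernel t • G (y, ε * t)) ε
      simp only [mul_div_cancel₀ _ hε.ne', abs_of_pos hε] at this
      calc _ = ∫ s, ε⁻¹ • (layerKernel (s / ε) • G (y, s)) := by simp_rw [mul_smul]
        _ = _ := by
          rw [integral_smul, this, smul_smul, inv_mul_cancel₀ hε.ne', one_smul]
    · have hc : Continuous fun z : Y × ℝ => (ε⁻¹ * layerKernel (z.2 / ε)) • G z :=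
        (continuous_const.mul (continuous_layerKernel.comp (by fun_prop))).smul hG
      have hs : HasCompactSupport fun z : Y × ℝ => (ε⁻¹ * layerKernel (z.2 / ε)) • G z :=
        hGc.mono fun z hz h0 => hz (by simp [h0])
      exact hc.integrable_of_hasCompactSupport hs
  have lim : Tendsto (fun ε : ℝ => ∫ y, (∫ t, layerKernel t • G (y, ε * t)) ∂μ) (𝓝 0)
      (𝓝 (∫ y, G (y, 0) ∂μ)) := by
    refine tendsto_integral_filter_of_dominated_convergence
      (K.indicator fun _ => M * ∫ t, ‖layerKernel t‖) ?_ ?_ ?_ ?_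
    · refine Eventually.of_forall fun ε => ?_
      have hc : Continuous fun z : Y × ℝ => layerKernel z.2 • G (z.1, ε * z.2) :=
        (continuous_layerKernel.comp continuous_snd).smul (hG.comp (by fun_prop))
      exact (hc.stronglyMeasurable.integral_prod_right).aestronglyMeasurable
    · refine Eventually.of_forall fun ε => Eventually.of_forall fun y => ?_
      by_cases hy : y ∈ K
      · rw [Set.indicator_of_mem hy, ← integral_const_mul]
        refine norm_integral_le_of_norm_le (hint.norm.const_mul M) ?_
        refine Eventually.of_forall fun t => ?_
        rw [norm_smul, mul_comm]
        exact mul_le_mul_of_nonneg_right (hM _) (norm_nonneg _)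
      · simp [hG0 y hy, Set.indicator_of_notMem hy]
    · exact (integrable_indicator_iff hKc.measurableSet).2
        (integrableOn_const hKc.measure_lt_top.ne)
    · refine Eventually.of_forall fun y => ?_
      have : Tendsto (fun ε : ℝ => ∫ t, layerKernel t • G (y, ε * t)) (𝓝 0)
          (𝓝 (∫ t, layerKernel t • G (y, 0 * t))) := by
        refine tendsto_integral_filter_of_dominated_convergence (fun t => M * ‖layerKernel t‖)
          ?_ ?_ (hint.norm.const_mul M) ?_
        · exact Eventually.of_forall fun ε => (continuous_layerKernel.smul
            (hG.comp (by fun_prop))).aestronglyMeasurable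
        · refine Eventually.of_forall fun ε => Eventually.of_forall fun t => ?_
          rw [norm_smul, mul_comm]
          exact mul_le_mul_of_nonneg_right (hM _) (norm_nonneg _)
        · refine Eventually.of_forall fun t => ?_
          have h1 : Continuous fun ε : ℝ => G (y, ε * t) := hG.comp (by fun_prop)
          have : Continuous fun ε : ℝ => layerKernel t • G (y, ε * t) := by fun_prop
          exact this.tendsto 0
      simpa only [zero_mul, integral_smul_const, integral_layerKernel, one_smul] using this
  exact (lim.mono_left nhdsWithin_le_nhds).congr' (by
    filter_upwards [self_mem_nhdsWithin] with ε hε using (key ε hε).symm)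

end Helmholtz

end

noncomputable section

namespace Helmholtz

/-! ### Straightening the boundary -/

section Chart

variable {d : ℕ}

/-- The map replacing the `i`-th coordinate by `ρ`. -/
def straighten (ρ : EuclideanSpace ℝ (Fin d) → ℝ) (i : Fin d) (x : EuclideanSpace ℝ (Fin d)) :
    EuclideanSpace ℝ (Fin d) :=
  x + (ρ x - x i) • EuclideanSpace.single i 1

@[simp]
theorem straighten_apply_same (ρ : EuclideanSpace ℝ (Fin d) → ℝ) (i : Fin d)
    (x : EuclideanSpace ℝ (Fin d)) : straighten ρ i x i = ρ x := by
  simp [straighten]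

theorem straighten_apply_ne (ρ : EuclideanSpace ℝ (Fin d) → ℝ) {i j : Fin d} (hij : j ≠ i)
    (x : EuclideanSpace ℝ (Fin d)) : straighten ρ i x j = x j := by
  simp [straighten, hij]

/-- The derivative of `straighten ρ i`. -/
def straightenDeriv (ρ : EuclideanSpace ℝ (Fin d) → ℝ) (i : Fin d)
    (x : EuclideanSpace ℝ (Fin d)) : EuclideanSpace ℝ (Fin d) →L[ℝ] EuclideanSpace ℝ (Fin d) :=
  ContinuousLinearMap.id ℝ _ +
    (fderiv ℝ ρ x - EuclideanSpace.proj i).smulRight (EuclideanSpace.single i (1 : ℝ))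

theorem hasFDerivAt_straighten {ρ : EuclideanSpace ℝ (Fin d) → ℝ} {x : EuclideanSpace ℝ (Fin d)}
    (hρ : DifferentiableAt ℝ ρ x) (i : Fin d) :
    HasFDerivAt (straighten ρ i) (straightenDeriv ρ i x) x :=
  (hasFDerivAt_id x).add ((hρ.hasFDerivAt.sub
    (EuclideanSpace.proj i : EuclideanSpace ℝ (Fin d) →L[ℝ] ℝ).hasFDerivAt).smul_const _)

/-- The derivative is a transvection `v ↦ v + ℓ(v) eᵢ`, of determinant `1 + ℓ(eᵢ)`, with `ℓ(eᵢ) =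
∂ᵢρ - 1`. -/
theorem det_straightenDeriv (ρ : EuclideanSpace ℝ (Fin d) → ℝ) (i : Fin d)
    (x : EuclideanSpace ℝ (Fin d)) : (straightenDeriv ρ i x).det = pderiv i ρ x := by
  have : ((straightenDeriv ρ i x : EuclideanSpace ℝ (Fin d) →L[ℝ] EuclideanSpace ℝ (Fin d)) :
      EuclideanSpace ℝ (Fin d) →ₗ[ℝ] EuclideanSpace ℝ (Fin d)) =
      LinearMap.transvection ((fderiv ℝ ρ x - EuclideanSpace.proj i :
        EuclideanSpace ℝ (Fin d) →L[ℝ] ℝ) : EuclideanSpace ℝ (Fin d) →ₗ[ℝ] ℝ)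
        (EuclideanSpace.single i (1 : ℝ)) := by
    ext v
    simp [straightenDeriv, LinearMap.transvection]
  rw [ContinuousLinearMap.det, this, LinearMap.transvection.det]
  simp [pderiv]

theorem contDiff_straighten {ρ : EuclideanSpace ℝ (Fin d) → ℝ} (hρ : ContDiff ℝ ∞ ρ)
    (i : Fin d) : ContDiff ℝ ∞ (straighten ρ i) :=
  contDiff_id.add ((hρ.sub
    (EuclideanSpace.proj i : EuclideanSpace ℝ (Fin d) →L[ℝ] ℝ).contDiff).smul contDiff_const)

theorem contDiff_pderiv {F : Type*} [NormedAddCommGroup F] [NormedSpace ℝ F]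
    {φ : EuclideanSpace ℝ (Fin d) → F} (hφ : ContDiff ℝ ∞ φ) (i : Fin d) :
    ContDiff ℝ ∞ (pderiv i φ) :=
  (hφ.fderiv_right (m := ∞) (by norm_cast)).clm_apply contDiff_const

/-- The inverse function theorem, with the source shrunk for later use: the Lipschitz inverse serves
to compare Hausdorff measures, the unit ball to have a finite measure, and the two-sided bound on
`∂ᵢρ` to control the Jacobian weight. -/
theorem exists_straightening {ρ : EuclideanSpace ℝ (Fin d) → ℝ} (hρ : ContDiff ℝ ∞ ρ)
    {p : EuclideanSpace ℝ (Fin d)} {i : Fin d} (hi : pderiv i ρ p ≠ 0) :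
    ∃ (e : OpenPartialHomeomorph (EuclideanSpace ℝ (Fin d)) (EuclideanSpace ℝ (Fin d)))
      (L : NNReal), p ∈ e.source ∧ (e : _ → _) = straighten ρ i ∧
      LipschitzOnWith L e.symm e.target ∧ e.source ⊆ Metric.ball p 1 ∧
      ∀ x ∈ e.source, |pderiv i ρ p| / 2 < |pderiv i ρ x| ∧
        |pderiv i ρ x| < 2 * |pderiv i ρ p| := by
  have hdet : (straightenDeriv ρ i p).det ≠ 0 := by rwa [det_straightenDeriv]
  have hdiff : Differentiable ℝ ρ := hρ.differentiable (by simp)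
  have hf : ContDiffAt ℝ ∞ (straighten ρ i) p := (contDiff_straighten hρ i).contDiffAt
  have hf' : HasFDerivAt (straighten ρ i)
      (((straightenDeriv ρ i p).toContinuousLinearEquivOfDetNeZero hdet :
        EuclideanSpace ℝ (Fin d) ≃L[ℝ] EuclideanSpace ℝ (Fin d)) :
        EuclideanSpace ℝ (Fin d) →L[ℝ] EuclideanSpace ℝ (Fin d)) p := by
    rw [ContinuousLinearMap.coe_toContinuousLinearEquivOfDetNeZero]
    exact hasFDerivAt_straighten (hdiff p) i
  have h0 : (∞ : WithTop ℕ∞) ≠ 0 := by simp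
  set e := hf.toOpenPartialHomeomorph (straighten ρ i) hf' h0 with he
  have hp : p ∈ e.source := hf.mem_toOpenPartialHomeomorph_source hf' h0
  have hsymm : ContDiffAt ℝ ∞ e.symm (straighten ρ i p) := hf.to_localInverse hf' h0
  obtain ⟨L, T, hT, hL⟩ := (hsymm.of_le (m := 1) (by norm_cast)).exists_lipschitzOnWith
  have hq : Continuous fun x => |pderiv i ρ x| := (contDiff_pderiv hρ i).continuous.abs
  have hcont : Continuous (straighten ρ i) := (contDiff_straighten hρ i).continuous
  set s : Set (EuclideanSpace ℝ (Fin d)) :=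
    (straighten ρ i ⁻¹' interior T) ∩ (Metric.ball p 1 ∩
      ((fun x => |pderiv i ρ x|) ⁻¹' Set.Ioo (|pderiv i ρ p| / 2) (2 * |pderiv i ρ p|))) with hs
  have hso : IsOpen s := (isOpen_interior.preimage hcont).inter
    (Metric.isOpen_ball.inter (isOpen_Ioo.preimage hq))
  have hpos : 0 < |pderiv i ρ p| := abs_pos.2 hi
  refine ⟨e.restrOpen s hso, L, ?_, rfl, ?_, ?_, ?_⟩
  · rw [OpenPartialHomeomorph.restrOpen_source]
    refine ⟨hp, mem_interior_iff_mem_nhds.2 hT, Metric.mem_ball_self one_pos, ?_, ?_⟩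
    · change |pderiv i ρ p| / 2 < |pderiv i ρ p|; linarith
    · change |pderiv i ρ p| < 2 * |pderiv i ρ p|; linarith
  · refine hL.mono fun y hy => ?_
    have hy1 : e.symm y ∈ s ∧ y ∈ e.target := by
      have := (e.restrOpen s hso).map_target hy
      rw [OpenPartialHomeomorph.restrOpen_source] at this
      exact ⟨this.2, hy.1⟩
    have h2 : straighten ρ i (e.symm y) ∈ interior T := hy1.1.1
    have h3 : straighten ρ i (e.symm y) = y := e.right_inv hy1.2
    rw [h3] at h2
    exact interior_subset h2
  · rw [OpenPartialHomeomorph.restrOpen_source]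
    exact fun x hx => hx.2.2.1
  · rw [OpenPartialHomeomorph.restrOpen_source]
    exact fun x hx => hx.2.2.2

end Chart

end Helmholtz

end

noncomputable section

namespace Helmholtz

/-! ### Layer averages in a chart -/

section Chart

variable {d m : ℕ}

/-- The average of `g` over the layer `{-2ε ≤ ρ ≤ -ε}`, with the weight `layerKernel`. -/
def layerAverage (ρ : EuclideanSpace ℝ (Fin d) → ℝ) (g : EuclideanSpace ℝ (Fin d) → ℂ)
    (ε : ℝ) : ℂ :=
  ∫ x, (ε⁻¹ * layerKernel (ρ x / ε)) • g x

theorem straighten_eq_insertCoord (ρ : EuclideanSpace ℝ (Fin (m + 1)) → ℝ) (i : Fin (m + 1))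
    (x : EuclideanSpace ℝ (Fin (m + 1))) :
    straighten ρ i x = insertCoord i (dropCoord i x, ρ x) := by
  ext j
  induction j using Fin.succAboveCases i with
  | x => simp
  | p j => simp [straighten_apply_ne]

/-- In a chart where `ρ` is the `i`-th coordinate, layer averages converge to an integral over the
boundary. -/
theorem tendsto_layerAverage_of_chart {ρ : EuclideanSpace ℝ (Fin (m + 1)) → ℝ}
    (hρ : ContDiff ℝ ∞ ρ) {i : Fin (m + 1)}
    (e : OpenPartialHomeomorph (EuclideanSpace ℝ (Fin (m + 1))) (EuclideanSpace ℝ (Fin (m + 1))))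
    (he : (e : _ → _) = straighten ρ i) (hq : ∀ x ∈ e.source, pderiv i ρ x ≠ 0)
    {g : EuclideanSpace ℝ (Fin (m + 1)) → ℂ} (hg : Continuous g) (hgc : HasCompactSupport g)
    (hgs : tsupport g ⊆ e.source) :
    Tendsto (layerAverage ρ g) (𝓝[>] 0) (𝓝 (∫ y in {y | insertCoord i (y, 0) ∈ e.target},
      |pderiv i ρ (e.symm (insertCoord i (y, 0)))|⁻¹ • g (e.symm (insertCoord i (y, 0))))) := by
  classical
  -- The transported integrand carries the inverse Jacobian `1 / |∂ᵢρ|`. Its extension by zero is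
  -- continuous because the support of `g` is a compact subset of the source.
  set G : EuclideanSpace ℝ (Fin (m + 1)) → ℂ :=
    e.target.indicator fun y => |pderiv i ρ (e.symm y)|⁻¹ • g (e.symm y) with hG
  set K := e '' tsupport g with hK
  have hKc : IsCompact K := hgc.isCompact.image_of_continuousOn (e.continuousOn.mono hgs)
  have hKt : K ⊆ e.target := by
    rintro _ ⟨x, hx, rfl⟩
    exact e.map_source (hgs hx)
  have hG0 : ∀ y ∉ K, G y = 0 := by
    intro y hy
    by_cases hyt : y ∈ e.target
    · have : g (e.symm y) = 0 := by
        by_contra h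
        exact hy ⟨e.symm y, subset_tsupport _ h, e.right_inv hyt⟩
      simp [hG, this]
    · simp [hG, hyt]
  have hGcs : HasCompactSupport G := HasCompactSupport.intro hKc hG0
  have hGts : tsupport G ⊆ K := closure_minimal
    (fun y hy => by_contra fun h => hy (hG0 y h)) hKc.isClosed
  have hGcont : Continuous G := by
    refine continuous_of_tsupport fun y hy => ?_
    have hyt : y ∈ e.target := hKt (hGts hy)
    have h1 : ContinuousAt e.symm y := e.continuousAt_symm hyt
    have h2 : ContinuousAt (fun y => |pderiv i ρ (e.symm y)|⁻¹ • g (e.symm y)) y := by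
      have h3 : ContinuousAt (fun y => pderiv i ρ (e.symm y)) y :=
        ContinuousAt.comp (contDiff_pderiv hρ i).continuous.continuousAt h1
      exact (h3.abs.inv₀ (abs_ne_zero.2 (hq _ (e.map_target hyt)))).smul
        (ContinuousAt.comp hg.continuousAt h1)
    refine h2.congr ?_
    filter_upwards [e.open_target.mem_nhds hyt] with z hz
    simp [hG, hz]
  have hchange : ∀ ε : ℝ, layerAverage ρ g ε =
      ∫ z, (ε⁻¹ * layerKernel (z.2 / ε)) • (G ∘ insertCoord i) z
        ∂((volume : Measure (EuclideanSpace ℝ (Fin m))).prod volume) := by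
    intro ε
    have h1 := integral_image_eq_integral_abs_det_fderiv_smul volume e.open_source.measurableSet
      (fun x _ => (hasFDerivAt_straighten ((hρ.differentiable (by simp)) x) i).hasFDerivWithinAt)
      (he ▸ e.injOn) (fun y => (ε⁻¹ * layerKernel (y i / ε)) • G y)
    rw [← he, e.image_source_eq_target, he] at h1
    have h2 : ∫ y in e.target, (ε⁻¹ * layerKernel (y i / ε)) • G y =
        ∫ y, (ε⁻¹ * layerKernel (y i / ε)) • G y :=
      setIntegral_eq_integral_of_forall_compl_eq_zero fun y hy => by simp [hG, hy]
    have h3 : ∫ x in e.source, |(straightenDeriv ρ i x).det| •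
        (fun y : EuclideanSpace ℝ (Fin (m + 1)) => (ε⁻¹ * layerKernel (y i / ε)) • G y)
          (straighten ρ i x) = layerAverage ρ g ε := by
      have h4 : ∫ x in e.source, (ε⁻¹ * layerKernel (ρ x / ε)) • g x = layerAverage ρ g ε :=
        setIntegral_eq_integral_of_forall_compl_eq_zero fun x hx => by
          have : g x = 0 := by
            by_contra h
            exact hx (hgs (subset_tsupport _ h))
          simp [this]
      rw [← h4]
      refine setIntegral_congr_fun e.open_source.measurableSet fun x hx => ?_
      have hx1 : straighten ρ i x ∈ e.target := he ▸ e.map_source hx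
      have hx2 : e.symm (straighten ρ i x) = x := he ▸ e.left_inv hx
      simp only [det_straightenDeriv, straighten_apply_same, hG, Set.indicator_of_mem hx1, hx2]
      rw [smul_comm, smul_smul |pderiv i ρ x|, mul_inv_cancel₀ (abs_ne_zero.2 (hq x hx)),
        one_smul]
    rw [← h3, ← h1, h2, ← (measurePreserving_insertCoord i).integral_comp
      (insertCoord i).measurableEmbedding]
    simp [Measure.volume_eq_prod]
  have hJc : HasCompactSupport (G ∘ insertCoord i) := by
    refine HasCompactSupport.intro (K := (fun x => (dropCoord i x, x i)) '' K)
      (hKc.image ((lipschitzWith_dropCoord i).continuous.prodMk (by fun_prop))) fun z hz => ?_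
    refine hG0 _ fun h => hz ⟨_, h, ?_⟩
    simp
  have hlim := tendsto_integral_flat_layer (volume : Measure (EuclideanSpace ℝ (Fin m)))
    (hGcont.comp (continuous_insertCoord i)) hJc
  have hV : MeasurableSet {y : EuclideanSpace ℝ (Fin m) | insertCoord i (y, 0) ∈ e.target} :=
    (e.open_target.preimage ((lipschitzWith_insertCoord_zero i).continuous)).measurableSet
  rw [show layerAverage ρ g = _ from funext hchange, ← integral_indicator hV]
  exact hlim

end Chart

end Helmholtz

end

noncomputable section

namespace Helmholtz

/-! ### The limit measure of one chart -/

section Chart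

variable {d m : ℕ}

/-- The measure is Lebesgue measure pushed forward by the parametrization `Ψ` of the zero set and
weighted by `1 / |∂ᵢρ|`, the limit found in the chart. The inverse of `Ψ` is a coordinate
projection, hence 1-Lipschitz, and `Ψ` is `L`-Lipschitz; each of the two gives one comparison with
the Hausdorff measure. -/
theorem exists_boundary_measure_of_chart {ρ : EuclideanSpace ℝ (Fin (m + 1)) → ℝ}
    (hρ : ContDiff ℝ ∞ ρ) {p : EuclideanSpace ℝ (Fin (m + 1))} {i : Fin (m + 1)}
    (hi : pderiv i ρ p ≠ 0) :
    ∃ (U : Set (EuclideanSpace ℝ (Fin (m + 1)))) (σ : Measure (EuclideanSpace ℝ (Fin (m + 1))))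
      (C : NNReal), IsOpen U ∧ p ∈ U ∧ IsFiniteMeasure σ ∧
      σ ≤ C • (Measure.euclideanHausdorffMeasure m).restrict {x | ρ x = 0} ∧
      (Measure.euclideanHausdorffMeasure m).restrict ({x | ρ x = 0} ∩ U) ≤ C • σ ∧
      ∀ g : EuclideanSpace ℝ (Fin (m + 1)) → ℂ, Continuous g → HasCompactSupport g →
        tsupport g ⊆ U → Tendsto (layerAverage ρ g) (𝓝[>] 0) (𝓝 (∫ x, g x ∂σ)) := by
  obtain ⟨e, L, hp, he, hL, hb, hq⟩ := exists_straightening hρ hi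
  have hpos : 0 < |pderiv i ρ p| := abs_pos.2 hi
  have hq0 : ∀ x ∈ e.source, pderiv i ρ x ≠ 0 := fun x hx => by
    have := (hq x hx).1
    exact abs_pos.1 (by linarith)
  have hρc : Continuous ρ := hρ.continuous
  have hqc : Continuous (pderiv i ρ) := (contDiff_pderiv hρ i).continuous
  set S : Set (EuclideanSpace ℝ (Fin (m + 1))) := {x | ρ x = 0} with hS
  have hSm : MeasurableSet S := (isClosed_singleton.preimage hρc).measurableSet
  set V : Set (EuclideanSpace ℝ (Fin m)) := {y | insertCoord i (y, 0) ∈ e.target} with hV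
  have hVo : IsOpen V := e.open_target.preimage (lipschitzWith_insertCoord_zero i).continuous
  set Ψ : EuclideanSpace ℝ (Fin m) → EuclideanSpace ℝ (Fin (m + 1)) :=
    fun y => e.symm (insertCoord i (y, 0)) with hΨ
  have hΨL : LipschitzOnWith L Ψ V := by
    have := hL.comp (lipschitzWith_insertCoord_zero i).lipschitzOnWith (s := V) (fun y hy => hy)
    rw [mul_one] at this
    exact this
  have hΨsrc : ∀ y ∈ V, Ψ y ∈ e.source := fun y hy => e.map_target hy
  have hΨst : ∀ y ∈ V, straighten ρ i (Ψ y) = insertCoord i (y, 0) := fun y hy => by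
    rw [← he]; exact e.right_inv hy
  have hΨS : ∀ y ∈ V, ρ (Ψ y) = 0 := fun y hy => by
    rw [← straighten_apply_same ρ i, hΨst y hy]; simp
  have hΨd : ∀ y ∈ V, dropCoord i (Ψ y) = y := fun y hy => by
    have h := congrArg (dropCoord i) (hΨst y hy)
    rw [straighten_eq_insertCoord] at h
    simpa using h
  have hback : ∀ x ∈ S ∩ e.source, dropCoord i x ∈ V ∧ Ψ (dropCoord i x) = x := by
    rintro x ⟨hx0, hx⟩
    have h1 : insertCoord i (dropCoord i x, 0) = e x := by
      rw [he, straighten_eq_insertCoord, show ρ x = 0 from hx0]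
    refine ⟨?_, ?_⟩
    · change insertCoord i (dropCoord i x, 0) ∈ e.target
      rw [h1]; exact e.map_source hx
    · change e.symm (insertCoord i (dropCoord i x, 0)) = x
      rw [h1]; exact e.left_inv hx
  have hVfin : volume V ≠ ⊤ := by
    have h1 : V ⊆ Metric.closedBall (dropCoord i p) 1 := by
      intro y hy
      have h2 := (lipschitzWith_dropCoord i).dist_le_mul (Ψ y) p
      rw [hΨd y hy] at h2
      have h3 := hb (hΨsrc y hy)
      rw [Metric.mem_ball] at h3
      rw [Metric.mem_closedBall]
      simp only [NNReal.coe_one, one_mul] at h2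
      linarith
    exact ((measure_mono h1).trans_lt measure_closedBall_lt_top).ne
  have hΨm : AEMeasurable Ψ (volume.restrict V) :=
    hΨL.continuousOn.aemeasurable hVo.measurableSet
  set σ₀ : Measure (EuclideanSpace ℝ (Fin (m + 1))) := Measure.map Ψ (volume.restrict V) with hσ₀
  have hσ₀app : ∀ A, MeasurableSet A → σ₀ A = volume (Ψ ⁻¹' A ∩ V) := fun A hA => by
    rw [hσ₀, Measure.map_apply_of_aemeasurable hΨm hA, Measure.restrict_apply' hVo.measurableSet]
  have hvol : ∀ A : Set (EuclideanSpace ℝ (Fin m)),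
      volume A = Measure.euclideanHausdorffMeasure m A := fun A => by
    rw [EuclideanSpace.euclideanHausdorffMeasure_eq_volume]
  have hle1 : σ₀ ≤ (Measure.euclideanHausdorffMeasure m).restrict S := by
    refine Measure.le_iff.2 fun A hA => ?_
    rw [hσ₀app A hA, Measure.restrict_apply hA, hvol]
    have h1 : Ψ ⁻¹' A ∩ V ⊆ dropCoord i '' (A ∩ S) := fun y hy =>
      ⟨Ψ y, ⟨hy.1, hΨS y hy.2⟩, hΨd y hy.2⟩
    refine (measure_mono h1).trans ?_
    simpa using euclideanHausdorffMeasure_image_le_of_lipschitzOnWith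
      ((lipschitzWith_dropCoord i).lipschitzOnWith (s := A ∩ S)) m
  have hle2 : (Measure.euclideanHausdorffMeasure m).restrict (S ∩ e.source) ≤ (L ^ m) • σ₀ := by
    refine Measure.le_iff.2 fun A hA => ?_
    rw [Measure.smul_apply, hσ₀app A hA, Measure.restrict_apply hA, hvol]
    have h1 : A ∩ (S ∩ e.source) ⊆ Ψ '' (Ψ ⁻¹' A ∩ V) := fun x hx =>
      ⟨dropCoord i x, ⟨by simpa [(hback x hx.2).2] using hx.1, (hback x hx.2).1⟩,
        (hback x hx.2).2⟩
    refine (measure_mono h1).trans ?_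
    have := euclideanHausdorffMeasure_image_le_of_lipschitzOnWith
      (hΨL.mono (Set.inter_subset_right (s := Ψ ⁻¹' A))) m
    simpa [ENNReal.smul_def] using this
  have hσ₀fin : IsFiniteMeasure σ₀ := ⟨by
    rw [hσ₀app _ MeasurableSet.univ]
    exact (measure_mono Set.inter_subset_right).trans_lt hVfin.lt_top⟩
  have hσ₀src : ∀ᵐ x ∂σ₀, x ∈ e.source := by
    rw [ae_iff]
    change σ₀ e.sourceᶜ = 0
    rw [hσ₀app _ e.open_source.measurableSet.compl]
    have : Ψ ⁻¹' e.sourceᶜ ∩ V = ∅ := Set.eq_empty_of_forall_notMem fun y hy =>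
      hy.1 (hΨsrc y hy.2)
    rw [this, measure_empty]
  set w : EuclideanSpace ℝ (Fin (m + 1)) → ENNReal :=
    fun x => ENNReal.ofReal |pderiv i ρ x|⁻¹ with hw
  have hwm : Measurable w := (hqc.measurable.abs.inv).ennreal_ofReal
  set a : ℝ := |pderiv i ρ p| with ha
  have hw1 : ∀ x ∈ e.source, w x ≤ ENNReal.ofReal (2 / a) := fun x hx => by
    refine ENNReal.ofReal_le_ofReal ?_
    rw [show (2 : ℝ) / a = (a / 2)⁻¹ by rw [inv_div]]
    exact inv_anti₀ (by positivity) (hq x hx).1.le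
  have hw2 : ∀ x ∈ e.source, 1 ≤ ENNReal.ofReal (2 * a) * w x := fun x hx => by
    rw [hw, ← ENNReal.ofReal_mul (by positivity), ← ENNReal.ofReal_one]
    refine ENNReal.ofReal_le_ofReal ?_
    have h1 : 0 < |pderiv i ρ x| := abs_pos.2 (hq0 x hx)
    rw [le_mul_inv_iff₀ h1]
    linarith [(hq x hx).2]
  set σ := σ₀.withDensity w with hσ
  have hb1 : σ ≤ (2 / a).toNNReal • σ₀ := by
    rw [hσ]
    calc σ₀.withDensity w ≤ σ₀.withDensity (fun _ => ENNReal.ofReal (2 / a)) :=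
          withDensity_mono (hσ₀src.mono hw1)
      _ = _ := by rw [withDensity_const]; rfl
  have hb2 : σ₀ ≤ (2 * a).toNNReal • σ := by
    calc σ₀ = σ₀.withDensity 1 := withDensity_one.symm
      _ ≤ σ₀.withDensity (ENNReal.ofReal (2 * a) • w) := withDensity_mono (hσ₀src.mono hw2)
      _ = _ := by rw [withDensity_smul _ hwm]; rfl
  -- The two comparisons need the two summands separately; their sum serves for both.
  refine ⟨e.source, σ, (2 / a).toNNReal + L ^ m * (2 * a).toNNReal, e.open_source, hp, ?_, ?_, ?_,
    ?_⟩
  · exact isFiniteMeasure_of_le _ hb1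
  · calc σ ≤ (2 / a).toNNReal • σ₀ := hb1
      _ ≤ (2 / a).toNNReal • (Measure.euclideanHausdorffMeasure m).restrict S := by gcongr
      _ ≤ _ := by
        refine Measure.le_iff.2 fun A _ => ?_
        simp only [Measure.smul_apply, ENNReal.smul_def, smul_eq_mul]
        gcongr
        exact le_self_add
  · calc _ ≤ (L ^ m) • σ₀ := hle2
      _ ≤ (L ^ m) • (2 * a).toNNReal • σ := by gcongr
      _ ≤ _ := by
        refine Measure.le_iff.2 fun A _ => ?_
        simp only [Measure.smul_apply, ENNReal.smul_def, smul_eq_mul]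
        rw [← mul_assoc, ← ENNReal.coe_mul]
        gcongr
        exact le_add_self
  · intro g hg hgc hgs
    have h1 := tendsto_layerAverage_of_chart hρ e he hq0 hg hgc hgs
    convert h1 using 2
    rw [hσ, integral_withDensity_eq_integral_toReal_smul hwm (by simp [hw]), hσ₀, integral_map hΨm]
    · refine setIntegral_congr_fun hVo.measurableSet fun y _ => ?_
      simp only [hw, hΨ]
      rw [ENNReal.toReal_ofReal (by positivity)]
    · exact (hwm.ennreal_toReal.aestronglyMeasurable.smul hg.aestronglyMeasurable)

theorem gradient_apply_eq_pderiv (ρ : EuclideanSpace ℝ (Fin d) → ℝ)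
    (x : EuclideanSpace ℝ (Fin d)) (i : Fin d) : gradient ρ x i = pderiv i ρ x := by
  have h : fderiv ℝ ρ x (EuclideanSpace.single i 1) =
      inner ℝ (gradient ρ x) (EuclideanSpace.single i 1) := by
    rw [gradient, InnerProductSpace.toDual_symm_apply]
  rw [pderiv, h, EuclideanSpace.inner_single_right]
  simp

end Chart

end Helmholtz

end

noncomputable section

namespace Helmholtz

/-! ### Gluing the chart measures -/

section Domain

variable {d : ℕ} {Ω : Set (EuclideanSpace ℝ (Fin d))} {ρ : EuclideanSpace ℝ (Fin d) → ℝ}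

theorem IsSmoothBoundedDomain.setOf_eq_frontier (hΩ : IsSmoothBoundedDomain Ω ρ) :
    {x | ρ x = 0} = frontier Ω := Set.ext hΩ.defining.zero_iff

theorem IsSmoothBoundedDomain.isCompact_closure (hΩ : IsSmoothBoundedDomain Ω ρ) :
    IsCompact (closure Ω) := hΩ.isBounded.isCompact_closure

theorem IsSmoothBoundedDomain.isCompact_frontier (hΩ : IsSmoothBoundedDomain Ω ρ) :
    IsCompact (frontier Ω) :=
  hΩ.isCompact_closure.of_isClosed_subset isClosed_frontier frontier_subset_closure

theorem layerKernel_div_eq_zero {s ε : ℝ} (hε : 0 < ε) (h : s < -2 * ε ∨ -ε < s) :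
    layerKernel (s / ε) = 0 := by
  refine layerKernel_eq_zero fun hs => ?_
  have h1 := (le_div_iff₀ hε).1 hs.1
  have h2 := (div_le_iff₀ hε).1 hs.2
  rcases h with h | h <;> linarith

theorem layerKernel_div_eq_zero_of_notMem (hΩ : IsSmoothBoundedDomain Ω ρ) {ε : ℝ} (hε : 0 < ε)
    {x : EuclideanSpace ℝ (Fin d)} (hx : x ∉ Ω) : layerKernel (ρ x / ε) = 0 := by
  have h : 0 ≤ ρ x := not_lt.1 fun h => hx ((hΩ.defining.neg_iff x).1 h)
  exact layerKernel_div_eq_zero hε (Or.inr (by linarith))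

theorem layerAverage_congr (hΩ : IsSmoothBoundedDomain Ω ρ) {g g' : EuclideanSpace ℝ (Fin d) → ℂ}
    (h : Set.EqOn g g' Ω) {ε : ℝ} (hε : 0 < ε) : layerAverage ρ g ε = layerAverage ρ g' ε := by
  refine integral_congr_ae (Eventually.of_forall fun x => ?_)
  by_cases hx : x ∈ Ω
  · simp only [h hx]
  · simp [layerKernel_div_eq_zero_of_notMem hΩ hε hx]

/-- By compactness `ρ ≤ -δ` on the part of the support lying in the closed domain, so the layer, of
depth `2ε`, misses it once `ε` is small; outside the domain the kernel vanishes. -/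
theorem tendsto_layerAverage_zero (hΩ : IsSmoothBoundedDomain Ω ρ)
    {g : EuclideanSpace ℝ (Fin d) → ℂ} (hgs : Disjoint (tsupport g) (frontier Ω)) :
    Tendsto (layerAverage ρ g) (𝓝[>] 0) (𝓝 0) := by
  have hρc : Continuous ρ := hΩ.defining.smooth.continuous
  have hK : IsCompact (tsupport g ∩ closure Ω) :=
    hΩ.isCompact_closure.inter_left (isClosed_tsupport g)
  have hneg : ∀ x ∈ tsupport g ∩ closure Ω, ρ x < 0 := fun x hx => by
    rw [hΩ.defining.neg_iff]
    by_contra h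
    refine Set.disjoint_left.1 hgs hx.1 ?_
    rw [hΩ.isOpen.frontier_eq]
    exact ⟨hx.2, h⟩
  have hδ : ∃ δ > 0, ∀ x ∈ tsupport g ∩ closure Ω, ρ x ≤ -δ := by
    rcases (tsupport g ∩ closure Ω).eq_empty_or_nonempty with h | h
    · exact ⟨1, one_pos, by simp [h]⟩
    · obtain ⟨x, hx, hmax⟩ := hK.exists_isMaxOn h hρc.continuousOn
      exact ⟨-ρ x, by linarith [hneg x hx], fun y hy => by simpa using hmax hy⟩
  obtain ⟨δ, hδ0, hδ⟩ := hδ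
  refine tendsto_const_nhds.congr' ?_
  filter_upwards [Ioo_mem_nhdsGT (show (0 : ℝ) < δ / 4 by linarith)] with ε hε
  refine (integral_eq_zero_of_ae (Eventually.of_forall fun x => ?_)).symm
  by_cases hx : x ∈ Ω
  · by_cases hxs : x ∈ tsupport g
    · have := hδ x ⟨hxs, subset_closure hx⟩
      simp [layerKernel_div_eq_zero (s := ρ x) hε.1 (Or.inl (by linarith [hε.2]))]
    · simp [image_eq_zero_of_notMem_tsupport hxs]
  · simp [layerKernel_div_eq_zero_of_notMem hΩ hε.1 hx]

theorem withDensity_le_of_restrict_le {X : Type*} [MeasurableSpace X] {μ ν : Measure X}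
    {U : Set X} (hU : MeasurableSet U) {w : X → ENNReal} (hw : ∀ x ∉ U, w x = 0)
    (h : μ.restrict U ≤ ν) : μ.withDensity w ≤ ν.withDensity w := by
  refine Measure.le_iff.2 fun A hA => ?_
  rw [withDensity_apply _ hA, withDensity_apply _ hA]
  have h1 : ∫⁻ x in A, w x ∂μ = ∫⁻ x in A, w x ∂(μ.restrict U) := by
    rw [← lintegral_indicator hA, ← lintegral_indicator hA, ← lintegral_indicator hU]
    refine lintegral_congr fun x => ?_
    by_cases hx : x ∈ U
    · simp [hx]
    · by_cases hxA : x ∈ A <;> simp [hx, hxA, hw x hx]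
  rw [h1]
  exact lintegral_mono' (Measure.restrict_mono subset_rfl h) le_rfl

/-- A partition of unity subordinate to finitely many charts localizes both the layer average and
the surface measure; the chart measures, weighted by the partition functions, are added up. -/
theorem exists_boundary_measure {m : ℕ} {Ω : Set (EuclideanSpace ℝ (Fin (m + 1)))}
    {ρ : EuclideanSpace ℝ (Fin (m + 1)) → ℝ} (hΩ : IsSmoothBoundedDomain Ω ρ) :
    ∃ (τ : Measure (EuclideanSpace ℝ (Fin (m + 1)))) (C : NNReal), IsFiniteMeasure τ ∧
      τ ≤ C • surfaceMeasure Ω ∧ surfaceMeasure Ω ≤ C • τ ∧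
      ∀ g : EuclideanSpace ℝ (Fin (m + 1)) → ℂ, Continuous g → HasCompactSupport g →
        Tendsto (layerAverage ρ g) (𝓝[>] 0) (𝓝 (∫ x, g x ∂τ)) := by
  classical
  have hS : surfaceMeasure Ω =
      (Measure.euclideanHausdorffMeasure m).restrict (frontier Ω) := rfl
  have hex : ∀ p : frontier Ω, ∃ (U : Set (EuclideanSpace ℝ (Fin (m + 1))))
      (σ : Measure (EuclideanSpace ℝ (Fin (m + 1))))
      (C : NNReal), IsOpen U ∧ (p : EuclideanSpace ℝ (Fin (m + 1))) ∈ U ∧ IsFiniteMeasure σ ∧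
      σ ≤ C • surfaceMeasure Ω ∧ (surfaceMeasure Ω).restrict U ≤ C • σ ∧
      ∀ g : EuclideanSpace ℝ (Fin (m + 1)) → ℂ, Continuous g → HasCompactSupport g →
        tsupport g ⊆ U → Tendsto (layerAverage ρ g) (𝓝[>] 0) (𝓝 (∫ x, g x ∂σ)) := by
    rintro ⟨p, hp⟩
    have hne := hΩ.defining.gradient_ne_zero p hp
    obtain ⟨i, hi⟩ : ∃ i, pderiv i ρ p ≠ 0 := by
      by_contra! h
      exact hne (by ext i; rw [gradient_apply_eq_pderiv, h i]; rfl)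
    obtain ⟨U, σ, C, hU, hpU, hfin, h1, h2, h3⟩ :=
      exists_boundary_measure_of_chart hΩ.defining.smooth hi
    refine ⟨U, σ, C, hU, hpU, hfin, ?_, ?_, h3⟩
    · rwa [hS, ← hΩ.setOf_eq_frontier]
    · rw [hS, Measure.restrict_restrict hU.measurableSet, Set.inter_comm,
        ← hΩ.setOf_eq_frontier]
      exact h2
  choose U σ C hU hpU hfin hσ1 hσ2 hσ3 using hex
  obtain ⟨t, ht⟩ := hΩ.isCompact_frontier.elim_finite_subcover U hU
    (fun x hx => Set.mem_iUnion.2 ⟨⟨x, hx⟩, hpU _⟩)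
  -- The index `none` stands for the complement of the boundary, so that the partition covers the
  -- whole space. Its function vanishes on the boundary and contributes nothing to the limit.
  let W : Option t → Set (EuclideanSpace ℝ (Fin (m + 1))) := fun j =>
    j.elim (frontier Ω)ᶜ fun p => U p
  obtain ⟨f, hf⟩ := PartitionOfUnity.exists_isSubordinate (s := Set.univ) isClosed_univ W
    (by
      rintro (_ | p)
      · exact isClosed_frontier.isOpen_compl
      · exact hU p)
    (by
      intro x _
      by_cases hx : x ∈ frontier Ω
      · obtain ⟨p, hp, hxp⟩ := Set.mem_iUnion₂.1 (ht hx)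
        exact Set.mem_iUnion.2 ⟨some ⟨p, hp⟩, hxp⟩
      · exact Set.mem_iUnion.2 ⟨none, hx⟩)
  have hsum : ∀ x, f none x + ∑ p : t, f (some p) x = 1 := fun x => by
    rw [← f.sum_eq_one (Set.mem_univ x), finsum_eq_sum_of_fintype, Fintype.sum_option]
  have hsupp : ∀ (p : t), tsupport (f (some p)) ⊆ U p := fun p => hf (some p)
  have hnone : tsupport (f none) ⊆ (frontier Ω)ᶜ := hf none
  let w : t → EuclideanSpace ℝ (Fin (m + 1)) → ENNReal := fun p x => ENNReal.ofReal (f (some p) x)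
  have hwm : ∀ p, Measurable (w p) := fun p => (f (some p)).continuous.measurable.ennreal_ofReal
  let τ : Measure (EuclideanSpace ℝ (Fin (m + 1))) := ∑ p : t, (σ p).withDensity (w p)
  have hτle : ∀ p : t, (σ p).withDensity (w p) ≤ σ p := fun p => by
    calc (σ p).withDensity (w p) ≤ (σ p).withDensity 1 := withDensity_mono
          (Eventually.of_forall fun x => by
            change ENNReal.ofReal _ ≤ 1
            rw [ENNReal.ofReal_le_one]; exact f.le_one _ _)
      _ = σ p := withDensity_one
  have hfin' : ∀ p : t, IsFiniteMeasure ((σ p).withDensity (w p)) := fun p =>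
    have := hfin p; isFiniteMeasure_of_le _ (hτle p)
  refine ⟨τ, ∑ p : t, C p, inferInstance, ?_, ?_, ?_⟩
  · refine Measure.le_iff.2 fun A hA => ?_
    simp only [τ, Measure.finsetSum_apply, Measure.smul_apply]
    rw [Finset.sum_smul]
    refine Finset.sum_le_sum fun p _ => ?_
    have := ((hτle p).trans (hσ1 p)) A
    simpa using this
  · have h1 : surfaceMeasure Ω = ∑ p : t, (surfaceMeasure Ω).withDensity (w p) := by
      have h2 : (surfaceMeasure Ω).withDensity (∑ p : t, w p) =
          (surfaceMeasure Ω).withDensity 1 := by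
        refine withDensity_congr_ae ?_
        rw [hS]
        filter_upwards [ae_restrict_mem isClosed_frontier.measurableSet] with x hx
        have h0 : f none x = 0 := by
          by_contra h
          exact hnone (subset_tsupport _ h) hx
        have h3 := hsum x
        rw [h0, zero_add] at h3
        simp only [Finset.sum_apply, w]
        rw [← ENNReal.ofReal_sum_of_nonneg (fun p _ => f.nonneg _ _), h3]
        simp
      rw [withDensity_one] at h2
      conv_lhs => rw [← h2]
      refine Measure.ext fun A hA => ?_
      rw [withDensity_apply _ hA, Measure.finsetSum_apply]
      simp only [Finset.sum_apply]
      rw [lintegral_finsetSum _ fun p _ => hwm p]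
      exact Finset.sum_congr rfl fun p _ => (withDensity_apply _ hA).symm
    rw [h1]
    refine Measure.le_iff.2 fun A hA => ?_
    simp only [τ, Measure.finsetSum_apply, Measure.smul_apply]
    rw [Finset.sum_smul]
    refine Finset.sum_le_sum fun p _ => ?_
    have h2 : (surfaceMeasure Ω).withDensity (w p) ≤ (C p • σ p).withDensity (w p) := by
      refine withDensity_le_of_restrict_le (hU p).measurableSet (fun x hx => ?_) (hσ2 p)
      have : f (some p) x = 0 := by
        by_contra h
        exact hx (hsupp p (subset_tsupport _ h))
      simp [w, this]
    have h4 : (C p • σ p).withDensity (w p) = C p • (σ p).withDensity (w p) :=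
      withDensity_smul_measure _ _
    rw [h4] at h2
    refine (h2 A).trans ?_
    rw [Measure.smul_apply]
    gcongr
    exact Finset.single_le_sum (f := fun q : t => (σ q).withDensity (w q) A)
      (fun _ _ => zero_le) (Finset.mem_univ p)
  · intro g hg hgc
    have hgw : ∀ j, Continuous fun x => f j x • g x := fun j => (f j).continuous.smul hg
    have hgwc : ∀ j, HasCompactSupport fun x => f j x • g x := fun j =>
      hgc.mono fun x hx h0 => hx (by simp [h0])
    have hgws : ∀ j, (tsupport fun x => f j x • g x) ⊆ tsupport (f j) := fun j =>
      closure_mono fun x hx h0 => hx (by simp [h0])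
    have hdec : ∀ ε : ℝ, layerAverage ρ g ε = layerAverage ρ (fun x => f none x • g x) ε +
        ∑ p : t, layerAverage ρ (fun x => f (some p) x • g x) ε := by
      intro ε
      have hint : ∀ j, Integrable fun x => (ε⁻¹ * layerKernel (ρ x / ε)) • f j x • g x := by
        intro j
        have hc : Continuous fun x => (ε⁻¹ * layerKernel (ρ x / ε)) • f j x • g x :=
          (continuous_const.mul (continuous_layerKernel.comp
            (hΩ.defining.smooth.continuous.div_const _))).smul (hgw j)
        have hs : HasCompactSupport fun x => (ε⁻¹ * layerKernel (ρ x / ε)) • f j x • g x :=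
          (hgwc j).mono fun x hx h0 => hx (by simp only [h0, smul_zero])
        exact hc.integrable_of_hasCompactSupport hs
      simp only [layerAverage]
      rw [← integral_finsetSum _ fun p _ => hint (some p),
        ← integral_add (hint none) (integrable_finsetSum _ fun p _ => hint (some p))]
      refine integral_congr_ae (Eventually.of_forall fun x => ?_)
      simp only
      rw [← Finset.smul_sum, ← smul_add, ← Finset.sum_smul, ← add_smul, hsum x, one_smul]
    have hlim : ∫ x, g x ∂τ = 0 + ∑ p : t, ∫ x, f (some p) x • g x ∂(σ p) := by
      rw [zero_add, integral_finsetSum_measure]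
      · refine Finset.sum_congr rfl fun p _ => ?_
        rw [integral_withDensity_eq_integral_toReal_smul (hwm p) (by simp [w])]
        simp only [w, ENNReal.toReal_ofReal (f.nonneg _ _)]
      · intro p _
        have := hfin' p
        exact hg.integrable_of_hasCompactSupport hgc
    rw [hlim, show layerAverage ρ g = _ from funext hdec]
    refine Tendsto.add ?_ (tendsto_finsetSum _ fun p _ => ?_)
    · exact tendsto_layerAverage_zero hΩ (Set.disjoint_left.2 fun x hx => hnone (hgws none hx))
    · exact hσ3 p _ (hgw _) (hgwc _) ((hgws _).trans (hsupp p))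

end Domain

end Helmholtz

end

noncomputable section

namespace Helmholtz

/-! ### The divergence theorem with conormal `∇ρ` -/

section Divergence

variable {d : ℕ} {Ω : Set (EuclideanSpace ℝ (Fin d))} {ρ : EuclideanSpace ℝ (Fin d) → ℝ}

/-- Functions continuous up to the boundary which are `C¹` inside, with bounded derivative. -/
structure IsC1Bounded {F : Type*} [NormedAddCommGroup F] [NormedSpace ℝ F]
    (Ω : Set (EuclideanSpace ℝ (Fin d))) (a : EuclideanSpace ℝ (Fin d) → F) : Prop where
  continuousOn : ContinuousOn a (closure Ω)
  contDiffOn : ContDiffOn ℝ 1 a Ω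
  bounded : ∃ M, ∀ x ∈ Ω, ‖fderiv ℝ a x‖ ≤ M

/-- A finite measure on the boundary, comparable to the surface measure, for which the divergence
theorem holds with the conormal `∇ρ` in place of the unit outer normal. -/
structure IsConormalMeasure (Ω : Set (EuclideanSpace ℝ (Fin d)))
    (ρ : EuclideanSpace ℝ (Fin d) → ℝ) (τ : Measure (EuclideanSpace ℝ (Fin d))) : Prop where
  isFinite : IsFiniteMeasure τ
  le_surface : ∃ C : NNReal, τ ≤ C • surfaceMeasure Ω
  surface_le : ∃ C : NNReal, surfaceMeasure Ω ≤ C • τ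
  integral_pderiv : ∀ (F : EuclideanSpace ℝ (Fin d) → ℂ), IsC1Bounded Ω F → ∀ j,
    ∫ x in Ω, pderiv j F x = ∫ x, pderiv j ρ x • F x ∂τ

theorem IsC1Bounded.differentiableAt {F : Type*} [NormedAddCommGroup F] [NormedSpace ℝ F]
    {a : EuclideanSpace ℝ (Fin d) → F} (ha : IsC1Bounded Ω a) (hΩ : IsOpen Ω)
    {x : EuclideanSpace ℝ (Fin d)} (hx : x ∈ Ω) : DifferentiableAt ℝ a x :=
  (ha.contDiffOn.differentiableOn one_ne_zero).differentiableAt (hΩ.mem_nhds hx)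

theorem norm_pderiv_le {F : Type*} [NormedAddCommGroup F] [NormedSpace ℝ F]
    (a : EuclideanSpace ℝ (Fin d) → F) (j : Fin d) (x : EuclideanSpace ℝ (Fin d)) :
    ‖pderiv j a x‖ ≤ ‖fderiv ℝ a x‖ := by
  simpa [pderiv] using (fderiv ℝ a x).le_opNorm (EuclideanSpace.single j 1)

theorem IsC1Bounded.continuousOn_pderiv {F : Type*} [NormedAddCommGroup F] [NormedSpace ℝ F]
    {a : EuclideanSpace ℝ (Fin d) → F} (ha : IsC1Bounded Ω a) (hΩ : IsOpen Ω) (j : Fin d) :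
    ContinuousOn (pderiv j a) Ω :=
  (ha.contDiffOn.continuousOn_fderiv_of_isOpen hΩ le_rfl).clm_apply continuousOn_const

theorem IsC1Bounded.integrableOn_pderiv {F : Type*} [NormedAddCommGroup F] [NormedSpace ℝ F]
    {a : EuclideanSpace ℝ (Fin d) → F} (ha : IsC1Bounded Ω a) (hΩ : IsSmoothBoundedDomain Ω ρ)
    (j : Fin d) : IntegrableOn (pderiv j a) Ω := by
  obtain ⟨M, hM⟩ := ha.bounded
  exact IntegrableOn.of_bound hΩ.isBounded.measure_lt_top
    ((ha.continuousOn_pderiv hΩ.isOpen j).aestronglyMeasurable hΩ.isOpen.measurableSet) M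
    ((ae_restrict_mem hΩ.isOpen.measurableSet).mono fun x hx =>
      (norm_pderiv_le a j x).trans (hM x hx))

/-- A function which is continuous up to the boundary extends to a compactly supported one. -/
theorem exists_continuous_extension (hΩ : IsSmoothBoundedDomain Ω ρ)
    {F : EuclideanSpace ℝ (Fin d) → ℂ} (hF : ContinuousOn F (closure Ω)) :
    ∃ g : EuclideanSpace ℝ (Fin d) → ℂ, Continuous g ∧ HasCompactSupport g ∧
      Set.EqOn g F (closure Ω) := by
  obtain ⟨g, hg⟩ := ContinuousMap.exists_restrict_eq (isClosed_closure (s := Ω))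
    ⟨(closure Ω).domRestrict F, hF.domRestrict⟩
  have hgF : ∀ x ∈ closure Ω, g x = F x := fun x hx =>
    congrArg (fun f : C(closure Ω, ℂ) => f ⟨x, hx⟩) hg
  let θ : EuclideanSpace ℝ (Fin d) → ℝ := fun x => max 0 (1 - Metric.infDist x (closure Ω))
  have hθ : Continuous θ := by fun_prop
  refine ⟨fun x => θ x • g x, hθ.smul g.continuous, ?_, fun x hx => ?_⟩
  · refine HasCompactSupport.intro
      (hΩ.isCompact_closure.isBounded.thickening (δ := 2)).isCompact_closure fun x hx => ?_
    have h1 : 1 < Metric.infDist x (closure Ω) := by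
      by_contra! h
      refine hx (subset_closure ?_)
      have hne : (closure Ω).Nonempty := hΩ.isConnected.nonempty.closure
      rw [Metric.mem_thickening_iff_infDist_lt hne]
      linarith
    have : θ x = 0 := max_eq_left (by linarith)
    simp [this]
  · have : θ x = 1 := by
      simp [θ, Metric.infDist_zero_of_mem hx]
    simp [this, hgF x hx]

theorem integral_pderiv_eq_zero {H : EuclideanSpace ℝ (Fin d) → ℂ} (hH : ContDiff ℝ 1 H)
    (hc : HasCompactSupport H) (j : Fin d) : ∫ x, pderiv j H x = 0 := by
  have hd : Continuous fun x => fderiv ℝ H x (EuclideanSpace.single j 1) :=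
    (hH.continuous_fderiv one_ne_zero).clm_apply continuous_const
  have h := integral_mul_fderiv_eq_neg_fderiv_mul_of_integrable (μ := volume)
    (f := fun _ : EuclideanSpace ℝ (Fin d) => (1 : ℂ)) (g := H)
    (v := EuclideanSpace.single j (1 : ℝ)) (by simp)
    (by simpa using hd.integrable_of_hasCompactSupport (hc.fderiv_apply ℝ _))
    (by simpa using hH.continuous.integrable_of_hasCompactSupport hc)
    (fun x _ => differentiableAt_const _)
    (fun x _ => (hH.differentiable one_ne_zero) x)
  simpa [pderiv] using h

/-- The cut-off function is `C¹` with compact support in the whole space, so the integral of its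
derivative is zero. The derivative of the cutoff produces the layer kernel times `∂ⱼρ`. -/
theorem integral_cutoff_pderiv (hΩ : IsSmoothBoundedDomain Ω ρ) {F : EuclideanSpace ℝ (Fin d) → ℂ}
    (hF : IsC1Bounded Ω F) (j : Fin d) {ε : ℝ} (hε : 0 < ε) :
    ∫ x in Ω, cutoffProfile (ρ x / ε) • pderiv j F x =
      layerAverage ρ (fun x => pderiv j ρ x • F x) ε := by
  have hρ := hΩ.defining.smooth
  have hχ : ContDiff ℝ ∞ fun x => cutoffProfile (ρ x / ε) :=
    contDiff_cutoffProfile.comp (hρ.div_const ε)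
  set H : EuclideanSpace ℝ (Fin d) → ℂ := fun x => cutoffProfile (ρ x / ε) • F x with hHdef
  have hχ0 : ∀ x, -ε ≤ ρ x → cutoffProfile (ρ x / ε) = 0 := fun x hx =>
    cutoffProfile_eq_zero (by rw [le_div_iff₀ hε]; linarith)
  have hout : ∀ x ∉ Ω, 0 ≤ ρ x := fun x hx => not_lt.1 fun h => hx ((hΩ.defining.neg_iff x).1 h)
  -- The profile vanishes already for `ρ ≥ -ε`, which makes `H` zero near boundary points, where `F`
  -- need not be differentiable.
  have hH0 : ∀ x ∉ Ω, H =ᶠ[𝓝 x] fun _ => 0 := fun x hx => by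
    filter_upwards [(isOpen_Ioi.preimage hρ.continuous).mem_nhds
      (show x ∈ ρ ⁻¹' Set.Ioi (-ε) from by
        have := hout x hx; simp only [Set.mem_preimage, Set.mem_Ioi]; linarith)] with y hy
    simp only [hHdef]
    rw [hχ0 y (le_of_lt hy), zero_smul]
  have hH : ContDiff ℝ 1 H := contDiff_iff_contDiffAt.2 fun x => by
    by_cases hx : x ∈ Ω
    · exact (hχ.of_le (by norm_cast)).contDiffAt.smul
        (hF.contDiffOn.contDiffAt (hΩ.isOpen.mem_nhds hx))
    · exact contDiffAt_const.congr_of_eventuallyEq (hH0 x hx)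
  have hHc : HasCompactSupport H := by
    refine HasCompactSupport.intro hΩ.isCompact_closure fun x hx => ?_
    exact (hH0 x fun h => hx (subset_closure h)).self_of_nhds
  have hdH : ∀ x, pderiv j H x = Ω.indicator (fun x => cutoffProfile (ρ x / ε) • pderiv j F x) x -
      (ε⁻¹ * layerKernel (ρ x / ε)) • pderiv j ρ x • F x := by
    intro x
    by_cases hx : x ∈ Ω
    · have h1 : HasFDerivAt (fun x => ρ x / ε) (ε⁻¹ • fderiv ℝ ρ x) x := by
        have := ((hρ.differentiable (by simp)) x).hasFDerivAt.const_smul ε⁻¹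
        refine this.congr_of_eventuallyEq (Eventually.of_forall fun y => ?_)
        simp [div_eq_inv_mul]
      have h2 := (hasDerivAt_cutoffProfile (ρ x / ε)).comp_hasFDerivAt x h1
      have h3 := h2.smul (hF.differentiableAt hΩ.isOpen hx).hasFDerivAt
      have h4 : fderiv ℝ H x = _ := h3.fderiv
      rw [Set.indicator_of_mem hx, pderiv, h4]
      simp only [pderiv, add_apply, smul_apply,
        ContinuousLinearMap.smulRight_apply, Function.comp_apply, smul_eq_mul, smul_smul]
      rw [sub_eq_add_neg, ← neg_smul]
      congr 2
      ring
    · rw [Set.indicator_of_notMem hx, pderiv, (hH0 x hx).fderiv_eq,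
        layerKernel_div_eq_zero_of_notMem hΩ hε hx]
      simp
  have hint1 : Integrable (Ω.indicator fun x => cutoffProfile (ρ x / ε) • pderiv j F x) := by
    rw [integrable_indicator_iff hΩ.isOpen.measurableSet]
    refine (hF.integrableOn_pderiv hΩ j).norm.mono'
      (hχ.continuous.aestronglyMeasurable.smul
        (hF.integrableOn_pderiv hΩ j).aestronglyMeasurable)
      (Eventually.of_forall fun x => ?_)
    rw [norm_smul]
    exact mul_le_of_le_one_left (norm_nonneg _) (abs_cutoffProfile_le_one _)
  have hintH : Integrable (pderiv j H) :=
    ((hH.continuous_fderiv one_ne_zero).clm_apply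
      continuous_const).integrable_of_hasCompactSupport (hHc.fderiv_apply ℝ _)
  have h0 := integral_pderiv_eq_zero hH hHc j
  have heq : (fun x => (ε⁻¹ * layerKernel (ρ x / ε)) • pderiv j ρ x • F x) = fun x =>
      Ω.indicator (fun x => cutoffProfile (ρ x / ε) • pderiv j F x) x - pderiv j H x :=
    funext fun x => by rw [hdH x]; abel
  rw [layerAverage, heq, integral_sub hint1 hintH, h0, sub_zero,
    integral_indicator hΩ.isOpen.measurableSet]

/-- Let `ε → 0` in `integral_cutoff_pderiv`: the left side converges by domination, since the
derivative is bounded, and the right side is a layer average of a continuous extension of `F`. -/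
theorem exists_isConormalMeasure {m : ℕ} {Ω : Set (EuclideanSpace ℝ (Fin (m + 1)))}
    {ρ : EuclideanSpace ℝ (Fin (m + 1)) → ℝ} (hΩ : IsSmoothBoundedDomain Ω ρ) :
    ∃ τ, IsConormalMeasure Ω ρ τ := by
  obtain ⟨τ, C, hfin, h1, h2, hlim⟩ := exists_boundary_measure hΩ
  refine ⟨τ, hfin, ⟨C, h1⟩, ⟨C, h2⟩, fun F hF j => ?_⟩
  have hρ := hΩ.defining.smooth
  obtain ⟨g, hg, hgc, hgF⟩ := exists_continuous_extension hΩ hF.continuousOn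
  have hlim' := hlim (fun x => pderiv j ρ x • g x)
    ((contDiff_pderiv hρ j).continuous.smul hg)
    (hgc.mono fun x hx h0 => hx (by simp only [h0, smul_zero]))
  have hτ : ∀ᵐ x ∂τ, x ∈ frontier Ω := by
    have h3 : ∀ᵐ x ∂(C • surfaceMeasure Ω), x ∈ frontier Ω :=
      Measure.ae_smul_measure (ae_restrict_mem isClosed_frontier.measurableSet) C
    exact (Measure.absolutelyContinuous_of_le h1).ae_le h3
  have e1 : ∫ x, pderiv j ρ x • g x ∂τ = ∫ x, pderiv j ρ x • F x ∂τ :=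
    integral_congr_ae (hτ.mono fun x hx => by
      simp only [hgF (frontier_subset_closure hx)])
  rw [e1] at hlim'
  refine tendsto_nhds_unique ?_ hlim'
  have hlim2 : Tendsto (fun ε : ℝ => ∫ x in Ω, cutoffProfile (ρ x / ε) • pderiv j F x) (𝓝[>] 0)
      (𝓝 (∫ x in Ω, pderiv j F x)) := by
    refine tendsto_integral_filter_of_dominated_convergence (fun x => ‖pderiv j F x‖) ?_ ?_
      (hF.integrableOn_pderiv hΩ j).norm ?_
    · refine Eventually.of_forall fun ε => ?_
      exact (contDiff_cutoffProfile.continuous.comp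
        (hρ.continuous.div_const ε)).aestronglyMeasurable.smul
        (hF.integrableOn_pderiv hΩ j).aestronglyMeasurable
    · refine Eventually.of_forall fun ε => Eventually.of_forall fun x => ?_
      rw [norm_smul]
      exact mul_le_of_le_one_left (norm_nonneg _) (abs_cutoffProfile_le_one _)
    · filter_upwards [ae_restrict_mem hΩ.isOpen.measurableSet] with x hx
      have hx0 : ρ x < 0 := (hΩ.defining.neg_iff x).2 hx
      refine tendsto_const_nhds.congr' ?_
      filter_upwards [Ioo_mem_nhdsGT (show (0 : ℝ) < -ρ x / 2 by linarith)] with ε hε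
      rw [cutoffProfile_eq_one, one_smul]
      rw [div_le_iff₀ hε.1]
      linarith [hε.2]
  refine hlim2.congr' ?_
  filter_upwards [self_mem_nhdsWithin] with ε hε
  rw [integral_cutoff_pderiv hΩ hF j hε]
  refine layerAverage_congr hΩ (fun x hx => ?_) hε
  simp only [hgF (subset_closure hx)]

end Divergence

end Helmholtz

end

noncomputable section

namespace Helmholtz

/-! ### Coefficients smooth up to the boundary -/

section Coefficients

variable {d : ℕ} {Ω : Set (EuclideanSpace ℝ (Fin d))} {ρ : EuclideanSpace ℝ (Fin d) → ℝ}
variable {F : Type*} [NormedAddCommGroup F] [NormedSpace ℝ F]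

/-- Near each point of the closure there is a derivative within the closed domain that is continuous
at that point, hence locally bounded; at interior points it is the Fréchet derivative. Compactness
makes the bound uniform. -/
theorem IsC1Bounded.of_contDiffOn (hΩo : IsOpen Ω) (hΩc : IsCompact (closure Ω))
    {a : EuclideanSpace ℝ (Fin d) → F} (ha : ContDiffOn ℝ ∞ a (closure Ω)) : IsC1Bounded Ω a := by
  refine ⟨ha.continuousOn, (ha.mono subset_closure).of_le (by norm_cast), ?_⟩
  have key : ∃ M, ∀ x ∈ closure Ω ∩ Ω, ‖fderiv ℝ a x‖ ≤ M := by
    refine hΩc.induction_on (p := fun s => ∃ M, ∀ x ∈ s ∩ Ω, ‖fderiv ℝ a x‖ ≤ M)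
      ⟨0, by simp⟩ (fun s t hst ⟨M, hM⟩ => ⟨M, fun x hx => hM x ⟨hst hx.1, hx.2⟩⟩)
      (fun s t ⟨M, hM⟩ ⟨N, hN⟩ => ⟨max M N, ?_⟩) (fun x hx => ?_)
    · rintro x ⟨hx | hx, hxΩ⟩
      · exact (hM x ⟨hx, hxΩ⟩).trans (le_max_left _ _)
      · exact (hN x ⟨hx, hxΩ⟩).trans (le_max_right _ _)
    · have h1 : ContDiffWithinAt ℝ ((0 : ℕ) + 1) a (closure Ω) x :=
        (ha x hx).of_le (by norm_cast)
      obtain ⟨u, hu, -, f', hf', hc⟩ :=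
        (contDiffWithinAt_succ_iff_hasFDerivWithinAt (by simp)).1 h1
      rw [Set.insert_eq_of_mem hx] at hu
      have hxu : x ∈ u := mem_of_mem_nhdsWithin hx hu
      have h2 : ∀ᶠ y in 𝓝[u] x, ‖f' y‖ < ‖f' x‖ + 1 :=
        (hc.continuousWithinAt.norm).eventually (gt_mem_nhds (by linarith))
      have h3 : ∀ᶠ y in 𝓝[closure Ω] x, y ∈ u ∧ ‖f' y‖ < ‖f' x‖ + 1 := by
        have h4 : 𝓝[closure Ω] x ≤ 𝓝[u] x :=
          le_inf inf_le_left (le_principal_iff.2 hu)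
        exact (eventually_mem_set.2 hu).and (h4 h2)
      -- Taking the interior ensures that `u` is a full neighbourhood of every point of `Ω` in this
      -- set, so that `f'` is the actual derivative there.
      refine ⟨{y | y ∈ u ∧ ‖f' y‖ < ‖f' x‖ + 1} ∩ (interior {y | y ∈ closure Ω →
        y ∈ u ∧ ‖f' y‖ < ‖f' x‖ + 1}), ?_, ‖f' x‖ + 1, ?_⟩
      · have h5 : interior {y | y ∈ closure Ω → y ∈ u ∧ ‖f' y‖ < ‖f' x‖ + 1} ∈ 𝓝 x :=
          interior_mem_nhds.2 (eventually_nhdsWithin_iff.1 h3)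
        exact inter_mem h3 (mem_nhdsWithin_of_mem_nhds h5)
      · rintro y ⟨⟨⟨hyu, hy⟩, hyi⟩, hyΩ⟩
        have h6 : u ∈ 𝓝 y := by
          filter_upwards [isOpen_interior.mem_nhds hyi, hΩo.mem_nhds hyΩ] with z hz hzΩ
          exact (interior_subset hz (subset_closure hzΩ)).1
        rw [((hf' y hyu).hasFDerivAt h6).fderiv]
        exact hy.le
  obtain ⟨M, hM⟩ := key
  exact ⟨M, fun x hx => hM x ⟨subset_closure hx, hx⟩⟩

theorem IsC1Bounded.of_contDiff (hΩ : IsSmoothBoundedDomain Ω ρ)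
    {a : EuclideanSpace ℝ (Fin d) → F} (ha : ContDiff ℝ ∞ a) : IsC1Bounded Ω a :=
  .of_contDiffOn hΩ.isOpen hΩ.isCompact_closure ha.contDiffOn

theorem pderiv_smul {a : EuclideanSpace ℝ (Fin d) → ℝ} {b : EuclideanSpace ℝ (Fin d) → F}
    {x : EuclideanSpace ℝ (Fin d)} (ha : DifferentiableAt ℝ a x) (hb : DifferentiableAt ℝ b x)
    (j : Fin d) :
    pderiv j (fun x => a x • b x) x = pderiv j a x • b x + a x • pderiv j b x := by
  have h : fderiv ℝ (fun x => a x • b x) x = _ := (ha.hasFDerivAt.smul hb.hasFDerivAt).fderiv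
  rw [pderiv, h]
  simp [pderiv, add_comm]

theorem IsC1Bounded.smul (hΩ : IsSmoothBoundedDomain Ω ρ) {a : EuclideanSpace ℝ (Fin d) → ℝ}
    {b : EuclideanSpace ℝ (Fin d) → F} (ha : IsC1Bounded Ω a) (hb : IsC1Bounded Ω b) :
    IsC1Bounded Ω fun x => a x • b x := by
  refine ⟨ha.continuousOn.smul hb.continuousOn, ha.contDiffOn.smul hb.contDiffOn, ?_⟩
  obtain ⟨A, hA⟩ := hΩ.isCompact_closure.exists_bound_of_continuousOn ha.continuousOn
  obtain ⟨B, hB⟩ := hΩ.isCompact_closure.exists_bound_of_continuousOn hb.continuousOn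
  obtain ⟨A', hA'⟩ := ha.bounded
  obtain ⟨B', hB'⟩ := hb.bounded
  refine ⟨A * B' + A' * B, fun x hx => ?_⟩
  have h : fderiv ℝ (fun x => a x • b x) x = _ :=
    ((ha.differentiableAt hΩ.isOpen hx).hasFDerivAt.smul
      (hb.differentiableAt hΩ.isOpen hx).hasFDerivAt).fderiv
  rw [h]
  have hAx := hA x (subset_closure hx)
  have hBx := hB x (subset_closure hx)
  refine (norm_add_le _ _).trans (add_le_add ?_ ?_)
  · rw [norm_smul]
    exact mul_le_mul hAx (hB' x hx) (norm_nonneg _) ((norm_nonneg _).trans hAx)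
  · rw [ContinuousLinearMap.norm_smulRight_apply]
    exact mul_le_mul (hA' x hx) hBx (norm_nonneg _) ((norm_nonneg _).trans (hA' x hx))

theorem IsC1Bounded.memLp_top (hΩ : IsSmoothBoundedDomain Ω ρ)
    {a : EuclideanSpace ℝ (Fin d) → F} (ha : IsC1Bounded Ω a) :
    MemLp a ⊤ (volume.restrict Ω) := by
  obtain ⟨A, hA⟩ := hΩ.isCompact_closure.exists_bound_of_continuousOn ha.continuousOn
  exact memLp_top_of_bound ((ha.continuousOn.mono subset_closure).aestronglyMeasurable
    hΩ.isOpen.measurableSet) A ((ae_restrict_mem hΩ.isOpen.measurableSet).mono fun x hx =>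
      hA x (subset_closure hx))

theorem IsC1Bounded.memLp_top_pderiv (hΩ : IsSmoothBoundedDomain Ω ρ)
    {a : EuclideanSpace ℝ (Fin d) → F} (ha : IsC1Bounded Ω a) (j : Fin d) :
    MemLp (pderiv j a) ⊤ (volume.restrict Ω) := by
  obtain ⟨A, hA⟩ := ha.bounded
  exact memLp_top_of_bound ((ha.continuousOn_pderiv hΩ.isOpen j).aestronglyMeasurable
    hΩ.isOpen.measurableSet) A ((ae_restrict_mem hΩ.isOpen.measurableSet).mono fun x hx =>
      (norm_pderiv_le a j x).trans (hA x hx))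

theorem IsConormalMeasure.ae_mem {τ : Measure (EuclideanSpace ℝ (Fin d))}
    (hτ : IsConormalMeasure Ω ρ τ) : ∀ᵐ x ∂τ, x ∈ frontier Ω := by
  obtain ⟨C, hC⟩ := hτ.le_surface
  have h3 : ∀ᵐ x ∂(C • surfaceMeasure Ω), x ∈ frontier Ω :=
    Measure.ae_smul_measure (ae_restrict_mem isClosed_frontier.measurableSet) C
  exact (Measure.absolutelyContinuous_of_le hC).ae_le h3

theorem memLp_top_conormal (hΩ : IsSmoothBoundedDomain Ω ρ)
    {τ : Measure (EuclideanSpace ℝ (Fin d))} (hτ : IsConormalMeasure Ω ρ τ)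
    {F' : Type*} [NormedAddCommGroup F'] {a : EuclideanSpace ℝ (Fin d) → F'}
    (ha : ContinuousOn a (frontier Ω)) : MemLp a ⊤ τ := by
  obtain ⟨A, hA⟩ := hΩ.isCompact_frontier.exists_bound_of_continuousOn ha
  have hr : τ.restrict (frontier Ω) = τ := Measure.restrict_eq_self_of_ae_mem hτ.ae_mem
  refine memLp_top_of_bound ?_ A (hτ.ae_mem.mono hA)
  rw [← hr]
  exact ha.aestronglyMeasurable isClosed_frontier.measurableSet

end Coefficients

/-! ### Weighted pairings and their continuity in `L²` -/

section Pairing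

variable {d : ℕ} {μ : Measure (EuclideanSpace ℝ (Fin d))}

/-- The weighted sesquilinear pairing `∫ b f ḡ dμ`. -/
def pairing (μ : Measure (EuclideanSpace ℝ (Fin d))) (b : EuclideanSpace ℝ (Fin d) → ℝ)
    (f g : EuclideanSpace ℝ (Fin d) → ℂ) : ℂ :=
  ∫ x, b x • (f x * starRingEnd ℂ (g x)) ∂μ

theorem integrable_pairing {b : EuclideanSpace ℝ (Fin d) → ℝ}
    {f g : EuclideanSpace ℝ (Fin d) → ℂ} (hb : MemLp b ⊤ μ) (hf : MemLp f 2 μ) (hg : MemLp g 2 μ) :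
    Integrable (fun x => b x • (f x * starRingEnd ℂ (g x))) μ := by
  have h1 : MemLp (fun x => f x * starRingEnd ℂ (g x)) 1 μ := hg.star.mul hf
  have h2 : MemLp (fun x => b x • (f x * starRingEnd ℂ (g x))) 1 μ := h1.smul hb
  exact memLp_one_iff_integrable.1 h2

theorem norm_sq_l2norm {f : EuclideanSpace ℝ (Fin d) → ℂ} (hf : MemLp f 2 μ) :
    l2norm μ f ^ 2 = ∫ x, ‖f x‖ ^ 2 ∂μ := by
  rw [l2norm, hf.eLpNorm_eq_integral_rpow_norm two_ne_zero ENNReal.ofNat_ne_top,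
    ENNReal.toReal_ofReal (by positivity)]
  simp only [ENNReal.toReal_ofNat, Real.rpow_two]
  rw [← Real.rpow_natCast, ← Real.rpow_mul (integral_nonneg fun x => by positivity)]
  norm_num

theorem l2norm_nonneg (μ : Measure (EuclideanSpace ℝ (Fin d)))
    (f : EuclideanSpace ℝ (Fin d) → ℂ) : 0 ≤ l2norm μ f := ENNReal.toReal_nonneg

theorem l2norm_eq_norm_toLp {f : EuclideanSpace ℝ (Fin d) → ℂ} (hf : MemLp f 2 μ) :
    l2norm μ f = ‖hf.toLp f‖ := by
  rw [Lp.norm_toLp, l2norm]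

theorem inner_toLp {f g : EuclideanSpace ℝ (Fin d) → ℂ} (hf : MemLp f 2 μ) (hg : MemLp g 2 μ) :
    inner ℂ (hg.toLp g) (hf.toLp f) = ∫ x, f x * starRingEnd ℂ (g x) ∂μ := by
  rw [L2.inner_def]
  refine integral_congr_ae ?_
  filter_upwards [hf.coeFn_toLp, hg.coeFn_toLp] with x h1 h2
  rw [h1, h2, RCLike.inner_apply]

theorem pairing_eq_integral {b : EuclideanSpace ℝ (Fin d) → ℝ}
    {f g : EuclideanSpace ℝ (Fin d) → ℂ} :
    pairing μ b f g = ∫ x, (b x • f x) * starRingEnd ℂ (g x) ∂μ := by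
  simp only [pairing, smul_mul_assoc]

theorem norm_pairing_le {b : EuclideanSpace ℝ (Fin d) → ℝ}
    {f g : EuclideanSpace ℝ (Fin d) → ℂ} {M : ℝ} (hb : AEStronglyMeasurable b μ)
    (hM : ∀ᵐ x ∂μ, ‖b x‖ ≤ M) (hf : MemLp f 2 μ)
    (hg : MemLp g 2 μ) : ‖pairing μ b f g‖ ≤ M * (l2norm μ f * l2norm μ g) := by
  have hbf : MemLp (fun x => b x • f x) 2 μ := hf.smul (memLp_top_of_bound hb M hM)
  rw [pairing_eq_integral, ← inner_toLp hbf hg, l2norm_eq_norm_toLp hf, l2norm_eq_norm_toLp hg]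
  refine (norm_inner_le_norm _ _).trans ?_
  have : ‖hbf.toLp _‖ ≤ M * ‖hf.toLp f‖ := by
    refine Lp.norm_le_mul_norm_of_ae_le_mul ?_
    filter_upwards [hM, hf.coeFn_toLp, hbf.coeFn_toLp] with x h1 h2 h3
    rw [h2, h3, norm_smul]
    gcongr
  calc _ ≤ ‖hg.toLp g‖ * (M * ‖hf.toLp f‖) := by gcongr
    _ = _ := by ring

theorem TendstoL2.tendsto_toLp {fk : ℕ → EuclideanSpace ℝ (Fin d) → ℂ}
    {f : EuclideanSpace ℝ (Fin d) → ℂ} (h : TendstoL2 μ fk f) (hfk : ∀ k, MemLp (fk k) 2 μ)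
    (hf : MemLp f 2 μ) : Tendsto (fun k => (hfk k).toLp (fk k)) atTop (𝓝 (hf.toLp f)) :=
  (Lp.tendsto_Lp_iff_tendsto_eLpNorm'' fk hfk f hf).2 h

theorem TendstoL2.smul {fk : ℕ → EuclideanSpace ℝ (Fin d) → ℂ}
    {f : EuclideanSpace ℝ (Fin d) → ℂ} (h : TendstoL2 μ fk f) {b : EuclideanSpace ℝ (Fin d) → ℝ}
    (hb : MemLp b ⊤ μ) (hfk : ∀ k, MemLp (fk k) 2 μ) (hf : MemLp f 2 μ) :
    TendstoL2 μ (fun k x => b x • fk k x) fun x => b x • f x := by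
  have h1 : ∀ k, eLpNorm (fun x => b x • fk k x - b x • f x) 2 μ ≤
      eLpNorm b ⊤ μ * eLpNorm (fun x => fk k x - f x) 2 μ := fun k => by
    simp only [← smul_sub]
    exact eLpNorm_smul_le_mul_eLpNorm ((hfk k).sub hf).aestronglyMeasurable
      hb.aestronglyMeasurable
  refine tendsto_of_tendsto_of_tendsto_of_le_of_le tendsto_const_nhds ?_ (fun _ => zero_le) h1
  have := ENNReal.Tendsto.const_mul (a := eLpNorm b ⊤ μ) h (Or.inr hb.eLpNorm_lt_top.ne)
  simpa using this

theorem TendstoL2.pairing {fk gk : ℕ → EuclideanSpace ℝ (Fin d) → ℂ}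
    {f g : EuclideanSpace ℝ (Fin d) → ℂ} {b : EuclideanSpace ℝ (Fin d) → ℝ}
    (hf' : TendstoL2 μ fk f) (hg' : TendstoL2 μ gk g) (hb : MemLp b ⊤ μ)
    (hfk : ∀ k, MemLp (fk k) 2 μ) (hf : MemLp f 2 μ)
    (hgk : ∀ k, MemLp (gk k) 2 μ) (hg : MemLp g 2 μ) :
    Tendsto (fun k => pairing μ b (fk k) (gk k)) atTop (𝓝 (pairing μ b f g)) := by
  have hbfk : ∀ k, MemLp (fun x => b x • fk k x) 2 μ := fun k => (hfk k).smul hb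
  have hbf : MemLp (fun x => b x • f x) 2 μ := hf.smul hb
  have h1 := (hf'.smul hb hfk hf).tendsto_toLp hbfk hbf
  have h2 := hg'.tendsto_toLp hgk hg
  have h3 := h2.inner (𝕜 := ℂ) h1
  simp only [inner_toLp] at h3
  simpa only [pairing_eq_integral] using h3

theorem pairing_sub_left {b : EuclideanSpace ℝ (Fin d) → ℝ}
    {f f' g : EuclideanSpace ℝ (Fin d) → ℂ} (hb : MemLp b ⊤ μ) (hf : MemLp f 2 μ)
    (hf' : MemLp f' 2 μ) (hg : MemLp g 2 μ) :
    pairing μ b (fun x => f x - f' x) g = pairing μ b f g - pairing μ b f' g := by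
  simp only [Helmholtz.pairing, sub_mul, smul_sub]
  exact integral_sub (integrable_pairing hb hf hg) (integrable_pairing hb hf' hg)

end Pairing

end Helmholtz

end

noncomputable section

namespace Helmholtz

/-! ### Traces and integration by parts -/

section Trace

variable {d : ℕ} {Ω : Set (EuclideanSpace ℝ (Fin d))} {ρ : EuclideanSpace ℝ (Fin d) → ℝ}
  {τ : Measure (EuclideanSpace ℝ (Fin d))}

/-- `w ∈ H¹(Ω)` has gradient `Dw` and trace `f`, in the sense of approximation by smooth functions,
the boundary being endowed with the measure `τ`. -/
structure HasTrace (Ω : Set (EuclideanSpace ℝ (Fin d))) (τ : Measure (EuclideanSpace ℝ (Fin d)))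
    (w : EuclideanSpace ℝ (Fin d) → ℂ) (Dw : Fin d → EuclideanSpace ℝ (Fin d) → ℂ)
    (f : EuclideanSpace ℝ (Fin d) → ℂ) : Prop where
  memLp : MemLp w 2 (volume.restrict Ω)
  memLp_deriv : ∀ i, MemLp (Dw i) 2 (volume.restrict Ω)
  memLp_trace : MemLp f 2 τ
  approx : ∃ φ : ℕ → EuclideanSpace ℝ (Fin d) → ℂ,
    (∀ k, ContDiff ℝ ∞ (φ k)) ∧
    TendstoL2 (volume.restrict Ω) φ w ∧
    (∀ i, TendstoL2 (volume.restrict Ω) (fun k => pderiv i (φ k)) (Dw i)) ∧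
    TendstoL2 τ φ f

theorem IsConormalMeasure.memLp (hτ : IsConormalMeasure Ω ρ τ)
    {f : EuclideanSpace ℝ (Fin d) → ℂ} (hf : MemLp f 2 (surfaceMeasure Ω)) : MemLp f 2 τ := by
  obtain ⟨C, hC⟩ := hτ.le_surface
  exact hf.of_measure_le_smul (c := (C : ENNReal)) ENNReal.coe_ne_top hC

theorem eLpNorm_le_of_le_smul {μ ν : Measure (EuclideanSpace ℝ (Fin d))} {C : NNReal}
    (h : μ ≤ C • ν) (f : EuclideanSpace ℝ (Fin d) → ℂ) :
    eLpNorm f 2 μ ≤ (C : ENNReal) ^ (1 / 2 : ℝ) * eLpNorm f 2 ν := by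
  refine (eLpNorm_mono_measure f h).trans ?_
  have : C • ν = (C : ENNReal) • ν := rfl
  rw [this, eLpNorm_smul_measure_of_ne_top ENNReal.ofNat_ne_top]
  simp

theorem l2norm_le_of_le_smul {μ ν : Measure (EuclideanSpace ℝ (Fin d))} {C : NNReal}
    (h : μ ≤ C • ν) {f : EuclideanSpace ℝ (Fin d) → ℂ} (hf : MemLp f 2 ν) :
    l2norm μ f ≤ (C : ℝ) ^ (1 / 2 : ℝ) * l2norm ν f := by
  have h1 := ENNReal.toReal_mono (ENNReal.mul_ne_top (by
    exact ENNReal.rpow_ne_top_of_nonneg (by norm_num) ENNReal.coe_ne_top) hf.eLpNorm_ne_top)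
    (eLpNorm_le_of_le_smul h f)
  rw [ENNReal.toReal_mul, ← ENNReal.toReal_rpow] at h1
  exact h1

theorem IsConormalMeasure.tendstoL2 (hτ : IsConormalMeasure Ω ρ τ)
    {fk : ℕ → EuclideanSpace ℝ (Fin d) → ℂ} {f : EuclideanSpace ℝ (Fin d) → ℂ}
    (h : TendstoL2 (surfaceMeasure Ω) fk f) : TendstoL2 τ fk f := by
  obtain ⟨C, hC⟩ := hτ.le_surface
  refine tendsto_of_tendsto_of_tendsto_of_le_of_le tendsto_const_nhds ?_ (fun _ => zero_le)
    (fun k => eLpNorm_le_of_le_smul hC _)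
  have := ENNReal.Tendsto.const_mul (a := (C : ENNReal) ^ (1 / 2 : ℝ)) h
    (Or.inr (ENNReal.rpow_ne_top_of_nonneg (by norm_num) ENNReal.coe_ne_top))
  simpa using this

theorem IsTrace.hasTrace (hτ : IsConormalMeasure Ω ρ τ) {w : EuclideanSpace ℝ (Fin d) → ℂ}
    {Dw : Fin d → EuclideanSpace ℝ (Fin d) → ℂ} {f : EuclideanSpace ℝ (Fin d) → ℂ}
    (hw : IsH1 Ω w Dw) (hf : IsTrace Ω w Dw f) : HasTrace Ω τ w Dw f := by
  obtain ⟨h1, φ, h2, h3, h4, h5⟩ := hf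
  exact ⟨hw.memLp, hw.memLp_deriv, hτ.memLp h1, φ, h2, h3, h4, hτ.tendstoL2 h5⟩

theorem memLp_two_of_continuous (hΩ : IsSmoothBoundedDomain Ω ρ)
    {φ : EuclideanSpace ℝ (Fin d) → ℂ} (hφ : ContDiff ℝ ∞ φ) :
    MemLp φ 2 (volume.restrict Ω) := by
  have : IsFiniteMeasure (volume.restrict Ω) := ⟨by
    simpa using hΩ.isBounded.measure_lt_top⟩
  exact ((IsC1Bounded.of_contDiff hΩ hφ).memLp_top hΩ).mono_exponent le_top

theorem memLp_two_conormal (hΩ : IsSmoothBoundedDomain Ω ρ) (hτ : IsConormalMeasure Ω ρ τ)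
    {φ : EuclideanSpace ℝ (Fin d) → ℂ} (hφ : ContDiff ℝ ∞ φ) : MemLp φ 2 τ := by
  have := hτ.isFinite
  exact (memLp_top_conormal hΩ hτ hφ.continuous.continuousOn).mono_exponent le_top

theorem hasTrace_of_contDiff (hΩ : IsSmoothBoundedDomain Ω ρ) (hτ : IsConormalMeasure Ω ρ τ)
    {φ : EuclideanSpace ℝ (Fin d) → ℂ} (hφ : ContDiff ℝ ∞ φ) :
    HasTrace Ω τ φ (fun i => pderiv i φ) φ := by
  refine ⟨memLp_two_of_continuous hΩ hφ, fun i => memLp_two_of_continuous hΩ (contDiff_pderiv hφ i),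
    memLp_two_conormal hΩ hτ hφ, fun _ => φ, fun _ => hφ, ?_, fun i => ?_, ?_⟩ <;>
  simp [TendstoL2]

theorem pderiv_mul_conj {φ χ : EuclideanSpace ℝ (Fin d) → ℂ} {x : EuclideanSpace ℝ (Fin d)}
    (hφ : DifferentiableAt ℝ φ x) (hχ : DifferentiableAt ℝ χ x) (i : Fin d) :
    pderiv i (fun x => φ x * starRingEnd ℂ (χ x)) x =
      pderiv i φ x * starRingEnd ℂ (χ x) + φ x * starRingEnd ℂ (pderiv i χ x) := by
  have h1 : HasFDerivAt (fun x => starRingEnd ℂ (χ x))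
      ((Complex.conjCLE : ℂ →L[ℝ] ℂ).comp (fderiv ℝ χ x)) x :=
    (Complex.conjCLE : ℂ →L[ℝ] ℂ).hasFDerivAt.comp x hχ.hasFDerivAt
  have h : fderiv ℝ (fun x => φ x * starRingEnd ℂ (χ x)) x = _ :=
    (hφ.hasFDerivAt.mul h1).fderiv
  rw [pderiv, h]
  simp [pderiv]
  ring

theorem contDiff_mul_conj {φ χ : EuclideanSpace ℝ (Fin d) → ℂ} (hφ : ContDiff ℝ ∞ φ)
    (hχ : ContDiff ℝ ∞ χ) : ContDiff ℝ ∞ fun x => φ x * starRingEnd ℂ (χ x) :=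
  hφ.mul ((Complex.conjCLE : ℂ →L[ℝ] ℂ).contDiff.comp hχ)

/-- Integration by parts for `H¹` functions with traces. -/
theorem pairing_integration_by_parts (hΩ : IsSmoothBoundedDomain Ω ρ)
    (hτ : IsConormalMeasure Ω ρ τ) {a : EuclideanSpace ℝ (Fin d) → ℝ} (ha : IsC1Bounded Ω a)
    {w z : EuclideanSpace ℝ (Fin d) → ℂ} {Dw Dz : Fin d → EuclideanSpace ℝ (Fin d) → ℂ}
    {f g : EuclideanSpace ℝ (Fin d) → ℂ} (hw : HasTrace Ω τ w Dw f) (hz : HasTrace Ω τ z Dz g)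
    (i : Fin d) :
    pairing (volume.restrict Ω) (pderiv i a) w z + pairing (volume.restrict Ω) a (Dw i) z +
      pairing (volume.restrict Ω) a w (Dz i) = pairing τ (fun x => pderiv i ρ x * a x) f g := by
  obtain ⟨φ, hφ, hφ1, hφ2, hφ3⟩ := hw.approx
  obtain ⟨χ, hχ, hχ1, hχ2, hχ3⟩ := hz.approx
  have ha0 := ha.memLp_top hΩ
  have ha1 := ha.memLp_top_pderiv hΩ i
  have hρa : MemLp (fun x => pderiv i ρ x * a x) ⊤ τ := memLp_top_conormal hΩ hτ
    ((contDiff_pderiv hΩ.defining.smooth i).continuous.continuousOn.mul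
      (ha.continuousOn.mono frontier_subset_closure))
  have mφ := fun k => memLp_two_of_continuous hΩ (hφ k)
  have mχ := fun k => memLp_two_of_continuous hΩ (hχ k)
  have mφ' := fun k => memLp_two_of_continuous hΩ (contDiff_pderiv (hφ k) i)
  have mχ' := fun k => memLp_two_of_continuous hΩ (contDiff_pderiv (hχ k) i)
  have mφτ := fun k => memLp_two_conormal hΩ hτ (hφ k)
  have mχτ := fun k => memLp_two_conormal hΩ hτ (hχ k)
  have l1 := hφ1.pairing hχ1 ha1 mφ hw.memLp mχ hz.memLp
  have l2 := (hφ2 i).pairing hχ1 ha0 mφ' (hw.memLp_deriv i) mχ hz.memLp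
  have l3 := hφ1.pairing (hχ2 i) ha0 mφ hw.memLp mχ' (hz.memLp_deriv i)
  have l4 := hφ3.pairing hχ3 hρa mφτ hw.memLp_trace mχτ hz.memLp_trace
  -- Both sides are limits along the approximating sequences. For smooth functions the identity is
  -- the divergence theorem for `a φₖ χ̄ₖ`.
  refine tendsto_nhds_unique ((l1.add l2).add l3) (l4.congr fun k => ?_)
  have hprod := contDiff_mul_conj (hφ k) (hχ k)
  have hdiv := hτ.integral_pderiv _ (ha.smul hΩ (.of_contDiff hΩ hprod)) i
  simp only [pairing]
  simp only [smul_smul] at hdiv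
  have i1 := integrable_pairing ha1 (mφ k) (mχ k)
  have i2 := integrable_pairing ha0 (mφ' k) (mχ k)
  have i3 := integrable_pairing ha0 (mφ k) (mχ' k)
  have i12 : Integrable (fun x => pderiv i a x • (φ k x * starRingEnd ℂ (χ k x)) +
    a x • (pderiv i (φ k) x * starRingEnd ℂ (χ k x))) (volume.restrict Ω) := i1.add i2
  rw [← hdiv, ← integral_add i1 i2, ← integral_add i12 i3]
  refine setIntegral_congr_fun hΩ.isOpen.measurableSet fun x hx => ?_
  simp only [pderiv_smul (ha.differentiableAt hΩ.isOpen hx) ((hprod.differentiable (by simp)) x) i,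
    pderiv_mul_conj (((hφ k).differentiable (by simp)) x) (((hχ k).differentiable (by simp)) x) i,
    smul_add, add_assoc]

end Trace

end Helmholtz

end

noncomputable section

namespace Helmholtz

/-! ### Tangential derivatives of the trace -/

section Tangential

variable {d : ℕ} {Ω : Set (EuclideanSpace ℝ (Fin d))} {ρ : EuclideanSpace ℝ (Fin d) → ℝ}
  {τ : Measure (EuclideanSpace ℝ (Fin d))}

theorem pderiv_comm {F : Type*} [NormedAddCommGroup F] [NormedSpace ℝ F]
    {φ : EuclideanSpace ℝ (Fin d) → F} (hφ : ContDiff ℝ ∞ φ) (i j : Fin d) :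
    pderiv i (pderiv j φ) = pderiv j (pderiv i φ) := by
  have h1 : ∀ k l x, pderiv k (pderiv l φ) x =
      fderiv ℝ (fderiv ℝ φ) x (EuclideanSpace.single k 1) (EuclideanSpace.single l 1) := by
    intro k l x
    have h : HasFDerivAt (pderiv l φ) _ x :=
      (((hφ.fderiv_right (m := ∞) (by norm_cast)).differentiable (by simp)) x).hasFDerivAt.clm_apply
        (hasFDerivAt_const (EuclideanSpace.single l (1 : ℝ)) x)
    rw [pderiv, h.fderiv]
    simp
  ext x
  have hs : IsSymmSndFDerivAt ℝ φ x := hφ.contDiffAt.isSymmSndFDerivAt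
    (by rw [minSmoothness_of_isRCLikeNormedField]; norm_cast)
  rw [h1, h1]
  exact hs _ _

theorem hasCompactSupport_pderiv {φ : EuclideanSpace ℝ (Fin d) → ℝ} (hφ : HasCompactSupport φ)
    (i : Fin d) : HasCompactSupport (pderiv i φ) := hφ.fderiv_apply ℝ _

theorem tsupport_pderiv_subset (φ : EuclideanSpace ℝ (Fin d) → ℝ) (i : Fin d) :
    tsupport (pderiv i φ) ⊆ tsupport φ := tsupport_fderiv_apply_subset ℝ _

theorem IsSmoothBoundedDomain.isFiniteMeasure_restrict (hΩ : IsSmoothBoundedDomain Ω ρ) :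
    IsFiniteMeasure (volume.restrict Ω) := ⟨by simpa using hΩ.isBounded.measure_lt_top⟩

/-- Against a test function both sides equal `u` integrated against its second derivatives, which
commute. -/
theorem IsH2.second_deriv_comm (hΩ : IsSmoothBoundedDomain Ω ρ)
    {u : EuclideanSpace ℝ (Fin d) → ℂ} {Du : Fin d → EuclideanSpace ℝ (Fin d) → ℂ}
    {D2u : Fin d → Fin d → EuclideanSpace ℝ (Fin d) → ℂ} (hu : IsH2 Ω u Du D2u) (i j : Fin d) :
    D2u i j =ᵐ[volume.restrict Ω] D2u j i := by
  have := hΩ.isFiniteMeasure_restrict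
  have key : ∀ (i j : Fin d) (φ : EuclideanSpace ℝ (Fin d) → ℝ), ContDiff ℝ ∞ φ →
      HasCompactSupport φ → tsupport φ ⊆ Ω →
      ∫ x in Ω, (φ x : ℂ) * D2u i j x = ∫ x in Ω, ((pderiv j (pderiv i φ) x : ℝ) : ℂ) * u x := by
    intro i j φ h1 h2 h3
    rw [hu.isH1.weak j _ (contDiff_pderiv h1 i) (hasCompactSupport_pderiv h2 i)
      ((tsupport_pderiv_subset φ i).trans h3), (hu.isH1_deriv j).weak i φ h1 h2 h3, neg_neg]
  have hi : ∀ i j, Integrable (D2u i j) (volume.restrict Ω) := fun i j =>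
    ((hu.isH1_deriv j).memLp_deriv i).integrable one_le_two
  have h := hΩ.isOpen.ae_eq_zero_of_integral_contDiff_smul_eq_zero (μ := volume.restrict Ω)
    (f := fun x => D2u i j x - D2u j i x)
    ((hi i j).sub (hi j i)).integrableOn.locallyIntegrableOn
    (fun φ h1 h2 h3 => by
      have hint : ∀ i j, Integrable (fun x => (φ x : ℂ) * D2u i j x) (volume.restrict Ω) := by
        intro i j
        obtain ⟨M, hM⟩ := h2.exists_bound_of_continuous h1.continuous
        refine (hi i j).bdd_mul (c := M) ?_ ?_
        · exact (Complex.continuous_ofReal.comp h1.continuous).aestronglyMeasurable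
        · exact Eventually.of_forall fun x => by simpa using hM x
      simp only [Complex.real_smul, mul_sub]
      rw [integral_sub (hint i j) (hint j i), key i j φ h1 h2 h3, key j i φ h1 h2 h3,
        pderiv_comm h1, sub_self])
  filter_upwards [h, ae_restrict_mem hΩ.isOpen.measurableSet] with x hx hxΩ
  exact sub_eq_zero.1 (hx hxΩ)

theorem pairing_zero_right {μ : Measure (EuclideanSpace ℝ (Fin d))}
    (b : EuclideanSpace ℝ (Fin d) → ℝ) (f : EuclideanSpace ℝ (Fin d) → ℂ) :
    pairing μ b f (fun _ => 0) = 0 := by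
  simp [pairing]

theorem pairing_congr_left {μ : Measure (EuclideanSpace ℝ (Fin d))}
    {b : EuclideanSpace ℝ (Fin d) → ℝ} {f f' g : EuclideanSpace ℝ (Fin d) → ℂ}
    (h : f =ᵐ[μ] f') : pairing μ b f g = pairing μ b f' g :=
  integral_congr_ae (h.mono fun x hx => by simp only [hx])

/-- Integration by parts against smooth functions. -/
theorem pairing_one_integration_by_parts (hΩ : IsSmoothBoundedDomain Ω ρ)
    (hτ : IsConormalMeasure Ω ρ τ) {a : EuclideanSpace ℝ (Fin d) → ℝ} (ha : IsC1Bounded Ω a)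
    {w : EuclideanSpace ℝ (Fin d) → ℂ} {Dw : Fin d → EuclideanSpace ℝ (Fin d) → ℂ}
    {f : EuclideanSpace ℝ (Fin d) → ℂ} (hw : HasTrace Ω τ w Dw f) (i : Fin d) :
    pairing (volume.restrict Ω) (pderiv i a) w (fun _ => 1) +
      pairing (volume.restrict Ω) a (Dw i) (fun _ => 1) =
      pairing τ (fun x => pderiv i ρ x * a x) f (fun _ => 1) := by
  have h := pairing_integration_by_parts hΩ hτ ha hw
    (hasTrace_of_contDiff hΩ hτ (φ := fun _ => 1) contDiff_const) i
  have h0 : pderiv i (fun _ : EuclideanSpace ℝ (Fin d) => (1 : ℂ)) = fun _ => 0 := by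
    ext x; simp [pderiv]
  rw [← h, h0, pairing_zero_right, add_zero]

/-- The tangential derivatives of the trace are the tangential components of the trace of the
gradient, tested against a smooth function. -/
theorem pairing_tangential (hΩ : IsSmoothBoundedDomain Ω ρ) (hτ : IsConormalMeasure Ω ρ τ)
    {u : EuclideanSpace ℝ (Fin d) → ℂ} {Du : Fin d → EuclideanSpace ℝ (Fin d) → ℂ}
    {D2u : Fin d → Fin d → EuclideanSpace ℝ (Fin d) → ℂ} {f : EuclideanSpace ℝ (Fin d) → ℂ}
    {γ : Fin d → EuclideanSpace ℝ (Fin d) → ℂ} (hu : HasTrace Ω τ u Du f)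
    (hDu : ∀ j, HasTrace Ω τ (Du j) (fun i => D2u i j) (γ j))
    (hsymm : ∀ i j, D2u i j =ᵐ[volume.restrict Ω] D2u j i)
    {ψ : EuclideanSpace ℝ (Fin d) → ℝ} (hψ : ContDiff ℝ ∞ ψ) (i j : Fin d) :
    pairing τ (fun x => pderiv i ρ x * ψ x) (γ j) (fun _ => 1) -
      pairing τ (fun x => pderiv j ρ x * ψ x) (γ i) (fun _ => 1) =
    pairing τ (fun x => pderiv j ρ x * pderiv i ψ x) f (fun _ => 1) -
      pairing τ (fun x => pderiv i ρ x * pderiv j ψ x) f (fun _ => 1) := by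
  have cψ := IsC1Bounded.of_contDiff hΩ hψ
  have cψ' := fun l => IsC1Bounded.of_contDiff hΩ (contDiff_pderiv hψ l)
  rw [← pairing_one_integration_by_parts hΩ hτ cψ (hDu j) i,
    ← pairing_one_integration_by_parts hΩ hτ cψ (hDu i) j,
    ← pairing_one_integration_by_parts hΩ hτ (cψ' i) hu j,
    ← pairing_one_integration_by_parts hΩ hτ (cψ' j) hu i,
    pairing_congr_left (hsymm i j), pderiv_comm hψ i j]
  ring

theorem continuous_gradient (hρ : ContDiff ℝ ∞ ρ) : Continuous (gradient ρ) :=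
  (InnerProductSpace.toDual ℝ (EuclideanSpace ℝ (Fin d))).symm.continuous.comp
    (hρ.continuous_fderiv (by simp))

theorem innerNormal_apply (x : EuclideanSpace ℝ (Fin d)) (i : Fin d) :
    innerNormal ρ x i = -(‖gradient ρ x‖⁻¹ * pderiv i ρ x) := by
  rw [← gradient_apply_eq_pderiv]
  simp [innerNormal]

theorem continuousOn_innerNormal (hΩ : IsSmoothBoundedDomain Ω ρ) (i : Fin d) :
    ContinuousOn (fun x => innerNormal ρ x i) (frontier Ω) := by
  simp only [innerNormal_apply]
  exact (((continuous_gradient hΩ.defining.smooth).norm.continuousOn.inv₀ fun x hx =>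
    norm_ne_zero_iff.2 (hΩ.defining.gradient_ne_zero x hx)).mul
    (contDiff_pderiv hΩ.defining.smooth i).continuous.continuousOn).neg

theorem memLp_tangentialPderiv (hΩ : IsSmoothBoundedDomain Ω ρ) (hτ : IsConormalMeasure Ω ρ τ)
    {φ : EuclideanSpace ℝ (Fin d) → ℂ} (hφ : ContDiff ℝ ∞ φ) (i : Fin d) :
    MemLp (tangentialPderiv ρ i φ) 2 τ := by
  have := hτ.isFinite
  have hN : ∀ i, ContinuousOn (fun x => ((innerNormal ρ x i : ℝ) : ℂ)) (frontier Ω) := fun i =>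
    Complex.continuous_ofReal.comp_continuousOn (continuousOn_innerNormal hΩ i)
  have hP : ∀ i, ContinuousOn (pderiv i φ) (frontier Ω) := fun i =>
    (contDiff_pderiv hφ i).continuous.continuousOn
  have : ContinuousOn (tangentialPderiv ρ i φ) (frontier Ω) :=
    (hP i).sub ((hN i).mul (continuousOn_finsetSum _ fun j _ => (hN j).mul (hP j)))
  exact (memLp_top_conormal hΩ hτ this).mono_exponent le_top

/-- By `pairing_tangential`, the combination `∂ᵢρ γⱼ - ∂ⱼρ γᵢ`, integrated against a smooth `ψ`,
depends on `f` alone. The same formula holds for the smooth functions that approximate `f` in `H¹`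
of the boundary, and passes to the limit with `G` in place of `γ`. No relation between these
functions and those approximating `u` is used. -/
theorem tangential_eq_of_boundaryH1 (hΩ : IsSmoothBoundedDomain Ω ρ)
    (hτ : IsConormalMeasure Ω ρ τ)
    {u : EuclideanSpace ℝ (Fin d) → ℂ} {Du : Fin d → EuclideanSpace ℝ (Fin d) → ℂ}
    {D2u : Fin d → Fin d → EuclideanSpace ℝ (Fin d) → ℂ} {f : EuclideanSpace ℝ (Fin d) → ℂ}
    {γ : Fin d → EuclideanSpace ℝ (Fin d) → ℂ} (hu : HasTrace Ω τ u Du f)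
    (hDu : ∀ j, HasTrace Ω τ (Du j) (fun i => D2u i j) (γ j))
    (hsymm : ∀ i j, D2u i j =ᵐ[volume.restrict Ω] D2u j i)
    {G : Fin d → EuclideanSpace ℝ (Fin d) → ℂ} (hG : IsBoundaryH1 Ω ρ f G) (i j : Fin d) :
    ∀ᵐ x ∂τ, ((pderiv i ρ x : ℝ) : ℂ) * γ j x - ((pderiv j ρ x : ℝ) : ℂ) * γ i x =
      ((pderiv i ρ x : ℝ) : ℂ) * G j x - ((pderiv j ρ x : ℝ) : ℂ) * G i x := by
  have := hτ.isFinite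
  obtain ⟨hf, hGm, φ, hφ, hφf, hφG⟩ := hG
  have hfτ := hτ.memLp hf
  have hGτ := fun i => hτ.memLp (hGm i)
  have hX : ∀ i, MemLp (pderiv i ρ) ⊤ τ := fun i => memLp_top_conormal hΩ hτ
    (contDiff_pderiv hΩ.defining.smooth i).continuous.continuousOn
  have hone : MemLp (fun _ : EuclideanSpace ℝ (Fin d) => (1 : ℂ)) 2 τ := memLp_const 1
  have htest : ∀ ψ : EuclideanSpace ℝ (Fin d) → ℝ, ContDiff ℝ ∞ ψ →
      pairing τ (fun x => pderiv i ρ x * ψ x) (G j) (fun _ => 1) -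
        pairing τ (fun x => pderiv j ρ x * ψ x) (G i) (fun _ => 1) =
      pairing τ (fun x => pderiv j ρ x * pderiv i ψ x) f (fun _ => 1) -
        pairing τ (fun x => pderiv i ρ x * pderiv j ψ x) f (fun _ => 1) := by
    intro ψ hψ
    have hw : ∀ i (χ : EuclideanSpace ℝ (Fin d) → ℝ), ContDiff ℝ ∞ χ →
        MemLp (fun x => pderiv i ρ x * χ x) ⊤ τ := fun i χ hχ => memLp_top_conormal hΩ hτ
      ((contDiff_pderiv hΩ.defining.smooth i).continuous.mul hχ.continuous).continuousOn
    have hone' : TendstoL2 τ (fun _ _ => (1 : ℂ)) (fun _ => 1) := by simp [TendstoL2]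
    have mT := fun i k => memLp_tangentialPderiv hΩ hτ (hφ k) i
    have mφ := fun k => memLp_two_conormal hΩ hτ (hφ k)
    have l1 := (hτ.tendstoL2 (hφG j)).pairing hone' (hw i ψ hψ) (mT j) (hGτ j)
      (fun _ => hone) hone
    have l2 := (hτ.tendstoL2 (hφG i)).pairing hone' (hw j ψ hψ) (mT i) (hGτ i)
      (fun _ => hone) hone
    have l3 := (hτ.tendstoL2 hφf).pairing hone' (hw j _ (contDiff_pderiv hψ i)) mφ hfτ
      (fun _ => hone) hone
    have l4 := (hτ.tendstoL2 hφf).pairing hone' (hw i _ (contDiff_pderiv hψ j)) mφ hfτ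
      (fun _ => hone) hone
    refine tendsto_nhds_unique (l1.sub l2) ((l3.sub l4).congr fun k => ?_)
    have mP := fun i => memLp_two_conormal hΩ hτ (contDiff_pderiv (hφ k) i)
    rw [← pairing_tangential hΩ hτ (hasTrace_of_contDiff hΩ hτ (hφ k))
      (D2u := fun i j => pderiv i (pderiv j (φ k)))
      (fun j => hasTrace_of_contDiff hΩ hτ (contDiff_pderiv (hφ k) j)) (fun i j => by
        rw [pderiv_comm (hφ k)]) hψ i j]
    simp only [pairing]
    rw [← integral_sub (integrable_pairing (hw i ψ hψ) (mP j) hone)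
      (integrable_pairing (hw j ψ hψ) (mP i) hone),
      ← integral_sub (integrable_pairing (hw i ψ hψ) (mT j k) hone)
      (integrable_pairing (hw j ψ hψ) (mT i k) hone)]
    refine integral_congr_ae (Eventually.of_forall fun x => ?_)
    -- The normal component removed from the gradient is parallel to `∇ρ`, so it drops out of the
    -- antisymmetric combination.
    simp only [tangentialPderiv, innerNormal_apply, Complex.real_smul, map_one, mul_one]
    push_cast
    ring
  have hδ : ∀ i, MemLp (fun x => γ i x - G i x) 2 τ := fun i =>
    (hDu i).memLp_trace.sub (hGτ i)
  have hXδ : ∀ i j, MemLp (fun x => pderiv i ρ x • (γ j x - G j x)) 2 τ := fun i j =>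
    (hδ j).smul (hX i)
  have hz := ae_eq_zero_of_integral_contDiff_smul_eq_zero (μ := τ)
    (f := fun x => pderiv i ρ x • (γ j x - G j x) - pderiv j ρ x • (γ i x - G i x))
    (((hXδ i j).sub (hXδ j i)).integrable one_le_two).locallyIntegrable
    (fun ψ hψ _ => by
      have hw : ∀ i, MemLp (fun x => pderiv i ρ x * ψ x) ⊤ τ := fun i => memLp_top_conormal hΩ hτ
        ((contDiff_pderiv hΩ.defining.smooth i).continuous.mul hψ.continuous).continuousOn
      have h1 := pairing_tangential hΩ hτ hu hDu hsymm hψ i j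
      rw [← htest ψ hψ] at h1
      have h2 : pairing τ (fun x => pderiv i ρ x * ψ x) (fun x => γ j x - G j x) (fun _ => 1) -
          pairing τ (fun x => pderiv j ρ x * ψ x) (fun x => γ i x - G i x) (fun _ => 1) = 0 := by
        rw [pairing_sub_left (hw i) (hDu j).memLp_trace (hGτ j) hone,
          pairing_sub_left (hw j) (hDu i).memLp_trace (hGτ i) hone]
        linear_combination h1
      rw [← h2, pairing, pairing, ← integral_sub (integrable_pairing (hw i) (hδ j) hone)
        (integrable_pairing (hw j) (hδ i) hone)]
      refine integral_congr_ae (Eventually.of_forall fun x => ?_)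
      simp only [Complex.real_smul, map_one, mul_one]
      push_cast
      ring)
  filter_upwards [hz] with x hx
  simp only [Complex.real_smul] at hx
  linear_combination hx

end Tangential

end Helmholtz

end

noncomputable section

namespace Helmholtz

/-! ### Bounds for pairings -/

section PairingBounds

variable {d : ℕ} {μ : Measure (EuclideanSpace ℝ (Fin d))}

theorem memLp_top_mul {a b : EuclideanSpace ℝ (Fin d) → ℝ} (ha : MemLp a ⊤ μ)
    (hb : MemLp b ⊤ μ) : MemLp (fun x => a x * b x) ⊤ μ := hb.smul ha

theorem exists_norm_pairing_le {b : EuclideanSpace ℝ (Fin d) → ℝ} (hb : MemLp b ⊤ μ) :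
    ∃ M : ℝ, 0 ≤ M ∧ ∀ f g, MemLp f 2 μ → MemLp g 2 μ →
      ‖pairing μ b f g‖ ≤ M * (l2norm μ f * l2norm μ g) := by
  refine ⟨(eLpNorm b ⊤ μ).toReal, ENNReal.toReal_nonneg, fun f g hf hg =>
    norm_pairing_le hb.aestronglyMeasurable ?_ hf hg⟩
  rw [eLpNorm_exponent_top]
  filter_upwards [ae_le_eLpNormEssSup (f := b) (μ := μ)] with x hx
  have h := ENNReal.toReal_mono (by simpa using hb.eLpNorm_ne_top) hx
  simpa using h

theorem pairing_self (b : EuclideanSpace ℝ (Fin d) → ℝ) (f : EuclideanSpace ℝ (Fin d) → ℂ) :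
    pairing μ b f f = ((∫ x, b x * ‖f x‖ ^ 2 ∂μ : ℝ) : ℂ) := by
  rw [pairing, ← integral_complex_ofReal]
  refine integral_congr_ae (Eventually.of_forall fun x => ?_)
  simp only [Complex.mul_conj, Complex.normSq_eq_norm_sq, Complex.real_smul]
  push_cast
  ring

theorem integrable_mul_norm_sq {b : EuclideanSpace ℝ (Fin d) → ℝ}
    {f : EuclideanSpace ℝ (Fin d) → ℂ} (hb : MemLp b ⊤ μ) (hf : MemLp f 2 μ) :
    Integrable (fun x => b x * ‖f x‖ ^ 2) μ := by
  have h := (integrable_pairing hb hf hf).re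
  refine h.congr (Eventually.of_forall fun x => ?_)
  simp only [Complex.mul_conj, Complex.normSq_eq_norm_sq, Complex.real_smul]
  norm_cast

theorem le_integral_mul_norm_sq {b : EuclideanSpace ℝ (Fin d) → ℝ}
    {f : EuclideanSpace ℝ (Fin d) → ℂ} {m : ℝ} (hb : MemLp b ⊤ μ) (hm : ∀ᵐ x ∂μ, m ≤ b x)
    (hf : MemLp f 2 μ) : m * l2norm μ f ^ 2 ≤ ∫ x, b x * ‖f x‖ ^ 2 ∂μ := by
  rw [norm_sq_l2norm hf, ← integral_const_mul]
  refine integral_mono_ae ((hf.integrable_norm_pow two_ne_zero).const_mul m)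
    (integrable_mul_norm_sq hb hf) ?_
  filter_upwards [hm] with x hx
  exact mul_le_mul_of_nonneg_right hx (by positivity)

theorem integral_mul_norm_sq_le {b : EuclideanSpace ℝ (Fin d) → ℝ}
    {f : EuclideanSpace ℝ (Fin d) → ℂ} {m : ℝ} (hb : MemLp b ⊤ μ) (hm : ∀ᵐ x ∂μ, b x ≤ m)
    (hf : MemLp f 2 μ) : ∫ x, b x * ‖f x‖ ^ 2 ∂μ ≤ m * l2norm μ f ^ 2 := by
  rw [norm_sq_l2norm hf, ← integral_const_mul]
  refine integral_mono_ae (integrable_mul_norm_sq hb hf)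
    ((hf.integrable_norm_pow two_ne_zero).const_mul m) ?_
  filter_upwards [hm] with x hx
  exact mul_le_mul_of_nonneg_right hx (by positivity)

theorem conj_pairing (b : EuclideanSpace ℝ (Fin d) → ℝ) (f g : EuclideanSpace ℝ (Fin d) → ℂ) :
    starRingEnd ℂ (pairing μ b f g) = pairing μ b g f := by
  rw [pairing, pairing, ← integral_conj]
  refine integral_congr_ae (Eventually.of_forall fun x => ?_)
  simp only [Complex.real_smul, map_mul, Complex.conj_ofReal, Complex.conj_conj]
  ring

theorem re_pairing_comm (b : EuclideanSpace ℝ (Fin d) → ℝ)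
    (f g : EuclideanSpace ℝ (Fin d) → ℂ) : (pairing μ b f g).re = (pairing μ b g f).re := by
  rw [← conj_pairing, Complex.conj_re]

end PairingBounds

/-! ### The energy identity and its estimates -/

section Energy

variable {d : ℕ} {Ω : Set (EuclideanSpace ℝ (Fin d))} {ρ : EuclideanSpace ℝ (Fin d) → ℝ}
  {τ : Measure (EuclideanSpace ℝ (Fin d))} {c n : EuclideanSpace ℝ (Fin d) → ℝ}
  {lam : ℂ} {u v f η : EuclideanSpace ℝ (Fin d) → ℂ}
  {Du γ : Fin d → EuclideanSpace ℝ (Fin d) → ℂ}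
  {D2u : Fin d → Fin d → EuclideanSpace ℝ (Fin d) → ℂ}

/-- An `H²` solution of the Helmholtz equation together with its boundary data: the trace `f`, the
trace `γ` of the gradient and the normal derivative `η`. -/
structure IsSolutionWithTraces (Ω : Set (EuclideanSpace ℝ (Fin d)))
    (ρ : EuclideanSpace ℝ (Fin d) → ℝ) (τ : Measure (EuclideanSpace ℝ (Fin d)))
    (c n : EuclideanSpace ℝ (Fin d) → ℝ) (lam : ℂ) (u : EuclideanSpace ℝ (Fin d) → ℂ)
    (Du : Fin d → EuclideanSpace ℝ (Fin d) → ℂ)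
    (D2u : Fin d → Fin d → EuclideanSpace ℝ (Fin d) → ℂ) (v f : EuclideanSpace ℝ (Fin d) → ℂ)
    (γ : Fin d → EuclideanSpace ℝ (Fin d) → ℂ) (η : EuclideanSpace ℝ (Fin d) → ℂ) : Prop where
  trace : HasTrace Ω τ u Du f
  trace_deriv : ∀ j, HasTrace Ω τ (Du j) (fun i => D2u i j) (γ j)
  comm : ∀ i j, D2u i j =ᵐ[volume.restrict Ω] D2u j i
  memLp_source : MemLp v 2 (volume.restrict Ω)
  solves : SolvesHelmholtz Ω c n lam u Du D2u v
  normal : η =ᵐ[τ] fun x => ∑ j, (innerNormal ρ x j : ℂ) * γ j x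

/-- The weight and the test function are left free: `b = 1`, `z = u` leads to the energy identity,
and `b = ∂ₗρ`, `z = ∂ₗu`, summed over `l`, to the Rellich identity. -/
theorem IsSolutionWithTraces.pairing_eq
    (hu : IsSolutionWithTraces Ω ρ τ c n lam u Du D2u v f γ η)
    (hc : MemLp c ⊤ (volume.restrict Ω)) (hc' : ∀ j, MemLp (pderiv j c) ⊤ (volume.restrict Ω))
    (hn : MemLp n ⊤ (volume.restrict Ω)) {b : EuclideanSpace ℝ (Fin d) → ℝ}
    (hb : MemLp b ⊤ (volume.restrict Ω)) {z : EuclideanSpace ℝ (Fin d) → ℂ}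
    (hz : MemLp z 2 (volume.restrict Ω)) :
    ∑ j, (pairing (volume.restrict Ω) (fun x => b x * c x) (D2u j j) z +
      pairing (volume.restrict Ω) (fun x => b x * pderiv j c x) (Du j) z) +
      lam ^ 2 * pairing (volume.restrict Ω) (fun x => b x * n x) u z =
      lam * pairing (volume.restrict Ω) b v z := by
  have i1 := fun j => integrable_pairing (memLp_top_mul hb hc)
    ((hu.trace_deriv j).memLp_deriv j) hz
  have i2 := fun j => integrable_pairing (memLp_top_mul hb (hc' j)) (hu.trace_deriv j).memLp hz
  have i3 := integrable_pairing (memLp_top_mul hb hn) hu.trace.memLp hz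
  simp only [pairing]
  have e1 : ∀ j, (∫ x in Ω, (b x * c x) • (D2u j j x * starRingEnd ℂ (z x))) +
      (∫ x in Ω, (b x * pderiv j c x) • (Du j x * starRingEnd ℂ (z x))) =
      ∫ x in Ω, ((b x * c x) • (D2u j j x * starRingEnd ℂ (z x)) +
        (b x * pderiv j c x) • (Du j x * starRingEnd ℂ (z x))) :=
    fun j => (integral_add (i1 j) (i2 j)).symm
  simp only [e1]
  have i12 : ∀ j ∈ Finset.univ, Integrable (fun x =>
      (b x * c x) • (D2u j j x * starRingEnd ℂ (z x)) +
        (b x * pderiv j c x) • (Du j x * starRingEnd ℂ (z x))) (volume.restrict Ω) :=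
    fun j _ => (i1 j).add (i2 j)
  rw [← integral_finsetSum _ i12, ← integral_const_mul,
    ← integral_const_mul, ← integral_add (integrable_finsetSum _ i12) (i3.const_mul _)]
  refine integral_congr_ae ?_
  filter_upwards [hu.solves] with x hx
  have h := congrArg (fun w => (b x : ℂ) * (w * starRingEnd ℂ (z x))) hx
  simp only [add_mul, mul_add, Finset.sum_mul, Finset.mul_sum] at h
  simp only [Complex.real_smul]
  push_cast
  calc _ = _ := ?_
    _ = _ := h
    _ = _ := by ring
  congr 1
  · refine Finset.sum_congr rfl fun j _ => ?_
    ring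
  · ring

/-- The minus sign arises because `∇ρ` points outwards while the normal derivative is taken along
the inner normal. -/
theorem sum_pderiv_mul_trace (hΩ : IsSmoothBoundedDomain Ω ρ) (hτ : IsConormalMeasure Ω ρ τ)
    (hu : IsSolutionWithTraces Ω ρ τ c n lam u Du D2u v f γ η) :
    ∀ᵐ x ∂τ, ∑ j, ((pderiv j ρ x : ℝ) : ℂ) * γ j x = -(‖gradient ρ x‖ * η x) := by
  filter_upwards [hu.normal, hτ.ae_mem] with x hx hxΓ
  have h0 : ‖gradient ρ x‖ ≠ 0 := norm_ne_zero_iff.2 (hΩ.defining.gradient_ne_zero x hxΓ)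
  have h0' : ((‖gradient ρ x‖ : ℝ) : ℂ) ≠ 0 := by exact_mod_cast h0
  rw [hx, Finset.mul_sum, ← Finset.sum_neg_distrib]
  refine Finset.sum_congr rfl fun j _ => ?_
  rw [innerNormal_apply]
  push_cast
  field_simp

theorem memLp_top_norm_gradient_mul (hΩ : IsSmoothBoundedDomain Ω ρ)
    (hτ : IsConormalMeasure Ω ρ τ) (hc : IsC1Bounded Ω c) :
    MemLp (fun x => ‖gradient ρ x‖ * c x) ⊤ τ :=
  memLp_top_conormal hΩ hτ ((continuous_gradient hΩ.defining.smooth).norm.continuousOn.mul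
    (hc.continuousOn.mono frontier_subset_closure))

theorem memLp_innerNormal (hΩ : IsSmoothBoundedDomain Ω ρ) (hτ : IsConormalMeasure Ω ρ τ)
    (hu : IsSolutionWithTraces Ω ρ τ c n lam u Du D2u v f γ η) : MemLp η 2 τ := by
  refine (memLp_congr_ae hu.normal).2 (memLp_finsetSum _ fun j _ => ?_)
  have h : MemLp (fun x => innerNormal ρ x j • γ j x) 2 τ :=
    (hu.trace_deriv j).memLp_trace.smul (memLp_top_conormal hΩ hτ (continuousOn_innerNormal hΩ j))
  refine h.ae_eq (Eventually.of_forall fun x => ?_)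
  simp

theorem sum_pairing_conormal (hΩ : IsSmoothBoundedDomain Ω ρ) (hτ : IsConormalMeasure Ω ρ τ)
    (hc : IsC1Bounded Ω c) (hu : IsSolutionWithTraces Ω ρ τ c n lam u Du D2u v f γ η) :
    ∑ j, pairing τ (fun x => pderiv j ρ x * c x) (γ j) f =
      -pairing τ (fun x => ‖gradient ρ x‖ * c x) η f := by
  have hw : ∀ j, MemLp (fun x => pderiv j ρ x * c x) ⊤ τ := fun j => memLp_top_conormal hΩ hτ
    ((contDiff_pderiv hΩ.defining.smooth j).continuous.continuousOn.mul
      (hc.continuousOn.mono frontier_subset_closure))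
  simp only [pairing]
  rw [← integral_finsetSum _ fun j _ =>
    integrable_pairing (hw j) (hu.trace_deriv j).memLp_trace hu.trace.memLp_trace, ← integral_neg]
  refine integral_congr_ae ?_
  filter_upwards [sum_pderiv_mul_trace hΩ hτ hu] with x hx
  have h := congrArg (fun w => (c x : ℂ) * (w * starRingEnd ℂ (f x))) hx
  simp only [Finset.sum_mul, Finset.mul_sum] at h
  simp only [Complex.real_smul]
  push_cast
  calc _ = _ := Finset.sum_congr rfl fun j _ => by ring
    _ = _ := h
    _ = _ := by ring

/-- The energy identity. -/
theorem energy_identity (hΩ : IsSmoothBoundedDomain Ω ρ) (hτ : IsConormalMeasure Ω ρ τ)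
    (hc : IsC1Bounded Ω c) (hn : IsC1Bounded Ω n)
    (hu : IsSolutionWithTraces Ω ρ τ c n lam u Du D2u v f γ η) :
    lam * pairing (volume.restrict Ω) (fun _ => 1) v u -
      lam ^ 2 * pairing (volume.restrict Ω) n u u +
      ∑ j, pairing (volume.restrict Ω) c (Du j) (Du j) =
      -pairing τ (fun x => ‖gradient ρ x‖ * c x) η f := by
  have := hΩ.isFiniteMeasure_restrict
  have h1 := hu.pairing_eq (hc.memLp_top hΩ) (hc.memLp_top_pderiv hΩ) (hn.memLp_top hΩ)
    (b := fun _ => 1) (memLp_const 1) hu.trace.memLp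
  simp only [one_mul] at h1
  rw [← h1, ← sum_pairing_conormal hΩ hτ hc hu, add_sub_cancel_right, ← Finset.sum_add_distrib]
  refine Finset.sum_congr rfl fun j _ => ?_
  rw [← pairing_integration_by_parts hΩ hτ hc (hu.trace_deriv j) hu.trace j]
  ring

theorem mul_add_mul_add_mul_le {N I B x y z : ℝ} (hN : 0 ≤ N) (hI : 0 ≤ I) (hB : 0 ≤ B)
    (hx : 0 ≤ x) (hy : 0 ≤ y) (hz : 0 ≤ z) :
    N * x + I * y + B * z ≤ (N + I + B) * (x + y + z) := by
  have h1 := mul_nonneg hN hy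
  have h2 := mul_nonneg hN hz
  have h3 := mul_nonneg hI hx
  have h4 := mul_nonneg hI hz
  have h5 := mul_nonneg hB hx
  have h6 := mul_nonneg hB hy
  linarith

/-- In the energy identity `∫ n|u|²` and `∫ c|∇u|²` are real. The imaginary part therefore isolates
`Im λ² ∫ n|u|²`, and the real part bounds `∫ c|∇u|²`; the minima of `c` and `n` on the compact
closure give coercivity. -/
theorem exists_energy_estimates (hΩ : IsSmoothBoundedDomain Ω ρ) (hτ : IsConormalMeasure Ω ρ τ)
    (hc : IsC1Bounded Ω c) (hn : IsC1Bounded Ω n) (hc_pos : ∀ x ∈ closure Ω, 0 < c x)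
    (hn_pos : ∀ x ∈ closure Ω, 0 < n x) :
    ∃ M m : ℝ, 0 ≤ M ∧ 0 < m ∧ ∀ (lam : ℂ) (u v f η : EuclideanSpace ℝ (Fin d) → ℂ)
      (Du γ : Fin d → EuclideanSpace ℝ (Fin d) → ℂ)
      (D2u : Fin d → Fin d → EuclideanSpace ℝ (Fin d) → ℂ),
      IsSolutionWithTraces Ω ρ τ c n lam u Du D2u v f γ η →
      m * (|(lam ^ 2).im| * l2norm (volume.restrict Ω) u ^ 2) ≤
        M * (‖lam‖ * (l2norm (volume.restrict Ω) v * l2norm (volume.restrict Ω) u) +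
          l2norm τ η * l2norm τ f) ∧
      m * ∑ j, l2norm (volume.restrict Ω) (Du j) ^ 2 ≤
        M * (‖lam‖ ^ 2 * l2norm (volume.restrict Ω) u ^ 2 +
          ‖lam‖ * (l2norm (volume.restrict Ω) v * l2norm (volume.restrict Ω) u) +
          l2norm τ η * l2norm τ f) := by
  have := hΩ.isFiniteMeasure_restrict
  have hne : (closure Ω).Nonempty := hΩ.isConnected.nonempty.closure
  obtain ⟨xc, hxc, hxc'⟩ := hΩ.isCompact_closure.exists_isMinOn hne hc.continuousOn
  obtain ⟨xn, hxn, hxn'⟩ := hΩ.isCompact_closure.exists_isMinOn hne hn.continuousOn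
  obtain ⟨N, hN0, hN⟩ := exists_norm_pairing_le (hn.memLp_top hΩ)
  obtain ⟨I, hI0, hI⟩ := exists_norm_pairing_le
    (memLp_const 1 : MemLp (fun _ : EuclideanSpace ℝ (Fin d) => (1 : ℝ)) ⊤ (volume.restrict Ω))
  obtain ⟨B, hB0, hB⟩ := exists_norm_pairing_le (memLp_top_norm_gradient_mul hΩ hτ hc)
  have hmin : ∀ a : EuclideanSpace ℝ (Fin d) → ℝ, ∀ y, IsMinOn a (closure Ω) y →
      ∀ᵐ x ∂(volume.restrict Ω), a y ≤ a x := fun a y hy =>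
    (ae_restrict_mem hΩ.isOpen.measurableSet).mono fun x hx => hy (subset_closure hx)
  refine ⟨N + I + B, min (c xc) (n xn), by positivity,
    lt_min (hc_pos xc hxc) (hn_pos xn hxn), ?_⟩
  intro lam u v f η Du γ D2u hu
  have hid := energy_identity hΩ hτ hc hn hu
  have hη := memLp_innerNormal hΩ hτ hu
  have b1 := hI v u hu.memLp_source hu.trace.memLp
  have b2 := hB η f hη hu.trace.memLp_trace
  have b3 := hN u u hu.trace.memLp hu.trace.memLp
  have l1 := le_integral_mul_norm_sq (hn.memLp_top hΩ) (hmin n xn hxn') hu.trace.memLp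
  have l2 := fun j => le_integral_mul_norm_sq (hc.memLp_top hΩ) (hmin c xc hxc')
    (hu.trace_deriv j).memLp
  rw [pairing_self n u] at hid b3
  simp only [pairing_self c] at hid
  set A := ∫ x in Ω, n x * ‖u x‖ ^ 2 with hA
  set P := pairing (volume.restrict Ω) (fun _ => 1) v u with hP
  set Q := pairing τ (fun x => ‖gradient ρ x‖ * c x) η f with hQ
  set U := l2norm (volume.restrict Ω) u with hU
  set V := l2norm (volume.restrict Ω) v with hV
  set W := l2norm τ η with hW
  set F := l2norm τ f with hF
  have hU0 : 0 ≤ U := l2norm_nonneg _ _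
  have hV0 : 0 ≤ V := l2norm_nonneg _ _
  have hW0 : 0 ≤ W := l2norm_nonneg _ _
  have hF0 : 0 ≤ F := l2norm_nonneg _ _
  have hA0 : 0 ≤ A := (mul_nonneg (hn_pos xn hxn).le (sq_nonneg _)).trans l1
  have hlP : ‖lam * P‖ ≤ I * (‖lam‖ * (V * U)) := by
    rw [norm_mul]
    calc ‖lam‖ * ‖P‖ ≤ ‖lam‖ * (I * (V * U)) := by gcongr
      _ = _ := by ring
  have p1 : 0 ≤ ‖lam‖ * (V * U) := by positivity
  have p2 : 0 ≤ W * F := by positivity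
  have p3 : 0 ≤ ‖lam‖ ^ 2 * U ^ 2 := by positivity
  constructor
  · have him := congrArg Complex.im hid
    simp only [Complex.add_im, Complex.sub_im, Complex.neg_im, Complex.im_sum, Complex.ofReal_im,
      Finset.sum_const_zero, Complex.im_mul_ofReal] at him
    have h1 : |(lam ^ 2).im| * A ≤ ‖lam * P‖ + ‖Q‖ := by
      have : (lam ^ 2).im * A = (lam * P).im + Q.im := by linarith
      rw [show |(lam ^ 2).im| * A = |(lam ^ 2).im * A| by rw [abs_mul, abs_of_nonneg hA0], this]
      exact (abs_add_le _ _).trans (add_le_add (Complex.abs_im_le_norm _)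
        (Complex.abs_im_le_norm _))
    calc min (c xc) (n xn) * (|(lam ^ 2).im| * U ^ 2)
        ≤ n xn * (|(lam ^ 2).im| * U ^ 2) := by gcongr; exact min_le_right _ _
      _ = |(lam ^ 2).im| * (n xn * U ^ 2) := by ring
      _ ≤ |(lam ^ 2).im| * A := by gcongr
      _ ≤ I * (‖lam‖ * (V * U)) + B * (W * F) := h1.trans (add_le_add hlP b2)
      _ ≤ (N + I + B) * (‖lam‖ * (V * U) + W * F) := by
        have := mul_add_mul_add_mul_le hN0 hI0 hB0 le_rfl p1 p2
        simpa using this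
  · have hre := congrArg Complex.re hid
    simp only [Complex.add_re, Complex.sub_re, Complex.neg_re, Complex.re_sum, Complex.ofReal_re,
      Complex.re_mul_ofReal] at hre
    have h1 : ∑ j, ∫ x in Ω, c x * ‖Du j x‖ ^ 2 ≤ ‖lam‖ ^ 2 * A + ‖lam * P‖ + ‖Q‖ := by
      have e1 : (lam ^ 2).re * A ≤ ‖lam‖ ^ 2 * A := by
        rw [← norm_pow]
        exact mul_le_mul_of_nonneg_right (Complex.re_le_norm _) hA0
      have e2 := (abs_le.1 (Complex.abs_re_le_norm (lam * P))).1
      have e3 := (abs_le.1 (Complex.abs_re_le_norm Q)).1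
      linarith
    have hA1 : A ≤ N * U ^ 2 := by
      rw [Complex.norm_real, Real.norm_of_nonneg hA0] at b3
      linarith [b3]
    calc min (c xc) (n xn) * ∑ j, l2norm (volume.restrict Ω) (Du j) ^ 2
        ≤ c xc * ∑ j, l2norm (volume.restrict Ω) (Du j) ^ 2 := by
          exact mul_le_mul_of_nonneg_right (min_le_left _ _)
            (Finset.sum_nonneg fun j _ => sq_nonneg _)
      _ ≤ ∑ j, ∫ x in Ω, c x * ‖Du j x‖ ^ 2 := by
          rw [Finset.mul_sum]
          exact Finset.sum_le_sum fun j _ => l2 j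
      _ ≤ ‖lam‖ ^ 2 * (N * U ^ 2) + I * (‖lam‖ * (V * U)) + B * (W * F) := by
          exact h1.trans (add_le_add (add_le_add
            (mul_le_mul_of_nonneg_left hA1 (sq_nonneg _)) hlP) b2)
      _ = N * (‖lam‖ ^ 2 * U ^ 2) + I * (‖lam‖ * (V * U)) + B * (W * F) := by ring
      _ ≤ _ := mul_add_mul_add_mul_le hN0 hI0 hB0 p3 p1 p2

end Energy

end Helmholtz

end

noncomputable section

namespace Helmholtz

/-! ### The Rellich boundary term -/

section Rellich

variable {d : ℕ} {Ω : Set (EuclideanSpace ℝ (Fin d))} {ρ : EuclideanSpace ℝ (Fin d) → ℝ}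
  {τ : Measure (EuclideanSpace ℝ (Fin d))} {c n : EuclideanSpace ℝ (Fin d) → ℝ}
  {lam : ℂ} {u v f η : EuclideanSpace ℝ (Fin d) → ℂ}
  {Du γ G : Fin d → EuclideanSpace ℝ (Fin d) → ℂ}
  {D2u : Fin d → Fin d → EuclideanSpace ℝ (Fin d) → ℂ}

/-- **Lagrange's identity** for a real and a complex vector. -/
theorem sum_norm_sq_mul_sub_mul (X : Fin d → ℝ) (a : Fin d → ℂ) :
    ∑ i, ∑ j, ‖(X i : ℂ) * a j - (X j : ℂ) * a i‖ ^ 2 =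
      2 * ((∑ i, X i ^ 2) * ∑ j, ‖a j‖ ^ 2) - 2 * ‖∑ j, (X j : ℂ) * a j‖ ^ 2 := by
  have key : ∀ r : Fin d → ℝ, ∑ i, ∑ j, (X i * r j - X j * r i) ^ 2 =
      2 * ((∑ i, X i ^ 2) * ∑ j, r j ^ 2) - 2 * (∑ j, X j * r j) ^ 2 := by
    intro r
    have h1 : ∑ i, ∑ j, X i ^ 2 * r j ^ 2 = (∑ i, X i ^ 2) * ∑ j, r j ^ 2 :=
      (Finset.sum_mul_sum _ _ _ _).symm
    have h2 : ∑ i, ∑ j, X j ^ 2 * r i ^ 2 = (∑ i, X i ^ 2) * ∑ j, r j ^ 2 := by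
      rw [Finset.sum_comm]; exact h1
    have h3 : ∑ i, ∑ j, (X i * r i) * (X j * r j) = (∑ j, X j * r j) ^ 2 := by
      rw [sq, Finset.sum_mul_sum]
    calc _ = ∑ i, ∑ j, (X i ^ 2 * r j ^ 2 + X j ^ 2 * r i ^ 2 -
          2 * ((X i * r i) * (X j * r j))) :=
          Finset.sum_congr rfl fun i _ => Finset.sum_congr rfl fun j _ => by ring
      _ = _ := by
        have h4 : ∑ i, ∑ j, 2 * ((X i * r i) * (X j * r j)) = 2 * (∑ j, X j * r j) ^ 2 := by
          rw [← h3, Finset.mul_sum]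
          exact Finset.sum_congr rfl fun i _ => (Finset.mul_sum _ _ _).symm
        simp only [Finset.sum_sub_distrib, Finset.sum_add_distrib, h1, h2, h4]
        ring
  have hn : ∀ z : ℂ, ‖z‖ ^ 2 = z.re ^ 2 + z.im ^ 2 := fun z => by
    rw [← Complex.normSq_eq_norm_sq, Complex.normSq_apply]; ring
  simp only [hn, Complex.sub_re, Complex.sub_im, Complex.re_ofReal_mul, Complex.im_ofReal_mul,
    Complex.re_sum, Complex.im_sum, Finset.sum_add_distrib, key]
  ring

/-- Two vectors with the same tangential part: the norm of the first one is controlled by its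
normal part and by the norm of the second one. -/
theorem sum_norm_sq_le_of_tangential {X : Fin d → ℝ} {a b : Fin d → ℂ}
    (h : ∀ i j, (X i : ℂ) * a j - (X j : ℂ) * a i = (X i : ℂ) * b j - (X j : ℂ) * b i) :
    (∑ i, X i ^ 2) * ∑ j, ‖a j‖ ^ 2 ≤
      ‖∑ j, (X j : ℂ) * a j‖ ^ 2 + (∑ i, X i ^ 2) * ∑ j, ‖b j‖ ^ 2 := by
  have h1 := sum_norm_sq_mul_sub_mul X a
  have h2 := sum_norm_sq_mul_sub_mul X b
  simp only [h] at h1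
  have h3 := sq_nonneg ‖∑ j, (X j : ℂ) * b j‖
  linarith

theorem re_pairing {μ : Measure (EuclideanSpace ℝ (Fin d))} {b : EuclideanSpace ℝ (Fin d) → ℝ}
    {f g : EuclideanSpace ℝ (Fin d) → ℂ} (hb : MemLp b ⊤ μ) (hf : MemLp f 2 μ)
    (hg : MemLp g 2 μ) :
    (pairing μ b f g).re = ∫ x, (b x • (f x * starRingEnd ℂ (g x))).re ∂μ :=
  (integral_re (integrable_pairing hb hf hg)).symm

/-- The pointwise form of the Rellich boundary density, with `X = ∇ρ` and `a` the trace of the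
gradient. -/
theorem sum_re_weighted (X : Fin d → ℝ) (a : Fin d → ℂ) (c : ℝ) :
    ∑ l, ∑ j, (((X j * (X l * c)) • (a j * starRingEnd ℂ (a l))).re -
      1 / 2 * ((X l * (X l * c)) • (a j * starRingEnd ℂ (a j))).re) =
    c * ‖∑ j, (X j : ℂ) * a j‖ ^ 2 - 1 / 2 * (c * ((∑ l, X l ^ 2) * ∑ j, ‖a j‖ ^ 2)) := by
  have h1 : ∑ l, ∑ j, ((X j * (X l * c)) • (a j * starRingEnd ℂ (a l))).re =
      c * ‖∑ j, (X j : ℂ) * a j‖ ^ 2 := by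
    have h2 : (((‖∑ j, (X j : ℂ) * a j‖ ^ 2 : ℝ)) : ℂ) =
        ∑ l, ∑ j, (X j * a j) * (X l * starRingEnd ℂ (a l)) := by
      rw [← Complex.normSq_eq_norm_sq, ← Complex.mul_conj, map_sum, Finset.sum_mul_sum,
        Finset.sum_comm]
      simp
    have h3 := congrArg Complex.re (congrArg (fun w => (c : ℂ) * w) h2)
    simp only [Complex.re_ofReal_mul, Complex.ofReal_re] at h3
    rw [h3, Complex.re_sum, Finset.mul_sum]
    refine Finset.sum_congr rfl fun l _ => ?_
    rw [Complex.re_sum, Finset.mul_sum]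
    refine Finset.sum_congr rfl fun j _ => ?_
    rw [← Complex.re_ofReal_mul]
    congr 1
    rw [Complex.real_smul]
    push_cast
    ring
  have h2 : ∑ l, ∑ j, ((X l * (X l * c)) • (a j * starRingEnd ℂ (a j))).re =
      c * ((∑ l, X l ^ 2) * ∑ j, ‖a j‖ ^ 2) := by
    rw [Finset.sum_mul_sum, Finset.mul_sum]
    refine Finset.sum_congr rfl fun l _ => ?_
    rw [Finset.mul_sum]
    refine Finset.sum_congr rfl fun j _ => ?_
    rw [Complex.mul_conj, Complex.normSq_eq_norm_sq, Complex.real_smul, Complex.re_ofReal_mul,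
      Complex.ofReal_re]
    ring
  simp only [Finset.sum_sub_distrib, ← Finset.mul_sum, h1, h2]

theorem sum_sq_pderiv (x : EuclideanSpace ℝ (Fin d)) :
    ∑ i, pderiv i ρ x ^ 2 = ‖gradient ρ x‖ ^ 2 := by
  rw [EuclideanSpace.norm_sq_eq]
  simp [gradient_apply_eq_pderiv]

theorem IsC1Bounded.mul (hΩ : IsSmoothBoundedDomain Ω ρ) {a b : EuclideanSpace ℝ (Fin d) → ℝ}
    (ha : IsC1Bounded Ω a) (hb : IsC1Bounded Ω b) : IsC1Bounded Ω fun x => a x * b x :=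
  ha.smul hΩ hb

theorem isC1Bounded_pderiv_mul (hΩ : IsSmoothBoundedDomain Ω ρ)
    {a : EuclideanSpace ℝ (Fin d) → ℝ} (ha : IsC1Bounded Ω a) (l : Fin d) :
    IsC1Bounded Ω fun x => pderiv l ρ x * a x :=
  (IsC1Bounded.of_contDiff hΩ (contDiff_pderiv hΩ.defining.smooth l)).mul hΩ ha

theorem memLp_top_pderiv_mul_conormal (hΩ : IsSmoothBoundedDomain Ω ρ)
    (hτ : IsConormalMeasure Ω ρ τ) {a : EuclideanSpace ℝ (Fin d) → ℝ} (ha : IsC1Bounded Ω a)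
    (j l : Fin d) : MemLp (fun x => pderiv j ρ x * (pderiv l ρ x * a x)) ⊤ τ :=
  memLp_top_conormal hΩ hτ ((isC1Bounded_pderiv_mul hΩ (isC1Bounded_pderiv_mul hΩ ha l)
    j).continuousOn.mono frontier_subset_closure)

/-- The boundary term of the Rellich identity. -/
def rellichBoundary (ρ : EuclideanSpace ℝ (Fin d) → ℝ) (τ : Measure (EuclideanSpace ℝ (Fin d)))
    (c : EuclideanSpace ℝ (Fin d) → ℝ) (γ : Fin d → EuclideanSpace ℝ (Fin d) → ℂ) : ℝ :=
  ∑ l, ∑ j, ((pairing τ (fun x => pderiv j ρ x * (pderiv l ρ x * c x)) (γ j) (γ l)).re -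
    1 / 2 * (pairing τ (fun x => pderiv l ρ x * (pderiv l ρ x * c x)) (γ j) (γ j)).re)

theorem rellichBoundary_eq_integral (hΩ : IsSmoothBoundedDomain Ω ρ)
    (hτ : IsConormalMeasure Ω ρ τ) (hc : IsC1Bounded Ω c) (hγ : ∀ j, MemLp (γ j) 2 τ) :
    Integrable (fun x => c x * ‖∑ j, ((pderiv j ρ x : ℝ) : ℂ) * γ j x‖ ^ 2 -
      1 / 2 * (c x * (‖gradient ρ x‖ ^ 2 * ∑ j, ‖γ j x‖ ^ 2))) τ ∧
    rellichBoundary ρ τ c γ = ∫ x, (c x * ‖∑ j, ((pderiv j ρ x : ℝ) : ℂ) * γ j x‖ ^ 2 -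
      1 / 2 * (c x * (‖gradient ρ x‖ ^ 2 * ∑ j, ‖γ j x‖ ^ 2))) ∂τ := by
  have hw := memLp_top_pderiv_mul_conormal hΩ hτ hc
  have i1 : ∀ l j, Integrable (fun x => ((pderiv j ρ x * (pderiv l ρ x * c x)) •
      (γ j x * starRingEnd ℂ (γ l x))).re) τ := fun l j =>
    (integrable_pairing (hw j l) (hγ j) (hγ l)).re
  have i2 : ∀ l j, Integrable (fun x => ((pderiv l ρ x * (pderiv l ρ x * c x)) •
      (γ j x * starRingEnd ℂ (γ j x))).re) τ := fun l j =>
    (integrable_pairing (hw l l) (hγ j) (hγ j)).re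
  have i3 : ∀ l j, Integrable (fun x => ((pderiv j ρ x * (pderiv l ρ x * c x)) •
      (γ j x * starRingEnd ℂ (γ l x))).re - 1 / 2 * ((pderiv l ρ x * (pderiv l ρ x * c x)) •
      (γ j x * starRingEnd ℂ (γ j x))).re) τ := fun l j => (i1 l j).sub ((i2 l j).const_mul _)
  have i4 : ∀ l, Integrable (fun x => ∑ j, (((pderiv j ρ x * (pderiv l ρ x * c x)) •
      (γ j x * starRingEnd ℂ (γ l x))).re - 1 / 2 * ((pderiv l ρ x * (pderiv l ρ x * c x)) •
      (γ j x * starRingEnd ℂ (γ j x))).re)) τ := fun l =>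
    integrable_finsetSum _ fun j _ => i3 l j
  have hpt : ∀ x, ∑ l, ∑ j, (((pderiv j ρ x * (pderiv l ρ x * c x)) •
      (γ j x * starRingEnd ℂ (γ l x))).re - 1 / 2 * ((pderiv l ρ x * (pderiv l ρ x * c x)) •
      (γ j x * starRingEnd ℂ (γ j x))).re) =
      c x * ‖∑ j, ((pderiv j ρ x : ℝ) : ℂ) * γ j x‖ ^ 2 -
      1 / 2 * (c x * (‖gradient ρ x‖ ^ 2 * ∑ j, ‖γ j x‖ ^ 2)) := fun x => by
    rw [sum_re_weighted (fun j => pderiv j ρ x) (fun j => γ j x) (c x), sum_sq_pderiv]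
  constructor
  · refine (integrable_finsetSum Finset.univ fun l _ => i4 l).congr
      (Eventually.of_forall fun x => hpt x)
  · rw [rellichBoundary, ← integral_congr_ae (Eventually.of_forall hpt),
      integral_finsetSum _ fun l _ => i4 l]
    refine Finset.sum_congr rfl fun l _ => ?_
    rw [integral_finsetSum _ fun j _ => i3 l j]
    refine Finset.sum_congr rfl fun j _ => ?_
    rw [re_pairing (hw j l) (hγ j) (hγ l), re_pairing (hw l l) (hγ j) (hγ j),
      integral_sub (i1 l j) ((i2 l j).const_mul _), integral_const_mul]

/-- Put `b = c |∇ρ|² / 2`. The density is `2b|η|² - b|γ|²`. As `γ` and `G` have the same tangential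
part, Lagrange's identity gives `|γ|² ≤ |η|² + |G|²`, so the density is at least `b|η|² - b|G|²`. On
the compact boundary `b` is bounded above and bounded away from zero. -/
theorem exists_rellichBoundary_ge (hΩ : IsSmoothBoundedDomain Ω ρ)
    (hτ : IsConormalMeasure Ω ρ τ) (hne : (frontier Ω).Nonempty) (hc : IsC1Bounded Ω c)
    (hc_pos : ∀ x ∈ closure Ω, 0 < c x) :
    ∃ M m : ℝ, 0 ≤ M ∧ 0 < m ∧ ∀ (lam : ℂ) (u v f η : EuclideanSpace ℝ (Fin d) → ℂ)
      (Du γ G : Fin d → EuclideanSpace ℝ (Fin d) → ℂ)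
      (D2u : Fin d → Fin d → EuclideanSpace ℝ (Fin d) → ℂ),
      IsSolutionWithTraces Ω ρ τ c n lam u Du D2u v f γ η → IsBoundaryH1 Ω ρ f G →
      m * l2norm τ η ^ 2 ≤ M * ∑ i, l2norm τ (G i) ^ 2 + rellichBoundary ρ τ c γ := by
  set b : EuclideanSpace ℝ (Fin d) → ℝ := fun x => 1 / 2 * (c x * ‖gradient ρ x‖ ^ 2) with hb
  have hbc : ContinuousOn b (frontier Ω) := continuousOn_const.mul
    ((hc.continuousOn.mono frontier_subset_closure).mul
      ((continuous_gradient hΩ.defining.smooth).norm.pow 2).continuousOn)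
  have hbL : MemLp b ⊤ τ := memLp_top_conormal hΩ hτ hbc
  have hbpos : ∀ x ∈ frontier Ω, 0 < b x := fun x hx => by
    have h1 := hc_pos x (frontier_subset_closure hx)
    have h2 := norm_pos_iff.2 (hΩ.defining.gradient_ne_zero x hx)
    positivity
  obtain ⟨y, hy, hymin⟩ := hΩ.isCompact_frontier.exists_isMinOn hne hbc
  obtain ⟨z, hz, hzmax⟩ := hΩ.isCompact_frontier.exists_isMaxOn hne hbc
  refine ⟨b z, b y, (hbpos z hz).le, hbpos y hy, ?_⟩
  intro lam u v f η Du γ G D2u hu hG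
  have hη := memLp_innerNormal hΩ hτ hu
  have hGτ := fun i => hτ.memLp (hG.2.1 i)
  have h1 := le_integral_mul_norm_sq hbL (hτ.ae_mem.mono fun x hx => hymin hx) hη
  have h2 := fun i => integral_mul_norm_sq_le hbL (hτ.ae_mem.mono fun x hx => hzmax hx) (hGτ i)
  obtain ⟨hint, heq⟩ := rellichBoundary_eq_integral hΩ hτ hc
    fun j => (hu.trace_deriv j).memLp_trace
  have hiG : Integrable (fun x => ∑ i, b x * ‖G i x‖ ^ 2) τ :=
    integrable_finsetSum _ fun i _ => integrable_mul_norm_sq hbL (hGτ i)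
  have h3 : ∫ x, b x * ‖η x‖ ^ 2 ∂τ ≤ (∑ i, ∫ x, b x * ‖G i x‖ ^ 2 ∂τ) +
      rellichBoundary ρ τ c γ := by
    rw [heq, ← integral_finsetSum _ fun i _ => integrable_mul_norm_sq hbL (hGτ i),
      ← integral_add hiG hint]
    refine integral_mono_ae (integrable_mul_norm_sq hbL hη) (hiG.add hint) ?_
    have htan : ∀ᵐ x ∂τ, ∀ i j, ((pderiv i ρ x : ℝ) : ℂ) * γ j x - ((pderiv j ρ x : ℝ) : ℂ) * γ i x =
        ((pderiv i ρ x : ℝ) : ℂ) * G j x - ((pderiv j ρ x : ℝ) : ℂ) * G i x :=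
      ae_all_iff.2 fun i => ae_all_iff.2 fun j =>
        tangential_eq_of_boundaryH1 hΩ hτ hu.trace hu.trace_deriv hu.comm hG i j
    filter_upwards [htan, hτ.ae_mem, sum_pderiv_mul_trace hΩ hτ hu] with x ht hx hn
    have h4 := sum_norm_sq_le_of_tangential ht
    have hnorm : ‖∑ j, ((pderiv j ρ x : ℝ) : ℂ) * γ j x‖ ^ 2 = ‖gradient ρ x‖ ^ 2 * ‖η x‖ ^ 2 := by
      rw [hn, norm_neg, norm_mul, Complex.norm_real, norm_norm, mul_pow]
    rw [sum_sq_pderiv, hnorm] at h4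
    change b x * ‖η x‖ ^ 2 ≤ (∑ i, b x * ‖G i x‖ ^ 2) +
      (c x * ‖∑ j, ((pderiv j ρ x : ℝ) : ℂ) * γ j x‖ ^ 2 -
        1 / 2 * (c x * (‖gradient ρ x‖ ^ 2 * ∑ j, ‖γ j x‖ ^ 2)))
    rw [hnorm, ← Finset.mul_sum, hb]
    have h5 := mul_le_mul_of_nonneg_left h4 (hc_pos x (frontier_subset_closure hx)).le
    simp only
    linarith
  have h6 : ∑ i, ∫ x, b x * ‖G i x‖ ^ 2 ∂τ ≤ b z * ∑ i, l2norm τ (G i) ^ 2 := by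
    rw [Finset.mul_sum]
    exact Finset.sum_le_sum fun i _ => h2 i
  linarith

end Rellich

end Helmholtz

end

noncomputable section

namespace Helmholtz

/-! ### The Rellich identity and its interior terms -/

section Rellich

variable {d : ℕ} {Ω : Set (EuclideanSpace ℝ (Fin d))} {ρ : EuclideanSpace ℝ (Fin d) → ℝ}
  {τ : Measure (EuclideanSpace ℝ (Fin d))} {c n : EuclideanSpace ℝ (Fin d) → ℝ}
  {lam : ℂ} {u v f η : EuclideanSpace ℝ (Fin d) → ℂ}
  {Du γ G : Fin d → EuclideanSpace ℝ (Fin d) → ℂ}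
  {D2u : Fin d → Fin d → EuclideanSpace ℝ (Fin d) → ℂ}

theorem pairing_congr_right {μ : Measure (EuclideanSpace ℝ (Fin d))}
    {b : EuclideanSpace ℝ (Fin d) → ℝ} {f g g' : EuclideanSpace ℝ (Fin d) → ℂ}
    (h : g =ᵐ[μ] g') : pairing μ b f g = pairing μ b f g' :=
  integral_congr_ae (h.mono fun x hx => by simp only [hx])

/-- **Rellich's identity** for the vector field `∇ρ`. -/
theorem rellich_identity (hΩ : IsSmoothBoundedDomain Ω ρ) (hτ : IsConormalMeasure Ω ρ τ)
    (hc : IsC1Bounded Ω c) (hn : IsC1Bounded Ω n)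
    (hu : IsSolutionWithTraces Ω ρ τ c n lam u Du D2u v f γ η) :
    rellichBoundary ρ τ c γ =
      ∑ l, ((∑ j, ((pairing (volume.restrict Ω) (pderiv j fun x => pderiv l ρ x * c x)
          (Du j) (Du l)).re -
        1 / 2 * (pairing (volume.restrict Ω) (pderiv l fun x => pderiv l ρ x * c x)
          (Du j) (Du j)).re -
        (pairing (volume.restrict Ω) (fun x => pderiv l ρ x * pderiv j c x) (Du j) (Du l)).re)) +
      (lam * pairing (volume.restrict Ω) (pderiv l ρ) v (Du l)).re -
      (lam ^ 2 * pairing (volume.restrict Ω) (fun x => pderiv l ρ x * n x) u (Du l)).re) := by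
  rw [rellichBoundary]
  refine Finset.sum_congr rfl fun l _ => ?_
  have hX := IsC1Bounded.of_contDiff hΩ (contDiff_pderiv hΩ.defining.smooth l)
  have ha := isC1Bounded_pderiv_mul hΩ hc l
  have hpde := congrArg Complex.re (hu.pairing_eq (hc.memLp_top hΩ) (hc.memLp_top_pderiv hΩ)
    (hn.memLp_top hΩ) (hX.memLp_top hΩ) (hu.trace_deriv l).memLp)
  simp only [Complex.add_re, Complex.re_sum] at hpde
  rw [← hpde]
  have key : ∀ j, (pairing τ (fun x => pderiv j ρ x * (pderiv l ρ x * c x)) (γ j) (γ l)).re -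
      1 / 2 * (pairing τ (fun x => pderiv l ρ x * (pderiv l ρ x * c x)) (γ j) (γ j)).re =
      ((pairing (volume.restrict Ω) (pderiv j fun x => pderiv l ρ x * c x) (Du j) (Du l)).re -
        1 / 2 * (pairing (volume.restrict Ω) (pderiv l fun x => pderiv l ρ x * c x)
          (Du j) (Du j)).re -
        (pairing (volume.restrict Ω) (fun x => pderiv l ρ x * pderiv j c x) (Du j) (Du l)).re) +
      ((pairing (volume.restrict Ω) (fun x => pderiv l ρ x * c x) (D2u j j) (Du l)).re +
        (pairing (volume.restrict Ω) (fun x => pderiv l ρ x * pderiv j c x) (Du j) (Du l)).re) := by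
    intro j
    have h1 := congrArg Complex.re
      (pairing_integration_by_parts hΩ hτ ha (hu.trace_deriv j) (hu.trace_deriv l) j)
    have h2 := congrArg Complex.re
      (pairing_integration_by_parts hΩ hτ ha (hu.trace_deriv j) (hu.trace_deriv j) l)
    simp only [Complex.add_re] at h1 h2
    -- The two second-derivative terms of `h2` have equal real parts, and by symmetry of second
    -- derivatives these equal the one in `h1` containing `D2u j l`. With the factor `1 / 2` they
    -- cancel, leaving only the term with `D2u j j`, which the equation controls.
    rw [re_pairing_comm _ (D2u l j), pairing_congr_right (hu.comm l j)] at h2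
    linarith
  simp only [key, Finset.sum_add_distrib]
  ring

/-- The quantity controlling the interior terms of the Rellich identity. -/
def rellichBound (lam : ℂ) (U V F D : ℝ) : ℝ :=
  D ^ 2 + ‖lam‖ * (V * D) + ‖lam‖ ^ 2 * (F ^ 2 + U ^ 2) + |(lam ^ 2).im| * (U * D)

/-- Since `2 Re (u ∂ₗū) = ∂ₗ|u|²`, integrating by parts removes the derivative of `u`, at the price
of a boundary term in `f`. -/
theorem two_mul_re_pairing_deriv (hΩ : IsSmoothBoundedDomain Ω ρ) (hτ : IsConormalMeasure Ω ρ τ)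
    {a : EuclideanSpace ℝ (Fin d) → ℝ} (ha : IsC1Bounded Ω a) (hu : HasTrace Ω τ u Du f)
    (l : Fin d) :
    2 * (pairing (volume.restrict Ω) a u (Du l)).re =
      (pairing τ (fun x => pderiv l ρ x * a x) f f).re -
        (pairing (volume.restrict Ω) (pderiv l a) u u).re := by
  have h := congrArg Complex.re (pairing_integration_by_parts hΩ hτ ha hu hu l)
  simp only [Complex.add_re] at h
  rw [re_pairing_comm _ (Du l)] at h
  linarith

/-- Every interior term follows from Cauchy–Schwarz except the one with `λ²`, where that would cost
`‖λ‖² ‖u‖ ‖∇u‖`, one power of `Re λ` too many. -/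
theorem exists_rellichBoundary_le (hΩ : IsSmoothBoundedDomain Ω ρ) (hτ : IsConormalMeasure Ω ρ τ)
    (hc : IsC1Bounded Ω c) (hn : IsC1Bounded Ω n) :
    ∃ M : ℝ, 0 ≤ M ∧ ∀ (lam : ℂ) (u v f η : EuclideanSpace ℝ (Fin d) → ℂ)
      (Du γ : Fin d → EuclideanSpace ℝ (Fin d) → ℂ)
      (D2u : Fin d → Fin d → EuclideanSpace ℝ (Fin d) → ℂ),
      IsSolutionWithTraces Ω ρ τ c n lam u Du D2u v f γ η →
      rellichBoundary ρ τ c γ ≤ M * rellichBound lam (l2norm (volume.restrict Ω) u)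
        (l2norm (volume.restrict Ω) v) (l2norm τ f)
        √(∑ j, l2norm (volume.restrict Ω) (Du j) ^ 2) := by
  have hX := fun l => (IsC1Bounded.of_contDiff hΩ (contDiff_pderiv hΩ.defining.smooth l)).memLp_top
    hΩ
  have ha := fun l => isC1Bounded_pderiv_mul hΩ hc l
  have hb := fun l => isC1Bounded_pderiv_mul hΩ hn l
  choose A hA0 hA using fun l j => exists_norm_pairing_le ((ha l).memLp_top_pderiv hΩ j)
  choose E hE0 hE using fun l j => exists_norm_pairing_le
    (memLp_top_mul (hX l) (hc.memLp_top_pderiv hΩ j))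
  choose P hP0 hP using fun l => exists_norm_pairing_le (hX l)
  choose Q hQ0 hQ using fun l => exists_norm_pairing_le ((hb l).memLp_top hΩ)
  choose R hR0 hR using fun l => exists_norm_pairing_le ((hb l).memLp_top_pderiv hΩ l)
  choose S hS0 hS using fun l => exists_norm_pairing_le
    (memLp_top_pderiv_mul_conormal hΩ hτ hn l l)
  refine ⟨∑ l, ((∑ j, (A l j + A l l + E l j)) + P l + Q l + R l + S l), ?_, ?_⟩
  · refine Finset.sum_nonneg fun l _ => ?_
    have : 0 ≤ ∑ j, (A l j + A l l + E l j) := Finset.sum_nonneg fun j _ =>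
      add_nonneg (add_nonneg (hA0 l j) (hA0 l l)) (hE0 l j)
    linarith [hP0 l, hQ0 l, hR0 l, hS0 l]
  intro lam u v f η Du γ D2u hu
  rw [rellich_identity hΩ hτ hc hn hu, Finset.sum_mul]
  refine Finset.sum_le_sum fun l _ => ?_
  have mD := fun j => (hu.trace_deriv j).memLp
  set U := l2norm (volume.restrict Ω) u with hU
  set V := l2norm (volume.restrict Ω) v with hV
  set F := l2norm τ f with hF
  set D := √(∑ j, l2norm (volume.restrict Ω) (Du j) ^ 2) with hD
  have hU0 : 0 ≤ U := l2norm_nonneg _ _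
  have hV0 : 0 ≤ V := l2norm_nonneg _ _
  have hF0 : 0 ≤ F := l2norm_nonneg _ _
  have hD0 : 0 ≤ D := Real.sqrt_nonneg _
  have hDj : ∀ j, l2norm (volume.restrict Ω) (Du j) ≤ D := fun j =>
    Real.le_sqrt_of_sq_le (Finset.single_le_sum
      (f := fun j => l2norm (volume.restrict Ω) (Du j) ^ 2) (fun _ _ => sq_nonneg _)
      (Finset.mem_univ j))
  have hDj0 : ∀ j, 0 ≤ l2norm (volume.restrict Ω) (Du j) := fun j => l2norm_nonneg _ _
  have hDD : ∀ i j, l2norm (volume.restrict Ω) (Du i) * l2norm (volume.restrict Ω) (Du j) ≤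
      D ^ 2 := fun i j => by
    rw [sq]; exact mul_le_mul (hDj i) (hDj j) (hDj0 j) hD0
  clear_value D U V F
  set z1 := D ^ 2 with hz1
  set z2 := ‖lam‖ * (V * D) with hz2
  set z3 := ‖lam‖ ^ 2 * (F ^ 2 + U ^ 2) with hz3
  set z4 := |(lam ^ 2).im| * (U * D) with hz4
  have hz10 : 0 ≤ z1 := by positivity
  have hz20 : 0 ≤ z2 := by positivity
  have hz30 : 0 ≤ z3 := by positivity
  have hz40 : 0 ≤ z4 := by positivity
  set Z := rellichBound lam U V F D with hZ
  have hZeq : Z = z1 + z2 + z3 + z4 := rfl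
  clear_value Z z1 z2 z3 z4
  have t1 : ∑ j, ((pairing (volume.restrict Ω) (pderiv j fun x => pderiv l ρ x * c x)
        (Du j) (Du l)).re -
      1 / 2 * (pairing (volume.restrict Ω) (pderiv l fun x => pderiv l ρ x * c x)
        (Du j) (Du j)).re -
      (pairing (volume.restrict Ω) (fun x => pderiv l ρ x * pderiv j c x) (Du j) (Du l)).re) ≤
      (∑ j, (A l j + A l l + E l j)) * Z := by
    rw [Finset.sum_mul]
    refine Finset.sum_le_sum fun j _ => ?_
    have e1 := (Complex.abs_re_le_norm _).trans ((hA l j _ _ (mD j) (mD l)).trans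
      (mul_le_mul_of_nonneg_left (hDD j l) (hA0 l j)))
    have e2 := (Complex.abs_re_le_norm _).trans ((hA l l _ _ (mD j) (mD j)).trans
      (mul_le_mul_of_nonneg_left (hDD j j) (hA0 l l)))
    have e3 := (Complex.abs_re_le_norm _).trans ((hE l j _ _ (mD j) (mD l)).trans
      (mul_le_mul_of_nonneg_left (hDD j l) (hE0 l j)))
    have e4 : (A l j + A l l + E l j) * z1 ≤ (A l j + A l l + E l j) * Z :=
      mul_le_mul_of_nonneg_left (by linarith)
        (add_nonneg (add_nonneg (hA0 l j) (hA0 l l)) (hE0 l j))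
    have e5 := mul_nonneg (hA0 l l) hz10
    have f1 := (abs_le.1 e1).2
    have f2 := (abs_le.1 e2).1
    have f3 := (abs_le.1 e3).1
    linarith
  have t2 : (lam * pairing (volume.restrict Ω) (pderiv l ρ) v (Du l)).re ≤ P l * Z := by
    refine (Complex.re_le_norm _).trans ?_
    rw [norm_mul]
    calc ‖lam‖ * ‖pairing (volume.restrict Ω) (pderiv l ρ) v (Du l)‖
        ≤ ‖lam‖ * (P l * (V * D)) := by
          refine mul_le_mul_of_nonneg_left ((hP l _ _ hu.memLp_source (mD l)).trans ?_)
            (norm_nonneg _)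
          rw [← hV]
          exact mul_le_mul_of_nonneg_left (mul_le_mul_of_nonneg_left (hDj l) hV0) (hP0 l)
      _ = P l * z2 := by rw [hz2]; ring
      _ ≤ P l * Z := mul_le_mul_of_nonneg_left (by linarith) (hP0 l)
  have t3 : -(lam ^ 2 * pairing (volume.restrict Ω) (fun x => pderiv l ρ x * n x) u (Du l)).re ≤
      (Q l + R l + S l) * Z := by
    set q := pairing (volume.restrict Ω) (fun x => pderiv l ρ x * n x) u (Du l) with hq
    have h1 : ‖q‖ ≤ Q l * (U * D) := by
      refine (hQ l _ _ hu.trace.memLp (mD l)).trans ?_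
      rw [← hU]
      exact mul_le_mul_of_nonneg_left (mul_le_mul_of_nonneg_left (hDj l) hU0) (hQ0 l)
    have h2 := two_mul_re_pairing_deriv hΩ hτ (hb l) hu.trace l
    rw [← hq] at h2
    have h3 := (Complex.abs_re_le_norm _).trans (hR l u u hu.trace.memLp hu.trace.memLp)
    have h4 := (Complex.abs_re_le_norm _).trans (hS l f f hu.trace.memLp_trace
      hu.trace.memLp_trace)
    have h5 : |q.re| ≤ (R l + S l) * (F ^ 2 + U ^ 2) := by
      have g1 := mul_nonneg (hR0 l) (sq_nonneg F)
      have g2 := mul_nonneg (hS0 l) (sq_nonneg U)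
      have g3 := mul_nonneg (hR0 l) (sq_nonneg U)
      have g4 := mul_nonneg (hS0 l) (sq_nonneg F)
      have f3 := abs_le.1 h3
      have f4 := abs_le.1 h4
      rw [← hU] at f3
      rw [← hF] at f4
      rw [abs_le]
      constructor <;> nlinarith [f3.1, f3.2, f4.1, f4.2]
    have h6 : |(lam ^ 2).re| ≤ ‖lam‖ ^ 2 := by
      rw [← norm_pow]; exact Complex.abs_re_le_norm _
    -- The large factor `Re λ²` meets only `Re q`, from which the derivative has been removed; `Im
    -- q` is bounded by Cauchy–Schwarz and meets only `Im λ²`.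
    have h7 : -(lam ^ 2 * q).re ≤ |(lam ^ 2).re| * |q.re| + |(lam ^ 2).im| * |q.im| := by
      rw [Complex.mul_re, ← abs_mul, ← abs_mul]
      linarith [neg_abs_le ((lam ^ 2).re * q.re), le_abs_self ((lam ^ 2).im * q.im)]
    have h8 : |(lam ^ 2).re| * |q.re| ≤ ‖lam‖ ^ 2 * ((R l + S l) * (F ^ 2 + U ^ 2)) :=
      mul_le_mul h6 h5 (abs_nonneg _) (sq_nonneg _)
    have h9 : |(lam ^ 2).im| * |q.im| ≤ |(lam ^ 2).im| * (Q l * (U * D)) :=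
      mul_le_mul_of_nonneg_left ((Complex.abs_im_le_norm _).trans h1) (abs_nonneg _)
    calc -(lam ^ 2 * q).re ≤ (R l + S l) * z3 + Q l * z4 := by
          rw [hz3, hz4]; linarith
      _ ≤ (R l + S l) * Z + Q l * Z := add_le_add
          (mul_le_mul_of_nonneg_left (by linarith) (add_nonneg (hR0 l) (hS0 l)))
          (mul_le_mul_of_nonneg_left (by linarith) (hQ0 l))
      _ = _ := by ring
  linarith

end Rellich

end Helmholtz

end

noncomputable section

namespace Helmholtz

/-! ### Combining the scalar inequalities -/

section Combination

/-- Eliminate `δ` through `hB`, multiply by `a ^ 2`, and eliminate `a ^ 2 * U ^ 2` through `hA`.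
What remains besides data is a multiple of `a * (w * F)`, which is absorbed in the left side. -/
theorem sq_mul_sq_le_of_estimates {L k a U V w F δ g : ℝ} (hL : 1 ≤ L) (ha0 : 0 ≤ a) (hak : a ≤ k)
    (hw : 0 ≤ w) (hF : 0 ≤ F)
    (hA : a * U ^ 2 ≤ L * (V * U + w * F)) (hB : δ ^ 2 ≤ L * (U ^ 2 + V * U + w * F))
    (hC : w ^ 2 ≤ L * (g ^ 2 + F ^ 2 + δ ^ 2 + V * δ + U ^ 2 + U * δ)) :
    a ^ 2 * w ^ 2 ≤ (16 * L ^ 2 * (k ^ 2 + L ^ 2) + (8 * L ^ 2) ^ 2 * (2 * L + k) ^ 2) *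
      (V ^ 2 + (F ^ 2 + g ^ 2)) := by
  have hL0 : 0 ≤ L := by linarith
  have hk0 : 0 ≤ k := ha0.trans hak
  have hwF : 0 ≤ w * F := mul_nonneg hw hF
  have hLL : L ≤ L ^ 2 := by nlinarith
  have h1 : δ ^ 2 ≤ L * (2 * U ^ 2 + V ^ 2 + w * F) := by
    refine hB.trans (mul_le_mul_of_nonneg_left ?_ hL0)
    nlinarith [sq_nonneg (V - U), sq_nonneg U, sq_nonneg V]
  have h2 : w ^ 2 ≤ L * (g ^ 2 + F ^ 2 + V ^ 2 + 2 * U ^ 2) + L * (2 * δ ^ 2) := by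
    have : g ^ 2 + F ^ 2 + δ ^ 2 + V * δ + U ^ 2 + U * δ ≤
        (g ^ 2 + F ^ 2 + V ^ 2 + 2 * U ^ 2) + 2 * δ ^ 2 := by
      nlinarith [sq_nonneg (V - δ), sq_nonneg (U - δ), sq_nonneg U, sq_nonneg V]
    have := mul_le_mul_of_nonneg_left this hL0
    linarith
  have h3 : w ^ 2 ≤ 8 * L ^ 2 * (g ^ 2 + F ^ 2 + V ^ 2 + U ^ 2 + w * F) := by
    have e1 : L * (2 * δ ^ 2) ≤ 2 * L ^ 2 * (2 * U ^ 2 + V ^ 2 + w * F) := by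
      have := mul_le_mul_of_nonneg_left h1 hL0
      linarith
    have e2 : L * (g ^ 2 + F ^ 2 + V ^ 2 + 2 * U ^ 2) ≤
        L ^ 2 * (g ^ 2 + F ^ 2 + V ^ 2 + 2 * U ^ 2) :=
      mul_le_mul_of_nonneg_right hLL (by positivity)
    have e3 : L ^ 2 * (g ^ 2 + F ^ 2 + V ^ 2 + 2 * U ^ 2) +
        2 * L ^ 2 * (2 * U ^ 2 + V ^ 2 + w * F) ≤
        8 * L ^ 2 * (g ^ 2 + F ^ 2 + V ^ 2 + U ^ 2 + w * F) := by
      have : (g ^ 2 + F ^ 2 + V ^ 2 + 2 * U ^ 2) + 2 * (2 * U ^ 2 + V ^ 2 + w * F) ≤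
          8 * (g ^ 2 + F ^ 2 + V ^ 2 + U ^ 2 + w * F) := by
        linarith [sq_nonneg g, sq_nonneg F, sq_nonneg V, sq_nonneg U]
      have := mul_le_mul_of_nonneg_left this (sq_nonneg L)
      linarith
    linarith
  -- After multiplication of `hA` by `a`, the product `(L * V) * (a * U)` is split and half of `a ^
  -- 2 * U ^ 2` is absorbed.
  have h4 : a ^ 2 * U ^ 2 ≤ L ^ 2 * V ^ 2 + 2 * L * (a * (w * F)) := by
    have e1 := mul_le_mul_of_nonneg_left hA ha0
    nlinarith [sq_nonneg (a * U - L * V)]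
  have hak2 : a ^ 2 ≤ k ^ 2 := pow_le_pow_left₀ ha0 hak 2
  set P := 8 * L ^ 2 with hP
  have hP0 : 0 ≤ P := by positivity
  have h5 : a ^ 2 * w ^ 2 ≤ P * (k ^ 2 * (g ^ 2 + F ^ 2) + (k ^ 2 + L ^ 2) * V ^ 2 +
      (2 * L + k) * (a * (w * F))) := by
    have e1 := mul_le_mul_of_nonneg_left h3 (sq_nonneg a)
    have e2 : a ^ 2 * (g ^ 2 + F ^ 2 + V ^ 2) ≤ k ^ 2 * (g ^ 2 + F ^ 2 + V ^ 2) :=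
      mul_le_mul_of_nonneg_right hak2 (by positivity)
    have e3 : a ^ 2 * (w * F) ≤ k * (a * (w * F)) := by
      have := mul_le_mul_of_nonneg_right hak (mul_nonneg ha0 hwF)
      linarith
    have e4 : a ^ 2 * (g ^ 2 + F ^ 2 + V ^ 2 + U ^ 2 + w * F) ≤
        k ^ 2 * (g ^ 2 + F ^ 2) + (k ^ 2 + L ^ 2) * V ^ 2 + (2 * L + k) * (a * (w * F)) := by
      linarith
    have e5 := mul_le_mul_of_nonneg_left e4 hP0
    linarith
  -- Twice the cross term is at most `a ^ 2 * w ^ 2` plus data, so the cross term itself costs only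
  -- half of the left side; this doubles the other constants in `h7`.
  have h6 : 2 * (P * ((2 * L + k) * (a * (w * F)))) ≤
      a ^ 2 * w ^ 2 + P ^ 2 * (2 * L + k) ^ 2 * F ^ 2 := by
    nlinarith [sq_nonneg (a * w - P * (2 * L + k) * F)]
  have h7 : a ^ 2 * w ^ 2 ≤ 2 * P * (k ^ 2 * (g ^ 2 + F ^ 2) + (k ^ 2 + L ^ 2) * V ^ 2) +
      P ^ 2 * (2 * L + k) ^ 2 * F ^ 2 := by linarith
  have h8 : k ^ 2 * (g ^ 2 + F ^ 2) + (k ^ 2 + L ^ 2) * V ^ 2 ≤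
      (k ^ 2 + L ^ 2) * (V ^ 2 + (F ^ 2 + g ^ 2)) := by
    have := mul_nonneg (sq_nonneg L) (add_nonneg (sq_nonneg F) (sq_nonneg g))
    linarith
  have h9 := mul_le_mul_of_nonneg_left h8 (show 0 ≤ 2 * P by positivity)
  have h10 : P ^ 2 * (2 * L + k) ^ 2 * F ^ 2 ≤
      P ^ 2 * (2 * L + k) ^ 2 * (V ^ 2 + (F ^ 2 + g ^ 2)) :=
    mul_le_mul_of_nonneg_left (by linarith [sq_nonneg V, sq_nonneg g]) (by positivity)
  calc a ^ 2 * w ^ 2 ≤ 2 * P * ((k ^ 2 + L ^ 2) * (V ^ 2 + (F ^ 2 + g ^ 2))) +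
        P ^ 2 * (2 * L + k) ^ 2 * (V ^ 2 + (F ^ 2 + g ^ 2)) := by linarith
    _ = _ := by rw [hP]; ring

/-- The energy and Rellich estimates imply the bound on the normal derivative. -/
theorem exists_bound_of_estimates {M₁ m₁ M₂ M₃ m₂ k : ℝ} (hM₁ : 0 ≤ M₁) (hm₁ : 0 < m₁)
    (hM₂ : 0 ≤ M₂) (hM₃ : 0 ≤ M₃) (hm₂ : 0 < m₂) (hk : 0 < k) :
    ∃ C : ℝ, 0 < C ∧ ∀ R a l U V w F δ g : ℝ, 1 ≤ R → 0 ≤ a → a ≤ k → 0 ≤ l → l ≤ (1 + k) * R →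
      0 ≤ U → 0 ≤ V → 0 ≤ w → 0 ≤ F → 0 ≤ δ →
      m₁ * (2 * R * a * U ^ 2) ≤ M₁ * (l * (V * U) + R * w * F) →
      m₁ * (R * δ) ^ 2 ≤ M₁ * (l ^ 2 * U ^ 2 + l * (V * U) + R * w * F) →
      m₂ * (R * w) ^ 2 ≤ M₂ * (R * g) ^ 2 + M₃ * ((R * δ) ^ 2 + l * (V * (R * δ)) +
        l ^ 2 * (F ^ 2 + U ^ 2) + 2 * R * a * (U * (R * δ))) →
      a ^ 2 * w ^ 2 ≤ C * (V ^ 2 + (F ^ 2 + g ^ 2)) := by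
  set K : ℝ := 1 + k with hK
  have hK1 : 1 ≤ K := by linarith
  have hK0 : 0 ≤ K := by linarith
  have hKK : K ≤ K ^ 2 := by nlinarith
  have h1K : 1 ≤ K ^ 2 := by nlinarith
  set N₁ := M₁ / m₁ with hN₁
  set N₂ := (M₂ + M₃) / m₂ with hN₂
  have hN₁0 : 0 ≤ N₁ := by positivity
  have hN₂0 : 0 ≤ N₂ := by positivity
  -- One constant for all three inequalities: it dominates `N₁ * K ^ 2` and `N₂ * (2 * K ^ 2)` and
  -- is at least `1`.
  set L := 1 + 2 * K ^ 2 * (N₁ + N₂) with hL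
  have hL1 : 1 ≤ L := by
    have : 0 ≤ 2 * K ^ 2 * (N₁ + N₂) := by positivity
    linarith
  have hLN₁ : N₁ * K ^ 2 ≤ L := by
    have h1 : 0 ≤ K ^ 2 * N₁ := by positivity
    have h2 : 0 ≤ K ^ 2 * N₂ := by positivity
    linarith
  have hLN₂ : N₂ * (2 * K ^ 2) ≤ L := by
    have h1 : 0 ≤ K ^ 2 * N₁ := by positivity
    linarith
  refine ⟨16 * L ^ 2 * (k ^ 2 + L ^ 2) + (8 * L ^ 2) ^ 2 * (2 * L + k) ^ 2, by positivity, ?_⟩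
  intro R a l U V w F δ g hR ha0 hak hl0 hl hU hV hw hF hδ e1 e2 e3
  have hR0 : 0 < R := by linarith
  have hRR : R ≤ R ^ 2 := by nlinarith
  have hVU : 0 ≤ V * U := mul_nonneg hV hU
  have hwF : 0 ≤ w * F := mul_nonneg hw hF
  have hVδ : 0 ≤ V * δ := mul_nonneg hV hδ
  have hUδ : 0 ≤ U * δ := mul_nonneg hU hδ
  have hl2 : l ^ 2 ≤ K ^ 2 * R ^ 2 := by
    rw [← mul_pow]; exact pow_le_pow_left₀ hl0 hl 2
  refine sq_mul_sq_le_of_estimates hL1 ha0 hak hw hF (U := U) (V := V) (δ := δ) ?_ ?_ ?_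
  · have h1 : m₁ * (2 * (a * U ^ 2)) ≤ M₁ * (K * (V * U) + w * F) := by
      refine le_of_mul_le_mul_left ?_ hR0
      have h2 := mul_le_mul_of_nonneg_left (mul_le_mul_of_nonneg_right hl hVU) hM₁
      linarith
    have h2 : a * U ^ 2 ≤ N₁ * (K * (V * U) + w * F) := by
      rw [hN₁, div_mul_eq_mul_div, le_div_iff₀ hm₁]
      have : 0 ≤ m₁ * (a * U ^ 2) := by positivity
      linarith
    calc a * U ^ 2 ≤ N₁ * (K * (V * U) + w * F) := h2
      _ ≤ N₁ * (K ^ 2 * (V * U + w * F)) := by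
        refine mul_le_mul_of_nonneg_left ?_ hN₁0
        have g1 := mul_le_mul_of_nonneg_right hKK hVU
        have g2 := mul_le_mul_of_nonneg_right h1K hwF
        linarith
      _ = (N₁ * K ^ 2) * (V * U + w * F) := by ring
      _ ≤ _ := mul_le_mul_of_nonneg_right hLN₁ (by positivity)
  · have h1 : m₁ * δ ^ 2 ≤ M₁ * (K ^ 2 * (U ^ 2 + V * U + w * F)) := by
      refine le_of_mul_le_mul_left ?_ (show 0 < R ^ 2 by positivity)
      have g1 : l ^ 2 * U ^ 2 ≤ K ^ 2 * R ^ 2 * U ^ 2 :=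
        mul_le_mul_of_nonneg_right hl2 (sq_nonneg U)
      have g2 : l * (V * U) ≤ K ^ 2 * R ^ 2 * (V * U) :=
        mul_le_mul_of_nonneg_right (hl.trans (mul_le_mul hKK hRR hR0.le (sq_nonneg K))) hVU
      have g3 : R * (w * F) ≤ K ^ 2 * R ^ 2 * (w * F) := by
        refine mul_le_mul_of_nonneg_right ?_ hwF
        have := mul_le_mul_of_nonneg_right h1K (sq_nonneg R)
        linarith
      have g4 : l ^ 2 * U ^ 2 + l * (V * U) + R * w * F ≤
          R ^ 2 * (K ^ 2 * (U ^ 2 + V * U + w * F)) := by linarith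
      have g5 := mul_le_mul_of_nonneg_left g4 hM₁
      linarith
    have h2 : δ ^ 2 ≤ N₁ * (K ^ 2 * (U ^ 2 + V * U + w * F)) := by
      rw [hN₁, div_mul_eq_mul_div, le_div_iff₀ hm₁]
      linarith
    calc δ ^ 2 ≤ N₁ * (K ^ 2 * (U ^ 2 + V * U + w * F)) := h2
      _ = (N₁ * K ^ 2) * (U ^ 2 + V * U + w * F) := by ring
      _ ≤ _ := mul_le_mul_of_nonneg_right hLN₁ (by positivity)
  · set Y := g ^ 2 + F ^ 2 + δ ^ 2 + V * δ + U ^ 2 + U * δ with hY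
    have hY0 : 0 ≤ Y := by positivity
    have h1 : m₂ * w ^ 2 ≤ (M₂ + M₃) * (2 * K ^ 2 * Y) := by
      refine le_of_mul_le_mul_left ?_ (show 0 < R ^ 2 by positivity)
      have g1 : l * (V * (R * δ)) ≤ R ^ 2 * (K ^ 2 * (V * δ)) := by
        have h3 := mul_le_mul_of_nonneg_right hl (mul_nonneg hR0.le hVδ)
        have h4 := mul_le_mul_of_nonneg_right hKK (mul_nonneg (sq_nonneg R) hVδ)
        linarith
      have g2 : l ^ 2 * (F ^ 2 + U ^ 2) ≤ R ^ 2 * (K ^ 2 * (F ^ 2 + U ^ 2)) := by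
        have := mul_le_mul_of_nonneg_right hl2 (show 0 ≤ F ^ 2 + U ^ 2 by positivity)
        linarith
      -- The bound `a ≤ k` makes this term of order `R ^ 2`, the same as the left side.
      have g3 : 2 * R * a * (U * (R * δ)) ≤ R ^ 2 * (2 * K ^ 2 * (U * δ)) := by
        have h3 : a ≤ K ^ 2 := by linarith
        have h4 := mul_le_mul_of_nonneg_right h3 (mul_nonneg (sq_nonneg R) hUδ)
        linarith
      have g4 : (R * δ) ^ 2 ≤ R ^ 2 * (K ^ 2 * δ ^ 2) := by
        have := mul_le_mul_of_nonneg_right h1K (mul_nonneg (sq_nonneg R) (sq_nonneg δ))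
        linarith
      have g5 : (R * g) ^ 2 ≤ R ^ 2 * (K ^ 2 * g ^ 2) := by
        have := mul_le_mul_of_nonneg_right h1K (mul_nonneg (sq_nonneg R) (sq_nonneg g))
        linarith
      have p1 : 0 ≤ R ^ 2 * (K ^ 2 * (V * δ)) := by positivity
      have p2 : 0 ≤ R ^ 2 * (K ^ 2 * (F ^ 2 + U ^ 2)) := by positivity
      have p3 : 0 ≤ R ^ 2 * (2 * K ^ 2 * (U * δ)) := by positivity
      have p4 : 0 ≤ R ^ 2 * (K ^ 2 * δ ^ 2) := by positivity
      have p5 : 0 ≤ R ^ 2 * (K ^ 2 * g ^ 2) := by positivity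
      have q1 : (R * g) ^ 2 ≤ R ^ 2 * (2 * K ^ 2 * Y) := by rw [hY]; linarith
      have q2 : (R * δ) ^ 2 + l * (V * (R * δ)) + l ^ 2 * (F ^ 2 + U ^ 2) +
          2 * R * a * (U * (R * δ)) ≤ R ^ 2 * (2 * K ^ 2 * Y) := by rw [hY]; linarith
      have r1 := mul_le_mul_of_nonneg_left q1 hM₂
      have r2 := mul_le_mul_of_nonneg_left q2 hM₃
      linarith
    have h2 : w ^ 2 ≤ N₂ * (2 * K ^ 2 * Y) := by
      rw [hN₂, div_mul_eq_mul_div, le_div_iff₀ hm₂]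
      linarith
    calc w ^ 2 ≤ N₂ * (2 * K ^ 2 * Y) := h2
      _ = (N₂ * (2 * K ^ 2)) * Y := by ring
      _ ≤ L * Y := mul_le_mul_of_nonneg_right hLN₂ hY0

end Combination

end Helmholtz

end

noncomputable section

namespace Helmholtz

/-! ### Bounds on the normal derivative -/

section NormalDerivative

variable {d : ℕ} {Ω : Set (EuclideanSpace ℝ (Fin d))} {ρ : EuclideanSpace ℝ (Fin d) → ℝ}
  {τ : Measure (EuclideanSpace ℝ (Fin d))} {c n : EuclideanSpace ℝ (Fin d) → ℝ}

/-- Needed to attain extrema on the boundary: with empty frontier the domain would be clopen, hence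
the whole unbounded space. -/
theorem IsSmoothBoundedDomain.nonempty_frontier (hΩ : IsSmoothBoundedDomain Ω ρ) (hd : 0 < d) :
    (frontier Ω).Nonempty := by
  by_contra h
  have hclopen : IsClopen Ω := isClopen_iff_frontier_eq_empty.2 (Set.not_nonempty_iff_eq_empty.1 h)
  have huniv : Ω = Set.univ := hclopen.eq_univ hΩ.isConnected.nonempty
  have : Nonempty (Fin d) := ⟨⟨0, hd⟩⟩
  exact NormedSpace.unbounded_univ ℝ (EuclideanSpace ℝ (Fin d)) (huniv ▸ hΩ.isBounded)

theorem l2norm_const_mul (μ : Measure (EuclideanSpace ℝ (Fin d))) (h : ℝ) (hh : 0 ≤ h)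
    (f : EuclideanSpace ℝ (Fin d) → ℂ) :
    l2norm μ (fun x => (h : ℂ) * f x) = h * l2norm μ f := by
  have : (fun x => (h : ℂ) * f x) = (h : ℂ) • f := rfl
  rw [l2norm, this, eLpNorm_const_smul, ENNReal.toReal_mul, l2norm]
  simp [abs_of_nonneg hh]

theorem IsConormalMeasure.absolutelyContinuous (hτ : IsConormalMeasure Ω ρ τ) :
    τ ≪ surfaceMeasure Ω := by
  obtain ⟨C, hC⟩ := hτ.le_surface
  exact (Measure.absolutelyContinuous_of_le hC).trans
    (Measure.AbsolutelyContinuous.rfl.smul_left C)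

theorem exists_isSolutionWithTraces (hΩ : IsSmoothBoundedDomain Ω ρ)
    (hτ : IsConormalMeasure Ω ρ τ) {lam : ℂ} {u v f η : EuclideanSpace ℝ (Fin d) → ℂ}
    {Du : Fin d → EuclideanSpace ℝ (Fin d) → ℂ}
    {D2u : Fin d → Fin d → EuclideanSpace ℝ (Fin d) → ℂ} (hu : IsH2 Ω u Du D2u)
    (hv : MemLp v 2 (volume.restrict Ω)) (hsol : SolvesHelmholtz Ω c n lam u Du D2u v)
    (hf : IsTrace Ω u Du f) (hη : IsNormalDerivative Ω ρ Du D2u η) :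
    ∃ γ, IsSolutionWithTraces Ω ρ τ c n lam u Du D2u v f γ η := by
  obtain ⟨γ, hγ, hηγ⟩ := hη
  exact ⟨γ, hf.hasTrace hτ hu.isH1, fun j => (hγ j).hasTrace hτ (hu.isH1_deriv j),
    fun i j => hu.second_deriv_comm hΩ i j, hv, hsol, hτ.absolutelyContinuous.ae_le hηγ⟩

/-- The bound on the normal derivative, in the norms of `L²(τ)`. -/
theorem exists_conormal_bound (hΩ : IsSmoothBoundedDomain Ω ρ) (hτ : IsConormalMeasure Ω ρ τ)
    (hne : (frontier Ω).Nonempty) (hc : IsC1Bounded Ω c) (hn : IsC1Bounded Ω n)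
    (hc_pos : ∀ x ∈ closure Ω, 0 < c x) (hn_pos : ∀ x ∈ closure Ω, 0 < n x) {k : ℝ} (hk : 0 < k) :
    ∃ C : ℝ, 0 < C ∧ ∀ (lam : ℂ), |lam.im| ≤ k → 1 ≤ lam.re →
      ∀ (u v f η : EuclideanSpace ℝ (Fin d) → ℂ) (Du γ G : Fin d → EuclideanSpace ℝ (Fin d) → ℂ)
        (D2u : Fin d → Fin d → EuclideanSpace ℝ (Fin d) → ℂ),
        IsSolutionWithTraces Ω ρ τ c n lam u Du D2u v f γ η → IsBoundaryH1 Ω ρ f G →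
        |lam.im| ^ 2 * (lam.re⁻¹ * l2norm τ η) ^ 2 ≤
          C * (l2norm (volume.restrict Ω) v ^ 2 +
            (l2norm τ f ^ 2 + (lam.re⁻¹ * √(∑ i, l2norm τ (G i) ^ 2)) ^ 2)) := by
  obtain ⟨M₁, m₁, hM₁, hm₁, hE⟩ := exists_energy_estimates hΩ hτ hc hn hc_pos hn_pos
  obtain ⟨M₂, m₂, hM₂, hm₂, hG⟩ := exists_rellichBoundary_ge (n := n) hΩ hτ hne hc hc_pos
  obtain ⟨M₃, hM₃, hR⟩ := exists_rellichBoundary_le hΩ hτ hc hn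
  obtain ⟨C, hC, hbound⟩ := exists_bound_of_estimates hM₁ hm₁ hM₂ hM₃ hm₂ hk
  refine ⟨C, hC, fun lam him hre u v f η Du γ G D2u hu hfG => ?_⟩
  have hre0 : 0 < lam.re := by linarith
  obtain ⟨e1, e2⟩ := hE lam u v f η Du γ D2u hu
  have e3 := hG lam u v f η Du γ G D2u hu hfG
  have e4 := hR lam u v f η Du γ D2u hu
  have hsq : |(lam ^ 2).im| = 2 * lam.re * |lam.im| := by
    have : (lam ^ 2).im = 2 * lam.re * lam.im := by simp [pow_two]; ring
    rw [this, abs_mul, abs_of_pos (by positivity)]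
  have hnorm : ‖lam‖ ≤ (1 + k) * lam.re := by
    have h1 := Complex.norm_le_abs_re_add_abs_im lam
    rw [abs_of_pos hre0] at h1
    have h2 : k ≤ k * lam.re := le_mul_of_one_le_right hk.le hre
    linarith
  have hcancel : ∀ t : ℝ, lam.re * (lam.re⁻¹ * t) = t := fun t => mul_inv_cancel_left₀ hre0.ne' t
  have hD0 : 0 ≤ ∑ j, l2norm (volume.restrict Ω) (Du j) ^ 2 :=
    Finset.sum_nonneg fun j _ => sq_nonneg _
  have hG0 : 0 ≤ ∑ j, l2norm τ (G j) ^ 2 := Finset.sum_nonneg fun j _ => sq_nonneg _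
  -- Here `w`, `δ` and `g` are the semiclassical quantities: the norms of `η`, of `∇u` and of the
  -- tangential gradient of `f`, each divided by `Re λ`.
  refine hbound lam.re |lam.im| ‖lam‖ (l2norm (volume.restrict Ω) u) _ _ _
    (lam.re⁻¹ * √(∑ j, l2norm (volume.restrict Ω) (Du j) ^ 2)) _ hre (abs_nonneg _) him
    (norm_nonneg _) hnorm (l2norm_nonneg _ _) (l2norm_nonneg _ _)
    (mul_nonneg (inv_nonneg.2 hre0.le) (l2norm_nonneg _ _)) (l2norm_nonneg _ _) (by positivity)
    ?_ ?_ ?_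
  · rw [hcancel, ← hsq]
    exact e1
  · rw [hcancel, hcancel, Real.sq_sqrt hD0]
    exact e2
  · rw [hcancel, hcancel, hcancel, ← hsq, Real.sq_sqrt hG0]
    exact e3.trans (add_le_add_right e4 _)

/-- Replacing `τ` by the surface measure on the right-hand side of the bound. -/
theorem IsConormalMeasure.exists_norm_le_boundaryH1Norm (hτ : IsConormalMeasure Ω ρ τ) :
    ∃ A : ℝ, 0 ≤ A ∧ ∀ (h : ℝ) (f : EuclideanSpace ℝ (Fin d) → ℂ)
      (G : Fin d → EuclideanSpace ℝ (Fin d) → ℂ), 0 ≤ h → IsBoundaryH1 Ω ρ f G →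
      l2norm τ f ^ 2 + (h * √(∑ i, l2norm τ (G i) ^ 2)) ^ 2 ≤ A * boundaryH1Norm Ω h f G ^ 2 := by
  obtain ⟨C, hC⟩ := hτ.le_surface
  have hA : 0 ≤ (C : ℝ) ^ (1 / 2 : ℝ) := by positivity
  refine ⟨((C : ℝ) ^ (1 / 2 : ℝ)) ^ 2, by positivity, fun h f G hh hf => ?_⟩
  have hle : ∀ w : EuclideanSpace ℝ (Fin d) → ℂ, MemLp w 2 (surfaceMeasure Ω) →
      l2norm τ w ^ 2 ≤ ((C : ℝ) ^ (1 / 2 : ℝ)) ^ 2 * l2norm (surfaceMeasure Ω) w ^ 2 := by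
    intro w hw
    rw [← mul_pow]
    exact pow_le_pow_left₀ (l2norm_nonneg _ _) (l2norm_le_of_le_smul hC hw) 2
  rw [boundaryH1Norm, Real.sq_sqrt (add_nonneg (sq_nonneg _)
    (Finset.sum_nonneg fun i _ => sq_nonneg _)), mul_pow,
    Real.sq_sqrt (Finset.sum_nonneg fun i _ => sq_nonneg _), mul_add, Finset.mul_sum,
    Finset.mul_sum]
  refine add_le_add (hle f hf.1) (Finset.sum_le_sum fun i _ => ?_)
  rw [l2norm_const_mul _ h hh, mul_pow, mul_left_comm]
  exact mul_le_mul_of_nonneg_left (hle (G i) (hf.2.1 i)) (sq_nonneg h)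

end NormalDerivative

end Helmholtz

end

/-! ### From `τ` back to the surface measure -/

theorem theorem3p3 {d : ℕ} (hd : 2 ≤ d)
    (Ω : Set (EuclideanSpace ℝ (Fin d))) (ρ : EuclideanSpace ℝ (Fin d) → ℝ)
    (hΩ : Helmholtz.IsSmoothBoundedDomain Ω ρ)
    (c n : EuclideanSpace ℝ (Fin d) → ℝ)
    (hc : ContDiffOn ℝ ∞ c (closure Ω)) (hn : ContDiffOn ℝ ∞ n (closure Ω))
    (hc_pos : ∀ x ∈ closure Ω, 0 < c x) (hn_pos : ∀ x ∈ closure Ω, 0 < n x)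
    (k : ℝ) (hk : 0 < k) :
    ∃ C : ℝ, 0 < C ∧
      ∀ lam : ℂ, |lam.im| ≤ k → 1 ≤ lam.re → lam.im ≠ 0 →
      ∀ (u : EuclideanSpace ℝ (Fin d) → ℂ)
        (Du : Fin d → EuclideanSpace ℝ (Fin d) → ℂ)
        (D2u : Fin d → Fin d → EuclideanSpace ℝ (Fin d) → ℂ)
        (v : EuclideanSpace ℝ (Fin d) → ℂ)
        (f : EuclideanSpace ℝ (Fin d) → ℂ)
        (G : Fin d → EuclideanSpace ℝ (Fin d) → ℂ)
        (η : EuclideanSpace ℝ (Fin d) → ℂ),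
        Helmholtz.IsH2 Ω u Du D2u →
        MemLp v 2 (volume.restrict Ω) →
        Helmholtz.SolvesHelmholtz Ω c n lam u Du D2u v →
        Helmholtz.IsTrace Ω u Du f →
        Helmholtz.IsBoundaryH1 Ω ρ f G →
        Helmholtz.IsNormalDerivative Ω ρ Du D2u η →
        Helmholtz.l2norm (Helmholtz.surfaceMeasure Ω) (fun x => (((lam.re)⁻¹ : ℝ) : ℂ) * η x) ≤
          C * |lam.im|⁻¹ *
            (Helmholtz.l2norm (volume.restrict Ω) v +
              Helmholtz.boundaryH1Norm Ω (lam.re)⁻¹ f G) := by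

  obtain ⟨m, rfl⟩ : ∃ m, d = m + 1 := ⟨d - 1, by omega⟩
  obtain ⟨τ, hτ⟩ := Helmholtz.exists_isConormalMeasure hΩ
  obtain ⟨C, hC, hbound⟩ := Helmholtz.exists_conormal_bound hΩ hτ
    (hΩ.nonempty_frontier (by omega))
    (Helmholtz.IsC1Bounded.of_contDiffOn hΩ.isOpen hΩ.isCompact_closure hc)
    (Helmholtz.IsC1Bounded.of_contDiffOn hΩ.isOpen hΩ.isCompact_closure hn) hc_pos hn_pos hk
  obtain ⟨A, hA, hAbound⟩ := hτ.exists_norm_le_boundaryH1Norm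
  obtain ⟨B, hB⟩ := hτ.surface_le
  -- `A` transfers the boundary data from `τ` to the surface measure and `B` transfers `η` back; `1
  -- + A` bounds `V ^ 2 + A * N ^ 2` by `(1 + A) * (V + N) ^ 2`. The summand `1` only secures
  -- positivity, as `B` is merely nonnegative.
  refine ⟨(B : ℝ) ^ (1 / 2 : ℝ) * √(C * (1 + A)) + 1, by positivity, ?_⟩
  intro lam him hre him0 u Du D2u v f G η hu hv hsol hf hG hη
  obtain ⟨γ, hsys⟩ := Helmholtz.exists_isSolutionWithTraces hΩ hτ hu hv hsol hf hη
  have hh : 0 ≤ lam.re⁻¹ := inv_nonneg.2 (by linarith)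
  have ha : 0 < |lam.im| := abs_pos.2 him0
  have h1 := hbound lam him hre u v f η Du γ G D2u hsys hG
  have h2 := hAbound lam.re⁻¹ f G hh hG
  have hηB := Helmholtz.l2norm_le_of_le_smul hB (Helmholtz.memLp_innerNormal hΩ hτ hsys)
  rw [Helmholtz.l2norm_const_mul _ _ hh]
  set V := Helmholtz.l2norm (volume.restrict Ω) v
  set N := Helmholtz.boundaryH1Norm Ω lam.re⁻¹ f G
  set w := lam.re⁻¹ * Helmholtz.l2norm τ η with hw
  have hV : 0 ≤ V := Helmholtz.l2norm_nonneg _ _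
  have hN : 0 ≤ N := Real.sqrt_nonneg _
  have h3 : |lam.im| * w ≤ √(C * (1 + A)) * (V + N) := by
    refine le_of_sq_le_sq ?_ (by positivity)
    rw [mul_pow _ w, mul_pow √_, Real.sq_sqrt (by positivity), mul_assoc]
    refine h1.trans (mul_le_mul_of_nonneg_left ?_ hC.le)
    have h4 : 0 ≤ V * N := mul_nonneg hV hN
    have h5 : 0 ≤ A * (V ^ 2 + 2 * (V * N)) := by positivity
    nlinarith [sq_nonneg N]
  have h4 : lam.re⁻¹ * Helmholtz.l2norm (Helmholtz.surfaceMeasure Ω) η ≤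
      (B : ℝ) ^ (1 / 2 : ℝ) * w := by
    rw [hw, mul_left_comm]
    exact mul_le_mul_of_nonneg_left hηB hh
  have h5 : w ≤ √(C * (1 + A)) * |lam.im|⁻¹ * (V + N) := by
    rw [← div_eq_mul_inv, div_mul_eq_mul_div, le_div_iff₀ ha, mul_comm w]
    exact h3
  calc _ ≤ (B : ℝ) ^ (1 / 2 : ℝ) * w := h4
    _ ≤ (B : ℝ) ^ (1 / 2 : ℝ) * (√(C * (1 + A)) * |lam.im|⁻¹ * (V + N)) :=
        mul_le_mul_of_nonneg_left h5 (by positivity)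
    _ = (B : ℝ) ^ (1 / 2 : ℝ) * √(C * (1 + A)) * |lam.im|⁻¹ * (V + N) := by ring
    _ ≤ _ := by
        gcongr
        linarith
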